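/- All represented spaces and multivalued functions are as in computable analysis, and computability on $\mathbb{N}^{\mathbb{N}}$ is Type-2 computability. For multivalued functions $f,g$ between represented spaces, $f \leq_{\mathrm W} g$ (Weihrauch reducibility) means that there are computable partial functions $H, K$ on $\mathbb{N}^{\mathbb{N}}$ such that $p \mapsto K\langle p, G(H(p))\rangle$ realizes $f$ for every realizer $G$ of $g$; $f <_{\mathrm W} g$ means $f \leq_{\mathrm W} g$ and $g \not\leq_{\mathrm W} f$; and $f \equiv_{\mathrm W} g$ means $f \leq_{\mathrm W} g$ and $g \leq_{\mathrm W} f$. The finite parallelization $f^*$ takes a finite tuple $(x_1,\dots,x_n)$, $n \geq 0$, of points of $\operatorname{dom} f$ and returns a tuple $(y_1,\dots,y_n)$ with $y_i \in f(x_i)$ for all $i$. Let $\mathrm{AoUC}_{[0,1]}$ (All-or-Unique choice) be the problem whose inputs are the closed sets $A \subseteq [0,1]$ that are either equal to $[0,1]$ or a singleton, given by negative information (an enumeration of rational open intervals whose union has intersection $[0,1] \setminus A$ with $[0,1]$), and whose valid outputs are the points of $A$. Let $\mathrm{BRoot} : \mathbb{R}[X] \rightrightarrows [0,1]$ map a real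 polynomial, given by an upper bound on its degree together with the corresponding tuple of real coefficients (each given by rational approximations with error less than $2^{-n}$), to any of its roots in $[0,1]$ if it has one there, and to any point of $[0,1]$ otherwise. Then $$\mathrm{AoUC}_{[0,1]} <_{\mathrm W} \mathrm{BRoot} <_{\mathrm W} \mathrm{AoUC}_{[0,1]}^*, \qquad\text{and hence}\qquad \mathrm{AoUC}_{[0,1]}^* \equiv_{\mathrm W} \mathrm{BRoot}^*.$$ -/

import Mathlib

namespace Weihrauch

/-- Baire space, the space of names. -/
abbrev Baire : Type := ℕ → ℕ

/-- The word consisting of the first `n` entries of `p`. -/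
def initialWord (p : Baire) (n : ℕ) : List ℕ := (List.range n).map p

/-- A partial function on Baire space is (Type-2) computable if some computable word function,
monotone for the prefix order, approximates it: on longer and longer prefixes of an input `p` in
the domain it produces longer and longer prefixes of the output. -/
def IsComputable (F : Baire →. Baire) : Prop :=
  ∃ g : List ℕ → List ℕ, Computable g ∧ (∀ u v, u <+: v → g u <+: g v) ∧
    ∀ p, ∀ q ∈ F p, ∀ n, ∃ m, initialWord q n <+: g (initialWord p m)

/-- The pairing of two points of Baire space, by interleaving. -/
def interleave (p q : Baire) : Baire := fun n => if n % 2 = 0 then p (n / 2) else q (n / 2)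

/-- A represented space: a set with a partial surjection from Baire space, given by its graph;
`IsName p x` says that `p` is a name of `x`. -/
class RepresentedSpace (X : Type*) where
  IsName : Baire → X → Prop
  unique : ∀ {p x y}, IsName p x → IsName p y → x = y
  surj : ∀ x, ∃ p, IsName p x

open RepresentedSpace

/-- A multivalued function `f` is given by its sets of valid outputs; its domain is the set of
all `x` with `f x` nonempty. `F` realizes `f` if it maps every name of every point `x` of the
domain to a name of a valid output. -/
def Realizes {X Y : Type*} [RepresentedSpace X] [RepresentedSpace Y]
    (F : Baire →. Baire) (f : X → Set Y) : Prop :=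
  ∀ p x, IsName p x → (f x).Nonempty → ∃ q ∈ F p, ∃ y ∈ f x, IsName q y

/-- Weihrauch reducibility: there are computable `H`, `K` such that `p ↦ K ⟨p, G (H p)⟩`
realizes `f` whenever `G` realizes `g`. -/
def Reducible {X Y Z W : Type*} [RepresentedSpace X] [RepresentedSpace Y]
    [RepresentedSpace Z] [RepresentedSpace W] (f : X → Set Y) (g : Z → Set W) : Prop :=
  ∃ H K : Baire →. Baire, IsComputable H ∧ IsComputable K ∧
    ∀ G : Baire →. Baire, Realizes G g →
      Realizes (fun p => (H p).bind fun h => (G h).bind fun q => K (interleave p q)) f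

/-- Strict Weihrauch reducibility. -/
def StrictlyReducible {X Y Z W : Type*} [RepresentedSpace X] [RepresentedSpace Y]
    [RepresentedSpace Z] [RepresentedSpace W] (f : X → Set Y) (g : Z → Set W) : Prop :=
  Reducible f g ∧ ¬ Reducible g f

/-- Weihrauch equivalence. -/
def Equivalent {X Y Z W : Type*} [RepresentedSpace X] [RepresentedSpace Y]
    [RepresentedSpace Z] [RepresentedSpace W] (f : X → Set Y) (g : Z → Set W) : Prop :=
  Reducible f g ∧ Reducible g f

/-- A numbering of the rationals: `⟨⟨a, b⟩, c⟩ ↦ (a - b) / (c + 1)`. -/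
def ratOf (n : ℕ) : ℚ :=
  ((n.unpair.1.unpair.1 : ℚ) - (n.unpair.1.unpair.2 : ℚ)) / ((n.unpair.2 : ℚ) + 1)

theorem ratOf_surjective : Function.Surjective ratOf := by
  intro r
  refine ⟨Nat.pair (Nat.pair r.num.toNat (-r.num).toNat) (r.den - 1), ?_⟩
  have h1 : ((r.num.toNat : ℚ) - ((-r.num).toNat : ℚ)) = (r.num : ℚ) := by
    exact_mod_cast Int.toNat_sub_toNat_neg r.num
  have h2 : (((r.den - 1 : ℕ) : ℚ) + 1) = (r.den : ℚ) := by
    exact_mod_cast Nat.sub_add_cancel r.den_pos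
  simp only [ratOf, Nat.unpair_pair, h1, h2]
  exact Rat.num_div_den r

/-- Real numbers: a name of `x` is a sequence of (indices of) rationals, the `n`-th of which
differs from `x` by less than `2⁻ⁿ`. -/
instance instReal : RepresentedSpace ℝ where
  IsName p x := ∀ n : ℕ, |(ratOf (p n) : ℝ) - x| < 2⁻¹ ^ n
  unique := by
    intro p x y hx hy
    by_contra hne
    have hpos : 0 < |x - y| := abs_pos.2 (sub_ne_zero.2 hne)
    obtain ⟨n, hn⟩ := exists_pow_lt_of_lt_one (half_pos hpos) (show (2⁻¹ : ℝ) < 1 by norm_num)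
    have h1 := hx n
    have h2 := hy n
    have h3 := abs_sub_le x (ratOf (p n) : ℝ) y
    rw [abs_sub_comm x (ratOf (p n) : ℝ)] at h3
    linarith
  surj := by
    intro x
    have h : ∀ n : ℕ, ∃ k : ℕ, |(ratOf k : ℝ) - x| < 2⁻¹ ^ n := by
      intro n
      obtain ⟨r, hr1, hr2⟩ := exists_rat_btwn (show x - 2⁻¹ ^ n < x by
        have : (0 : ℝ) < 2⁻¹ ^ n := by positivity
        linarith)
      obtain ⟨k, rfl⟩ := ratOf_surjective r
      exact ⟨k, by rw [abs_lt]; constructor <;> linarith⟩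
    choose p hp using h
    exact ⟨p, hp⟩

/-- The unit interval, as a subspace of the reals. -/
instance instUnitInterval : RepresentedSpace unitInterval where
  IsName p x := IsName p (x : ℝ)
  unique := fun hx hy => Subtype.ext (unique hx hy)
  surj := fun x => surj (x : ℝ)

/-- Closed subsets of the unit interval, by negative information: a name of `A` lists open
intervals with rational endpoints (possibly empty ones) whose union meets `[0,1]` exactly in the
complement of `A`. -/
instance instCloseds : RepresentedSpace (TopologicalSpace.Closeds unitInterval) where
  IsName p A := ∀ x : unitInterval, x ∉ A ↔
    ∃ n, (x : ℝ) ∈ Set.Ioo (ratOf (p n).unpair.1 : ℝ) (ratOf (p n).unpair.2 : ℝ)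
  unique := by
    intro p A B hA hB
    ext x
    exact not_iff_not.1 ((hA x).trans (hB x).symm)
  surj := by
    classical
    intro A
    let good : ℕ → Prop := fun n => ∀ y : unitInterval,
      (y : ℝ) ∈ Set.Ioo (ratOf n.unpair.1 : ℝ) (ratOf n.unpair.2 : ℝ) → y ∉ A
    refine ⟨fun n => if good n then n else Nat.pair 0 0, fun x => ⟨fun hx => ?_, ?_⟩⟩
    · have hopen : IsOpen (A : Set unitInterval)ᶜ := A.isClosed.isOpen_compl
      obtain ⟨ε, hε, hball⟩ := Metric.isOpen_iff.1 hopen x hx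
      obtain ⟨r, hr1, hr2⟩ := exists_rat_btwn (show (x : ℝ) - ε < x by linarith)
      obtain ⟨s, hs1, hs2⟩ := exists_rat_btwn (show (x : ℝ) < x + ε by linarith)
      obtain ⟨a, rfl⟩ := ratOf_surjective r
      obtain ⟨b, rfl⟩ := ratOf_surjective s
      have hgood : good (Nat.pair a b) := by
        intro y hy
        simp only [Nat.unpair_pair, Set.mem_Ioo] at hy
        refine hball ?_
        rw [Metric.mem_ball, Subtype.dist_eq, Real.dist_eq, abs_lt]
        constructor <;> linarith [hy.1, hy.2]
      refine ⟨Nat.pair a b, ?_⟩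
      simp only [if_pos hgood, Nat.unpair_pair]
      exact ⟨hr2, hs1⟩
    · rintro ⟨n, hn⟩
      by_cases h : good n
      · simp only [if_pos h] at hn
        exact h x hn
      · simp only [if_neg h, Nat.unpair_pair] at hn
        exact absurd (hn.1.trans hn.2) (lt_irrefl _)

/-- The `i`-th component of the sequence of names stored in `p` behind its first entry. -/
def component (p : Baire) (i : ℕ) : Baire := fun k => p (Nat.pair i k + 1)

theorem exists_components (n : ℕ) (c : ℕ → Baire) :
    ∃ p : Baire, p 0 = n ∧ ∀ i, component p i = c i :=
  ⟨fun m => Nat.casesOn m n fun m => c m.unpair.1 m.unpair.2, rfl, fun i => by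
    funext k
    simp [component]⟩

/-- Real polynomials: a name provides an upper bound `d = p 0` of the degree, followed by names
of the coefficients of degrees `0, …, d`. -/
instance instPolynomial : RepresentedSpace (Polynomial ℝ) where
  IsName p P := P.natDegree ≤ p 0 ∧ ∀ i ≤ p 0, IsName (component p i) (P.coeff i)
  unique := by
    intro p P Q hP hQ
    ext i
    by_cases hi : i ≤ p 0
    · exact unique (hP.2 i hi) (hQ.2 i hi)
    · rw [Polynomial.coeff_eq_zero_of_natDegree_lt (by have := hP.1; omega),
        Polynomial.coeff_eq_zero_of_natDegree_lt (by have := hQ.1; omega)]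
  surj := by
    intro P
    choose c hc using fun i => surj (P.coeff i)
    obtain ⟨p, h0, hp⟩ := exists_components P.natDegree c
    exact ⟨p, h0.ge, fun i _ => by rw [hp i]; exact hc i⟩

/-- Finite tuples of arbitrary length `n ≥ 0`: a name provides the length, followed by names of
the entries. -/
instance instTuples {X : Type*} [RepresentedSpace X] :
    RepresentedSpace (Σ n : ℕ, Fin n → X) where
  IsName p t := p 0 = t.1 ∧ ∀ i : Fin t.1, IsName (component p i) (t.2 i)
  unique := by
    rintro p ⟨n, x⟩ ⟨m, y⟩ ⟨h1, hx⟩ ⟨h2, hy⟩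
    obtain rfl : n = m := h1.symm.trans h2
    have : x = y := funext fun i => unique (hx i) (hy i)
    rw [this]
  surj := by
    rintro ⟨n, x⟩
    choose c hc using fun i => surj (x i)
    obtain ⟨p, h0, hp⟩ := exists_components n
      (fun i => if h : i < n then c ⟨i, h⟩ else fun _ => 0)
    refine ⟨p, h0, fun i => ?_⟩
    rw [hp i, dif_pos i.2]
    exact hc i

/-- The finite parallelization `f^*`: given finitely many instances of `f`, solve all of them. -/
def Parallel {X Y : Type*} (f : X → Set Y) (t : Σ n : ℕ, Fin n → X) :
    Set (Σ n : ℕ, Fin n → Y) :=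
  {s | ∃ y : Fin t.1 → Y, s = ⟨t.1, y⟩ ∧ ∀ i, y i ∈ f (t.2 i)}

/-- All-or-Unique choice on `[0,1]`: closed choice restricted to the closed sets which are either
all of `[0,1]` or a singleton. -/
def AoUC (A : TopologicalSpace.Closeds unitInterval) : Set unitInterval :=
  {x | ((A : Set unitInterval) = Set.univ ∨ ∃ a, (A : Set unitInterval) = {a}) ∧ x ∈ A}

/-- Bounded root finding: a root in `[0,1]` if there is one, and any point of `[0,1]` if not. -/
def BRoot (P : Polynomial ℝ) : Set unitInterval :=
  {x | (∃ y : unitInterval, P.eval (y : ℝ) = 0) → P.eval (x : ℝ) = 0}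

end Weihrauch

/-! ### Primitive recursion by `fun_prop` -/

attribute [fun_prop] Primrec Primrec.id Primrec.const Primrec.comp Primrec.fst Primrec.snd
  Primrec.pair

namespace Primrec

variable {α β γ : Type*} [Primcodable α] [Primcodable β] [Primcodable γ]

@[fun_prop] theorem add_fun {f g : α → ℕ} (hf : Primrec f) (hg : Primrec g) :
    Primrec fun a => f a + g a := nat_add.comp hf hg

@[fun_prop] theorem sub_fun {f g : α → ℕ} (hf : Primrec f) (hg : Primrec g) :
    Primrec fun a => f a - g a := nat_sub.comp hf hg

@[fun_prop] theorem mul_fun {f g : α → ℕ} (hf : Primrec f) (hg : Primrec g) :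
    Primrec fun a => f a * g a := nat_mul.comp hf hg

@[fun_prop] theorem div_fun {f g : α → ℕ} (hf : Primrec f) (hg : Primrec g) :
    Primrec fun a => f a / g a := nat_div.comp hf hg

@[fun_prop] theorem mod_fun {f g : α → ℕ} (hf : Primrec f) (hg : Primrec g) :
    Primrec fun a => f a % g a := nat_mod.comp hf hg

@[fun_prop] theorem natPair_fun {f g : α → ℕ} (hf : Primrec f) (hg : Primrec g) :
    Primrec fun a => Nat.pair (f a) (g a) := Primrec₂.natPair.comp hf hg

@[fun_prop] theorem unpair_fun {f : α → ℕ} (hf : Primrec f) :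
    Primrec fun a => (f a).unpair := unpair.comp hf

@[fun_prop] theorem ble_fun {f g : α → ℕ} (hf : Primrec f) (hg : Primrec g) :
    Primrec fun a => Nat.ble (f a) (g a) :=
  ((nat_le.comp hf hg).decide).of_eq fun a => by
    rw [Bool.eq_iff_iff, decide_eq_true_iff, Nat.ble_eq]

@[fun_prop] theorem blt_fun {f g : α → ℕ} (hf : Primrec f) (hg : Primrec g) :
    Primrec fun a => Nat.blt (f a) (g a) :=
  show Primrec fun a => Nat.ble (f a + 1) (g a) by fun_prop

@[fun_prop] theorem and_fun {f g : α → Bool} (hf : Primrec f) (hg : Primrec g) :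
    Primrec fun a => f a && g a := (dom_bool₂ (· && ·)).comp hf hg

@[fun_prop] theorem or_fun {f g : α → Bool} (hf : Primrec f) (hg : Primrec g) :
    Primrec fun a => f a || g a := (dom_bool₂ (· || ·)).comp hf hg

@[fun_prop] theorem not_fun {f : α → Bool} (hf : Primrec f) :
    Primrec fun a => !f a := Primrec.not.comp hf

@[fun_prop] theorem cond_fun {c : α → Bool} {f g : α → β} (hc : Primrec c) (hf : Primrec f)
    (hg : Primrec g) : Primrec fun a => bif c a then f a else g a := cond hc hf hg

@[fun_prop] theorem some_fun {f : α → β} (hf : Primrec f) :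
    Primrec fun a => some (f a) := option_some.comp hf

@[fun_prop] theorem rec_fun {n : α → ℕ} {f : α → β} {g : α → ℕ → β → β} (hn : Primrec n)
    (hf : Primrec f) (hg : Primrec fun x : α × ℕ × β => g x.1 x.2.1 x.2.2) :
    Primrec fun a => Nat.rec (motive := fun _ => β) (f a) (g a) (n a) :=
  nat_rec' (h := fun a x => g a x.1 x.2) hn hf hg

@[fun_prop] theorem getD_fun {f : α → List ℕ} {g : α → ℕ} (hf : Primrec f) (hg : Primrec g) :
    Primrec fun a => (f a).getD (g a) 0 := (list_getD 0).comp hf hg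

@[fun_prop] theorem getElem?_fun {f : α → List ℕ} {g : α → ℕ} (hf : Primrec f)
    (hg : Primrec g) : Primrec fun a => (f a)[g a]? := list_getElem?.comp hf hg

@[fun_prop] theorem length_fun {f : α → List ℕ} (hf : Primrec f) :
    Primrec fun a => (f a).length := list_length.comp hf

end Primrec

namespace Weihrauch

open RepresentedSpace

/-! ### Finite words and computable functions on Baire space -/

@[simp] theorem length_initialWord (p : Baire) (n : ℕ) : (initialWord p n).length = n := by
  simp [initialWord]

theorem initialWord_succ (p : Baire) (n : ℕ) : initialWord p (n + 1) = initialWord p n ++ [p n] := by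
  simp [initialWord, List.range_succ]

theorem getElem?_initialWord {p : Baire} {n k : ℕ} (h : k < n) :
    (initialWord p n)[k]? = some (p k) := by
  simp [initialWord, h]

theorem getElem?_initialWord_eq_some {p : Baire} {n k v : ℕ}
    (h : (initialWord p n)[k]? = some v) : k < n ∧ p k = v := by
  have hk : k < n := by simpa using (List.getElem?_eq_some_iff.1 h).1
  rw [getElem?_initialWord hk] at h
  exact ⟨hk, by simpa using h⟩

theorem getD_initialWord {p : Baire} {n k : ℕ} (h : k < n) :
    (initialWord p n).getD k 0 = p k := by
  rw [List.getD_eq_getElem?_getD, getElem?_initialWord h, Option.getD_some]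

theorem initialWord_prefix (p : Baire) {m n : ℕ} (h : m ≤ n) :
    initialWord p m <+: initialWord p n := by
  induction n, h using Nat.le_induction with
  | base => exact List.prefix_rfl
  | succ n _ ih => exact ih.trans (by rw [initialWord_succ]; exact List.prefix_append _ _)

theorem initialWord_congr {p q : Baire} {n : ℕ} (h : ∀ k < n, p k = q k) :
    initialWord p n = initialWord q n := by
  refine List.map_congr_left fun k hk => h k (List.mem_range.1 hk)

theorem getElem?_of_prefix {u v : List ℕ} (h : u <+: v) {k x : ℕ} (hx : u[k]? = some x) :
    v[k]? = some x := by
  obtain ⟨t, rfl⟩ := h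
  rw [List.getElem?_append_left (List.getElem?_eq_some_iff.1 hx).1, hx]

/-- The longest word, of length at most `n`, whose entries are listed by the partial sequence
`b`. -/
def wordOf (b : ℕ → Option ℕ) (n : ℕ) : List ℕ :=
  Nat.rec [] (fun k w => bif Nat.ble k w.length then w ++ (b k).toList else w) n

theorem wordOf_succ (b : ℕ → Option ℕ) (n : ℕ) :
    wordOf b (n + 1) = bif Nat.ble n (wordOf b n).length then wordOf b n ++ (b n).toList
      else wordOf b n := rfl

theorem length_wordOf_le (b : ℕ → Option ℕ) (n : ℕ) : (wordOf b n).length ≤ n := by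
  induction n with
  | zero => simp [wordOf]
  | succ n ih =>
    rw [wordOf_succ]
    cases hb : b n <;> cases h : Nat.ble n (wordOf b n).length <;> simp <;> omega

theorem wordOf_prefix_succ (b : ℕ → Option ℕ) (n : ℕ) : wordOf b n <+: wordOf b (n + 1) := by
  rw [wordOf_succ]
  cases Nat.ble n (wordOf b n).length <;> simp

theorem wordOf_prefix {b b' : ℕ → Option ℕ} {n n' : ℕ}
    (h : ∀ i < n, ∀ v, b i = some v → b' i = some v) (hn : n ≤ n') :
    wordOf b n <+: wordOf b' n' := by
  suffices H : wordOf b n <+: wordOf b' n by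
    induction n', hn using Nat.le_induction with
    | base => exact H
    | succ m _ ih => exact ih.trans (wordOf_prefix_succ b' m)
  clear hn
  induction n with
  | zero => simp [wordOf]
  | succ n ih =>
    specialize ih fun i hi => h i (by omega)
    by_cases hl : n ≤ (wordOf b n).length
    · have h1 := length_wordOf_le b' n
      have h2 : wordOf b n = wordOf b' n := ih.eq_of_length (le_antisymm ih.length_le (by omega))
      rw [wordOf_succ, wordOf_succ, ← h2, Nat.ble_eq_true_of_le hl, cond_true, cond_true]
      cases hb : b n with
      | none => simp
      | some v => rw [h n (by omega) v hb]
    · have h1 : wordOf b (n + 1) = wordOf b n := by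
        rw [wordOf_succ, Bool.eq_false_iff.2 (fun hc => hl (Nat.le_of_ble_eq_true hc)), cond_false]
      rw [h1]
      exact ih.trans (wordOf_prefix_succ b' n)

theorem wordOf_some (q : Baire) (n : ℕ) : wordOf (fun i => some (q i)) n = initialWord q n := by
  induction n with
  | zero => simp [wordOf, initialWord]
  | succ n ih =>
    rw [wordOf_succ, ih, initialWord_succ, length_initialWord, Nat.ble_eq_true_of_le le_rfl]
    rfl

theorem initialWord_prefix_wordOf {q : Baire} {b : ℕ → Option ℕ} {n n' : ℕ}
    (h : ∀ i < n, b i = some (q i)) (hn : n ≤ n') : initialWord q n <+: wordOf b n' := by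
  rw [← wordOf_some]
  refine wordOf_prefix (fun i hi v hv => ?_) hn
  rw [h i hi, ← hv]

theorem computable_wordOf {α : Type*} [Primcodable α] {b : α → ℕ → Option ℕ} {n : α → ℕ}
    (hb : Computable₂ b) (hn : Computable n) : Computable fun a => wordOf (b a) (n a) := by
  refine Computable.nat_rec (h := fun a (x : ℕ × List ℕ) => bif Nat.ble x.1 x.2.length then
    x.2 ++ (b a x.1).toList else x.2) hn (Computable.const []) ?_
  have hw : Computable fun x : α × ℕ × List ℕ => x.2.2 := Computable.snd.comp Computable.snd
  refine Computable.cond ?_ ?_ hw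
  · exact (show Primrec fun x : α × ℕ × List ℕ => Nat.ble x.2.1 x.2.2.length by fun_prop).to_comp
  · exact Computable.list_append.comp hw (Primrec.optionToList.to_comp.comp
      (hb.comp Computable.fst (Computable.fst.comp Computable.snd)))

theorem eventually_of_exists {P : ℕ → Prop} (hP : ∀ m n, m ≤ n → P m → P n) (h : ∃ m, P m) :
    ∀ᶠ m in Filter.atTop, P m := by
  obtain ⟨m, hm⟩ := h
  exact Filter.eventually_atTop.2 ⟨m, fun n hn => hP m n hn hm⟩

/-- A function is computable if its values are enumerated entrywise by a monotone computable
function on words. -/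
theorem isComputable_of_entries {F : Baire →. Baire} {b : List ℕ → ℕ → Option ℕ}
    (hb : Computable₂ b) (hmono : ∀ u v, u <+: v → ∀ n x, b u n = some x → b v n = some x)
    (hF : ∀ p, ∀ q ∈ F p, ∀ n, ∃ m, b (initialWord p m) n = some (q n)) : IsComputable F := by
  refine ⟨fun w => wordOf (b w) w.length, computable_wordOf hb Computable.list_length,
    fun u v h => wordOf_prefix (fun i _ => hmono u v h i) h.length_le, fun p q hq n => ?_⟩
  have h1 : ∀ i, ∀ᶠ m in Filter.atTop, b (initialWord p m) i = some (q i) := fun i =>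
    eventually_of_exists (fun m k hmk => hmono _ _ (initialWord_prefix p hmk) _ _) (hF p q hq i)
  have h2 := (Filter.eventually_all_finset (Finset.range n)).2 fun i _ => h1 i
  obtain ⟨m, hm, hmn⟩ := (h2.and (Filter.eventually_ge_atTop n)).exists
  exact ⟨m, initialWord_prefix_wordOf (fun i hi => hm i (Finset.mem_range.2 hi)) (by simpa)⟩

theorem IsComputable.exists_entries {F : Baire →. Baire} (hF : IsComputable F) :
    ∃ b : List ℕ → ℕ → Option ℕ, Computable₂ b ∧
      (∀ u v, u <+: v → ∀ n x, b u n = some x → b v n = some x) ∧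
      ∀ p, ∀ q ∈ F p, ∀ n, ∃ m, b (initialWord p m) n = some (q n) := by
  obtain ⟨g, hg, hmono, hF⟩ := hF
  refine ⟨fun w n => (g w)[n]?, Computable.list_getElem?.comp (hg.comp Computable.fst)
    Computable.snd, fun u v h n x hx => getElem?_of_prefix (hmono u v h) hx, fun p q hq n => ?_⟩
  obtain ⟨m, hm⟩ := hF p q hq (n + 1)
  exact ⟨m, getElem?_of_prefix hm (getElem?_initialWord (Nat.lt_succ_self n))⟩

/-- The first value found by `a` on a prefix of the word `w`. -/
def firstValue (a : List ℕ → ℕ → Option ℕ) (w : List ℕ) (n : ℕ) : ℕ → Option ℕ :=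
  Nat.rec none fun m r => r <|> a (w.take m) n

theorem firstValue_succ (a : List ℕ → ℕ → Option ℕ) (w : List ℕ) (n m : ℕ) :
    firstValue a w n (m + 1) = (firstValue a w n m <|> a (w.take m) n) := rfl

theorem firstValue_mono {a : List ℕ → ℕ → Option ℕ} {u v : List ℕ} (h : u <+: v) {n m m' x : ℕ}
    (hm : m ≤ m') (hu : m ≤ u.length + 1) (hx : firstValue a u n m = some x) :
    firstValue a v n m' = some x := by
  induction m', hm using Nat.le_induction with
  | succ k _ ih => rw [firstValue_succ, ih]; rfl
  | base =>
    suffices H : firstValue a v n m = firstValue a u n m by rw [H, hx]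
    clear hx
    induction m with
    | zero => rfl
    | succ m ih =>
      obtain ⟨t, rfl⟩ := h
      rw [firstValue_succ, firstValue_succ, ih (by omega), List.take_append_of_le_length (by omega)]

theorem exists_of_firstValue {a : List ℕ → ℕ → Option ℕ} {w : List ℕ} {n m x : ℕ}
    (h : firstValue a w n m = some x) : ∃ k, a (w.take k) n = some x := by
  induction m with
  | zero => simp [firstValue] at h
  | succ m ih =>
    rw [firstValue_succ] at h
    cases h' : firstValue a w n m with
    | some y => rw [h'] at h ih; exact ih h
    | none => rw [h'] at h; exact ⟨m, h⟩

theorem take_initialWord (p : Baire) {m k : ℕ} : (initialWord p m).take k =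
    initialWord p (min k m) := by
  simp [initialWord, ← List.map_take, List.take_range]

/-- Unbounded search: if for every `n` some prefix of the input makes the computable function `a`
produce a value, then a sequence of such values can be computed. -/
theorem exists_isComputable_of_search {a : List ℕ → ℕ → Option ℕ} (ha : Computable₂ a) :
    ∃ F : Baire →. Baire, IsComputable F ∧ ∀ p : Baire,
      (∀ n, ∃ m, (a (initialWord p m) n).isSome) →
        ∃ q ∈ F p, ∀ n, ∃ m, a (initialWord p m) n = some (q n) := by
  classical
  let b : List ℕ → ℕ → Option ℕ := fun w n => firstValue a w n (w.length + 1)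
  let D : Baire → Prop := fun p => ∃ q : Baire, ∀ n, ∃ m, b (initialWord p m) n = some (q n)
  refine ⟨fun p => ⟨D p, fun h => h.choose⟩, ?_, fun p hp => ?_⟩
  · refine isComputable_of_entries (b := b) ?_ ?_ ?_
    · refine Computable.nat_rec (h := fun (x : List ℕ × ℕ) (y : ℕ × Option ℕ) =>
        (y.2 <|> a (x.1.take y.1) x.2)) (Computable.succ.comp (Computable.list_length.comp
          Computable.fst)) (Computable.const none) ?_
      have h1 : Computable fun z : (List ℕ × ℕ) × ℕ × Option ℕ => a (z.1.1.take z.2.1) z.1.2 :=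
        ha.comp (Primrec.list_take.to_comp.comp (Computable.fst.comp Computable.snd)
          (Computable.fst.comp Computable.fst)) (Computable.snd.comp Computable.fst)
      exact Primrec.option_orElse.to_comp.comp (Computable.snd.comp Computable.snd) h1
    · intro u v h n x hx
      exact firstValue_mono h (by have := h.length_le; omega) le_rfl hx
    · rintro p q ⟨h, rfl⟩ n
      exact h.choose_spec n
  · have hD : D p := by
      have h1 : ∀ n, ∃ x m, b (initialWord p m) n = some x := by
        intro n
        obtain ⟨m, hm⟩ := hp n
        obtain ⟨y, hy⟩ := Option.isSome_iff_exists.1 hm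
        have h2 : b (initialWord p m) n =
            (firstValue a (initialWord p m) n m <|> some y) := by
          change firstValue a (initialWord p m) n (_ + 1) = _
          rw [length_initialWord, firstValue_succ, take_initialWord, min_self, hy]
        cases h3 : firstValue a (initialWord p m) n m with
        | none => exact ⟨y, m, by rw [h2, h3]; rfl⟩
        | some x => exact ⟨x, m, by rw [h2, h3]; rfl⟩
      choose q hq using h1
      exact ⟨q, hq⟩
    refine ⟨hD.choose, ⟨hD, rfl⟩, fun n => ?_⟩
    obtain ⟨m, hm⟩ := hD.choose_spec n
    obtain ⟨k, hk⟩ := exists_of_firstValue hm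
    rw [take_initialWord] at hk
    exact ⟨_, hk⟩

theorem IsComputable.bind {F G : Baire →. Baire} (hF : IsComputable F) (hG : IsComputable G) :
    IsComputable fun p => (F p).bind G := by
  obtain ⟨f, hf, fmono, hF⟩ := hF
  obtain ⟨g, hg, gmono, hG⟩ := hG
  refine ⟨fun w => g (f w), hg.comp hf, fun u v h => gmono _ _ (fmono u v h),
    fun p r hr n => ?_⟩
  obtain ⟨q, hq, hr⟩ := Part.mem_bind_iff.1 hr
  obtain ⟨k, hk⟩ := hG q r hr n
  obtain ⟨m, hm⟩ := hF p q hq k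
  exact ⟨m, hk.trans (gmono _ _ hm)⟩

theorem isComputable_reindex {φ : ℕ → ℕ} (hφ : Primrec φ) :
    IsComputable fun p => Part.some fun n => p (φ n) := by
  refine isComputable_of_entries (b := fun w n => w[φ n]?)
    (show Primrec fun x : List ℕ × ℕ => x.1[φ x.2]? by fun_prop).to_comp
    (fun u v h n x hx => getElem?_of_prefix h hx) ?_
  intro p q hq n
  rw [Part.mem_some_iff.1 hq]
  exact ⟨φ n + 1, getElem?_initialWord (Nat.lt_succ_self _)⟩

theorem IsComputable.interleave {F G : Baire →. Baire} (hF : IsComputable F)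
    (hG : IsComputable G) :
    IsComputable fun p => (F p).bind fun q => (G p).map fun r => Weihrauch.interleave q r := by
  obtain ⟨f, hf, fmono, hF⟩ := hF.exists_entries
  obtain ⟨g, hg, gmono, hG⟩ := hG.exists_entries
  refine isComputable_of_entries
    (b := fun w n => bif Nat.ble (n % 2) 0 then f w (n / 2) else g w (n / 2)) ?_ ?_ ?_
  · have h : Computable fun x : List ℕ × ℕ => x.2 / 2 :=
      (show Primrec fun x : List ℕ × ℕ => x.2 / 2 by fun_prop).to_comp
    exact Computable.cond
      (show Primrec fun x : List ℕ × ℕ => Nat.ble (x.2 % 2) 0 by fun_prop).to_comp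
      (hf.comp Computable.fst h) (hg.comp Computable.fst h)
  · intro u v h n x
    cases Nat.ble (n % 2) 0
    · exact gmono u v h _ x
    · exact fmono u v h _ x
  · intro p s hs n
    obtain ⟨q, hq, hs⟩ := Part.mem_bind_iff.1 hs
    obtain ⟨r, hr, rfl⟩ := (Part.mem_map_iff _).1 hs
    by_cases hn : n % 2 = 0
    · simpa only [Weihrauch.interleave, hn, show Nat.ble 0 0 = true from rfl, cond_true,
        if_true] using hF p q hq (n / 2)
    · have : Nat.ble (n % 2) 0 = false := Bool.eq_false_iff.2 fun h => hn (by simpa using h)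
      simpa only [Weihrauch.interleave, hn, this, cond_false, if_false] using hG p r hr (n / 2)

/-- The component word: the known initial part of the `i`-th component. -/
def componentWord (w : List ℕ) (i : ℕ) : List ℕ :=
  wordOf (fun k => w[Nat.pair i k + 1]?) w.length

theorem componentWord_prefix {u v : List ℕ} (h : u <+: v) (i : ℕ) :
    componentWord u i <+: componentWord v i :=
  wordOf_prefix (fun _ _ _ hx => getElem?_of_prefix h hx) h.length_le

theorem initialWord_component_prefix (p : Baire) (i n : ℕ) :
    initialWord (component p i) n <+: componentWord (initialWord p (Nat.pair i n + 1)) i := by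
  refine initialWord_prefix_wordOf (fun k hk => ?_) ?_
  · have := Nat.pair_lt_pair_right i hk
    rw [getElem?_initialWord (by omega)]
    rfl
  · rw [length_initialWord]
    have := Nat.right_le_pair i n
    omega

/-- Apply `F` to each of the components listed by `p`. -/
noncomputable def componentwise (F : Baire →. Baire) : Baire →. Baire := fun p =>
  ⟨∃ r : Baire, r 0 = p 0 ∧ (∀ i < p 0, component r i ∈ F (component p i)) ∧
    ∀ i, p 0 ≤ i → ∀ k, component r i k = 0, fun h => h.choose⟩

theorem exists_mem_componentwise {F : Baire →. Baire} {p : Baire} {c : ℕ → Baire}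
    (hc : ∀ i < p 0, c i ∈ F (component p i)) :
    ∃ r ∈ componentwise F p, r 0 = p 0 ∧ ∀ i < p 0, component r i = c i := by
  have hex : ∃ r : Baire, r 0 = p 0 ∧ (∀ i < p 0, component r i ∈ F (component p i)) ∧
      ∀ i, p 0 ≤ i → ∀ k, component r i k = 0 := by
    obtain ⟨r, h0, hr⟩ := exists_components (p 0) (fun i => if i < p 0 then c i else fun _ => 0)
    refine ⟨r, h0, fun i hi => ?_, fun i hi k => ?_⟩
    · rw [hr, if_pos hi]; exact hc i hi
    · rw [hr, if_neg (by omega)]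
  refine ⟨hex.choose, ⟨hex, rfl⟩, hex.choose_spec.1, fun i hi => ?_⟩
  exact Part.mem_unique (hex.choose_spec.2.1 i hi) (hc i hi)

theorem IsComputable.componentwise {F : Baire →. Baire} (hF : IsComputable F) :
    IsComputable (componentwise F) := by
  obtain ⟨f, hf, fmono, hF⟩ := hF
  refine isComputable_of_entries (b := fun w n => bif Nat.ble n 0 then w[0]? else
    bif Nat.ble 1 w.length then bif Nat.blt (n - 1).unpair.1 (w.getD 0 0) then
      (f (componentWord w (n - 1).unpair.1))[(n - 1).unpair.2]? else some 0 else none) ?_ ?_ ?_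
  · have h1 : Computable fun x : List ℕ × ℕ => (x.2 - 1).unpair.1 :=
      (show Primrec fun x : List ℕ × ℕ => (x.2 - 1).unpair.1 by fun_prop).to_comp
    have h2 : Computable fun x : List ℕ × ℕ => (x.2 - 1).unpair.2 :=
      (show Primrec fun x : List ℕ × ℕ => (x.2 - 1).unpair.2 by fun_prop).to_comp
    have h3 : Computable fun x : List ℕ × ℕ => componentWord x.1 (x.2 - 1).unpair.1 :=
      computable_wordOf (b := fun (x : List ℕ × ℕ) k => x.1[Nat.pair (x.2 - 1).unpair.1 k + 1]?)
        (show Primrec fun z : (List ℕ × ℕ) × ℕ =>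
          z.1.1[Nat.pair (z.1.2 - 1).unpair.1 z.2 + 1]? by fun_prop).to_comp
        (Computable.list_length.comp Computable.fst)
    refine Computable.cond (Primrec.to_comp (by fun_prop)) (Primrec.to_comp (by fun_prop))
      (Computable.cond (Primrec.to_comp (by fun_prop)) (Computable.cond
        (Primrec.to_comp (by fun_prop)) (Computable.list_getElem?.comp (hf.comp h3) h2)
        (Computable.const _)) (Computable.const _))
  · intro u v h n x
    cases Nat.ble n 0
    · simp only [cond_false]
      cases hu : Nat.ble 1 u.length
      · simp
      · have hul : 1 ≤ u.length := Nat.le_of_ble_eq_true hu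
        rw [Nat.ble_eq_true_of_le (hul.trans h.length_le)]
        have : v.getD 0 0 = u.getD 0 0 := by
          obtain ⟨t, rfl⟩ := h
          exact List.getD_append _ _ _ _ hul
        rw [this]
        cases Nat.blt (n - 1).unpair.1 (u.getD 0 0)
        · simp
        · exact getElem?_of_prefix (fmono _ _ (componentWord_prefix h _))
    · exact getElem?_of_prefix h
  · rintro p r ⟨hex, rfl⟩ n
    obtain ⟨h0, h1, h2⟩ := hex.choose_spec
    change ∃ m, _ = some (hex.choose n)
    set r := hex.choose
    rcases n with _ | n
    · exact ⟨1, by rw [h0]; exact getElem?_initialWord Nat.one_pos⟩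
    · simp only [Nat.add_sub_cancel, show Nat.ble (n + 1) 0 = false from rfl, cond_false]
      have hr : r (n + 1) = component r n.unpair.1 n.unpair.2 := by simp [component]
      rw [hr]
      by_cases hi : n.unpair.1 < p 0
      · obtain ⟨k, hk⟩ := hF _ _ (h1 _ hi) (n.unpair.2 + 1)
        refine ⟨Nat.pair n.unpair.1 k + 1, ?_⟩
        rw [length_initialWord, Nat.ble_eq_true_of_le (by omega), getD_initialWord (by omega),
          show Nat.blt n.unpair.1 (p 0) = true from Nat.ble_eq_true_of_le hi, cond_true, cond_true]
        exact getElem?_of_prefix (hk.trans (fmono _ _ (initialWord_component_prefix _ _ _)))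
          (getElem?_initialWord (Nat.lt_succ_self _))
      · refine ⟨1, ?_⟩
        rw [length_initialWord, Nat.ble_eq_true_of_le le_rfl, getD_initialWord (by omega),
          show Nat.blt n.unpair.1 (p 0) = false from Bool.eq_false_iff.2
            (fun h => hi (Nat.le_of_ble_eq_true h)), h2 _ (by omega)]
        rfl

/-! ### Weihrauch reducibility, pointwise -/

theorem parallel_nonempty {X Y : Type*} {f : X → Set Y} {t : Σ n : ℕ, Fin n → X} :
    (Parallel f t).Nonempty ↔ ∀ i, (f (t.2 i)).Nonempty := by
  constructor
  · rintro ⟨-, y, -, hy⟩ i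
    exact ⟨y i, hy i⟩
  · intro h
    choose y hy using h
    exact ⟨⟨t.1, y⟩, y, rfl, hy⟩

section

variable {X Y Z W U V : Type*} [RepresentedSpace X] [RepresentedSpace Y] [RepresentedSpace Z]
  [RepresentedSpace W] [RepresentedSpace U] [RepresentedSpace V]

theorem reducible_iff {f : X → Set Y} {g : Z → Set W} :
    Reducible f g ↔ ∃ H K : Baire →. Baire, IsComputable H ∧ IsComputable K ∧
      ∀ p x, IsName p x → (f x).Nonempty → ∃ h ∈ H p, ∃ z, IsName h z ∧ (g z).Nonempty ∧
        ∀ q, ∀ w ∈ g z, IsName q w → ∃ k ∈ K (interleave p q), ∃ y ∈ f x, IsName k y := by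
  classical
  constructor
  · rintro ⟨H, K, hH, hK, hG⟩
    refine ⟨H, K, hH, hK, fun p x hp hx => ?_⟩
    have hans : ∀ h : Baire, (∃ z : Z, IsName h z ∧ (g z).Nonempty) →
        ∃ q, ∃ z : Z, IsName h z ∧ ∃ w ∈ g z, IsName q w := by
      rintro h ⟨z, hz, w, hw⟩
      obtain ⟨q, hq⟩ := surj w
      exact ⟨q, z, hz, w, hw, hq⟩
    let G : Baire →. Baire := fun h => ⟨∃ z : Z, IsName h z ∧ (g z).Nonempty, fun hh =>
      (hans h hh).choose⟩
    have hGr : Realizes G g := by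
      intro h z hz hne
      have hd : ∃ z : Z, IsName h z ∧ (g z).Nonempty := ⟨z, hz, hne⟩
      refine ⟨_, ⟨hd, rfl⟩, ?_⟩
      obtain ⟨z', hz', w, hw, hq⟩ := (hans h hd).choose_spec
      obtain rfl := unique hz hz'
      exact ⟨w, hw, hq⟩
    obtain ⟨k, hk, -⟩ := hG G hGr p x hp hx
    obtain ⟨h, hh, hk⟩ := Part.mem_bind_iff.1 hk
    obtain ⟨-, ⟨hd, -⟩, -⟩ := Part.mem_bind_iff.1 hk
    obtain ⟨z, hz, hne⟩ := hd
    refine ⟨h, hh, z, hz, hne, fun q w hw hq => ?_⟩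
    let G' : Baire →. Baire := fun h' => if h' = h then Part.some q else G h'
    have hG'r : Realizes G' g := by
      intro h' z' hz' hne'
      by_cases heq : h' = h
      · subst heq
        obtain rfl := unique hz hz'
        exact ⟨q, by simp [G'], w, hw, hq⟩
      · simp only [G', if_neg heq]
        exact hGr h' z' hz' hne'
    obtain ⟨k, hk, y, hy, hky⟩ := hG G' hG'r p x hp hx
    obtain ⟨h', hh', hk⟩ := Part.mem_bind_iff.1 hk
    obtain rfl := Part.mem_unique hh hh'
    simp only [G', if_true, Part.bind_some] at hk
    exact ⟨k, hk, y, hy, hky⟩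
  · rintro ⟨H, K, hH, hK, h⟩
    refine ⟨H, K, hH, hK, fun G hG p x hp hx => ?_⟩
    obtain ⟨h, hh, z, hz, hne, hK⟩ := h p x hp hx
    obtain ⟨q, hq, w, hw, hqw⟩ := hG h z hz hne
    obtain ⟨k, hk, y, hy, hky⟩ := hK q w hw hqw
    exact ⟨k, Part.mem_bind hh (Part.mem_bind hq hk), y, hy, hky⟩

theorem interleave_even (p q : Baire) : (fun n => interleave p q (2 * n)) = p := by
  funext n
  simp [interleave]

theorem interleave_odd (p q : Baire) : (fun n => interleave p q (2 * n + 1)) = q := by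
  funext n
  have h1 : (2 * n + 1) % 2 = 1 := by omega
  have h2 : (2 * n + 1) / 2 = n := by omega
  simp [interleave, h1, h2]

theorem interleave_even_apply (p q : Baire) (n : ℕ) : interleave p q (2 * n) = p n :=
  congrFun (interleave_even p q) n

theorem interleave_odd_apply (p q : Baire) (n : ℕ) : interleave p q (2 * n + 1) = q n :=
  congrFun (interleave_odd p q) n

theorem isComputable_even : IsComputable fun p => Part.some fun n => p (2 * n) :=
  isComputable_reindex (by fun_prop)

theorem isComputable_odd : IsComputable fun p => Part.some fun n => p (2 * n + 1) :=
  isComputable_reindex (by fun_prop)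

theorem Reducible.trans {f : X → Set Y} {g : Z → Set W} {e : U → Set V} (hfg : Reducible f g)
    (hge : Reducible g e) : Reducible f e := by
  obtain ⟨H, K, hH, hK, h1⟩ := reducible_iff.1 hfg
  obtain ⟨H', K', hH', hK', h2⟩ := reducible_iff.1 hge
  refine reducible_iff.2 ⟨_, _, hH.bind hH', (isComputable_even.interleave
    (((isComputable_even.bind hH).interleave isComputable_odd).bind hK')).bind hK, ?_⟩
  intro p x hp hx
  obtain ⟨h, hh, z, hz, hzne, h1⟩ := h1 p x hp hx
  obtain ⟨h', hh', u, hu, hune, h2⟩ := h2 h z hz hzne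
  refine ⟨h', Part.mem_bind hh hh', u, hu, hune, fun q v hv hqv => ?_⟩
  obtain ⟨k', hk', w, hw, hkw⟩ := h2 q v hv hqv
  obtain ⟨k, hk, y, hy, hky⟩ := h1 k' w hw hkw
  refine ⟨k, ?_, y, hy, hky⟩
  simp only [interleave_even, interleave_odd, Part.bind_some, Part.map_some]
  exact Part.mem_bind (Part.mem_map _ (Part.mem_bind
    (Part.mem_bind (Part.mem_bind (Part.mem_some _) hh) (Part.mem_some _)) hk')) hk

theorem Reducible.parallel {f : X → Set Y} {g : Z → Set W} (h : Reducible f g) :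
    Reducible (Parallel f) (Parallel g) := by
  obtain ⟨H, K, hH, hK, h⟩ := reducible_iff.1 h
  let φ : ℕ → ℕ := fun n => bif Nat.ble n 0 then 0 else
    2 * (Nat.pair (n - 1).unpair.1 ((n - 1).unpair.2 / 2) + 1) + (n - 1).unpair.2 % 2
  have hφ : Primrec φ := by fun_prop
  have hcomp : ∀ (p q : Baire) (i : ℕ), component (fun n => interleave p q (φ n)) i =
      interleave (component p i) (component q i) := by
    intro p q i
    funext k
    simp only [component, φ, Nat.add_sub_cancel, Nat.unpair_pair]
    change interleave p q (2 * (Nat.pair i (k / 2) + 1) + k % 2) = _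
    rcases Nat.mod_two_eq_zero_or_one k with hk | hk
    · rw [hk, add_zero, interleave_even_apply]
      simp [interleave, hk, component]
    · rw [hk, interleave_odd_apply]
      simp [interleave, hk, component]
  refine reducible_iff.2 ⟨_, _, hH.componentwise,
    (isComputable_reindex hφ).bind hK.componentwise, ?_⟩
  rintro p ⟨n, x⟩ ⟨hp0, hp⟩ hx
  rw [parallel_nonempty] at hx
  have h1 := fun i : Fin n => h _ _ (hp i) (hx i)
  choose c hc z hcz hz hK' using h1
  obtain ⟨r, hr, hr0, hrc⟩ := exists_mem_componentwise (F := H) (p := p)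
    (c := fun i => if hi : i < n then c ⟨i, hi⟩ else fun _ => 0) (by
      intro i hi
      rw [hp0] at hi
      rw [dif_pos hi]
      exact hc ⟨i, hi⟩)
  refine ⟨r, hr, ⟨n, z⟩, ⟨hr0.trans hp0, fun i => ?_⟩, parallel_nonempty.2 hz, ?_⟩
  · rw [hrc i (by rw [hp0]; exact i.2), dif_pos i.2]
    exact hcz i
  rintro q _ ⟨w, rfl, hw⟩ ⟨hq0, hq⟩
  have h2 := fun i : Fin n => hK' i _ _ (hw i) (hq i)
  choose k hk y hy hky using h2
  have hφ0 : interleave p q (φ 0) = p 0 := interleave_even_apply p q 0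
  obtain ⟨s, hs, hs0, hsc⟩ := exists_mem_componentwise (F := K)
    (p := fun n => interleave p q (φ n))
    (c := fun i => if hi : i < n then k ⟨i, hi⟩ else fun _ => 0) (by
      intro i hi
      have hi : i < n := lt_of_lt_of_eq hi (hφ0.trans hp0)
      rw [dif_pos hi, hcomp]
      exact hk ⟨i, hi⟩)
  refine ⟨s, Part.mem_bind (Part.mem_some _) hs, ⟨n, y⟩, ⟨y, rfl, hy⟩,
    hs0.trans (hφ0.trans hp0), fun i => ?_⟩
  rw [hsc i (lt_of_lt_of_eq i.2 (hφ0.trans hp0).symm), dif_pos i.2]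
  exact hky i

end

end Weihrauch

namespace Weihrauch

/-! ### Rational arithmetic on indices -/

theorem blt_iff {m n : ℕ} : Nat.blt m n = true ↔ m < n := by rw [Nat.blt_eq]

/-- The index of `(a - b) / (c + 1)`. -/
def qmk (a b c : ℕ) : ℕ := Nat.pair (Nat.pair a b) c

theorem ratOf_qmk (a b c : ℕ) : ratOf (qmk a b c) = ((a : ℚ) - b) / (c + 1) := by
  simp [ratOf, qmk]

theorem ratOf_eq (m : ℕ) : ratOf m =
    ((m.unpair.1.unpair.1 : ℚ) - m.unpair.1.unpair.2) / (m.unpair.2 + 1) := rfl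

def qadd (m n : ℕ) : ℕ :=
  qmk (m.unpair.1.unpair.1 * (n.unpair.2 + 1) + n.unpair.1.unpair.1 * (m.unpair.2 + 1))
    (m.unpair.1.unpair.2 * (n.unpair.2 + 1) + n.unpair.1.unpair.2 * (m.unpair.2 + 1))
    (m.unpair.2 * n.unpair.2 + m.unpair.2 + n.unpair.2)

def qneg (m : ℕ) : ℕ := qmk m.unpair.1.unpair.2 m.unpair.1.unpair.1 m.unpair.2

def qmul (m n : ℕ) : ℕ :=
  qmk (m.unpair.1.unpair.1 * n.unpair.1.unpair.1 + m.unpair.1.unpair.2 * n.unpair.1.unpair.2)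
    (m.unpair.1.unpair.1 * n.unpair.1.unpair.2 + m.unpair.1.unpair.2 * n.unpair.1.unpair.1)
    (m.unpair.2 * n.unpair.2 + m.unpair.2 + n.unpair.2)

def qlt (m n : ℕ) : Bool :=
  Nat.blt (m.unpair.1.unpair.1 * (n.unpair.2 + 1) + n.unpair.1.unpair.2 * (m.unpair.2 + 1))
    (n.unpair.1.unpair.1 * (m.unpair.2 + 1) + m.unpair.1.unpair.2 * (n.unpair.2 + 1))

def qmin (m n : ℕ) : ℕ := bif qlt m n then m else n

def qpow (m k : ℕ) : ℕ := Nat.rec (qmk 1 0 0) (fun _ r => qmul m r) k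

/-- The index of `2⁻ᵏ`. -/
def qhalf (k : ℕ) : ℕ := qpow (qmk 1 0 1) k

def qsum (f : ℕ → ℕ) (n : ℕ) : ℕ := Nat.rec 0 (fun k r => qadd r (f k)) n

@[simp] theorem ratOf_zero : ratOf 0 = 0 := by simp [ratOf]

theorem ratOf_qadd (m n : ℕ) : ratOf (qadd m n) = ratOf m + ratOf n := by
  rw [qadd, ratOf_qmk, ratOf_eq m, ratOf_eq n]
  have h1 : (m.unpair.2 : ℚ) + 1 ≠ 0 := by positivity
  have h2 : (n.unpair.2 : ℚ) + 1 ≠ 0 := by positivity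
  have h3 : (m.unpair.2 : ℚ) * n.unpair.2 + m.unpair.2 + n.unpair.2 + 1 ≠ 0 := by positivity
  push_cast
  rw [div_add_div _ _ h1 h2, div_eq_div_iff h3 (mul_ne_zero h1 h2)]
  ring

theorem ratOf_qneg (m : ℕ) : ratOf (qneg m) = -ratOf m := by
  rw [qneg, ratOf_qmk, ratOf_eq m]
  ring

theorem ratOf_qmul (m n : ℕ) : ratOf (qmul m n) = ratOf m * ratOf n := by
  rw [qmul, ratOf_qmk, ratOf_eq m, ratOf_eq n]
  have h1 : (m.unpair.2 : ℚ) + 1 ≠ 0 := by positivity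
  have h2 : (n.unpair.2 : ℚ) + 1 ≠ 0 := by positivity
  have h3 : (m.unpair.2 : ℚ) * n.unpair.2 + m.unpair.2 + n.unpair.2 + 1 ≠ 0 := by positivity
  push_cast
  rw [div_mul_div_comm, div_eq_div_iff h3 (mul_ne_zero h1 h2)]
  ring

theorem qlt_iff {m n : ℕ} : qlt m n = true ↔ ratOf m < ratOf n := by
  have h1 : (0 : ℚ) < (m.unpair.2 : ℚ) + 1 := by positivity
  have h2 : (0 : ℚ) < (n.unpair.2 : ℚ) + 1 := by positivity
  rw [qlt, ratOf_eq m, ratOf_eq n, div_lt_div_iff₀ h1 h2, Nat.blt_eq, ← Nat.cast_lt (α := ℚ)]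
  push_cast
  constructor <;> intro h <;> linarith

theorem ratOf_qmin (m n : ℕ) : ratOf (qmin m n) = min (ratOf m) (ratOf n) := by
  rw [qmin]
  cases h : qlt m n
  · rw [cond_false, min_eq_right (not_lt.1 fun h' => by rw [qlt_iff.2 h'] at h; simp at h)]
  · rw [cond_true, min_eq_left (qlt_iff.1 h).le]

theorem ratOf_qpow (m k : ℕ) : ratOf (qpow m k) = ratOf m ^ k := by
  induction k with
  | zero => simp [qpow, ratOf_qmk]
  | succ k ih =>
    rw [pow_succ', ← ih, ← ratOf_qmul]
    rfl

theorem ratOf_qhalf (k : ℕ) : ratOf (qhalf k) = 2⁻¹ ^ k := by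
  rw [qhalf, ratOf_qpow, ratOf_qmk]
  norm_num

theorem ratOf_qsum (f : ℕ → ℕ) (n : ℕ) :
    ratOf (qsum f n) = ∑ k ∈ Finset.range n, ratOf (f k) := by
  induction n with
  | zero => simp [qsum]
  | succ n ih =>
    rw [Finset.sum_range_succ, ← ih, ← ratOf_qadd]
    rfl

theorem qsum_congr {f g : ℕ → ℕ} {n : ℕ} (h : ∀ k < n, f k = g k) : qsum f n = qsum g n := by
  induction n with
  | zero => rfl
  | succ n ih =>
    change qadd (qsum f n) (f n) = qadd (qsum g n) (g n)
    rw [ih fun k hk => h k (by omega), h n (by omega)]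

/-- Bounded universal quantification. -/
def ballLt (f : ℕ → Bool) (n : ℕ) : Bool := Nat.rec true (fun k r => r && f k) n

/-- Bounded existential quantification. -/
def bexLt (f : ℕ → Bool) (n : ℕ) : Bool := Nat.rec false (fun k r => r || f k) n

theorem ballLt_iff {f : ℕ → Bool} {n : ℕ} : ballLt f n = true ↔ ∀ k < n, f k = true := by
  induction n with
  | zero => simp [ballLt]
  | succ n ih =>
    change (ballLt f n && f n) = true ↔ _
    rw [Bool.and_eq_true, ih]
    exact ⟨fun h k hk => (Nat.lt_succ_iff_lt_or_eq.1 hk).elim (h.1 k) (fun e => e ▸ h.2),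
      fun h => ⟨fun k hk => h k (by omega), h n (by omega)⟩⟩

theorem bexLt_iff {f : ℕ → Bool} {n : ℕ} : bexLt f n = true ↔ ∃ k < n, f k = true := by
  induction n with
  | zero => simp [bexLt]
  | succ n ih =>
    change (bexLt f n || f n) = true ↔ _
    rw [Bool.or_eq_true, ih]
    constructor
    · rintro (⟨k, hk, h⟩ | h)
      exacts [⟨k, by omega, h⟩, ⟨n, by omega, h⟩]
    · rintro ⟨k, hk, h⟩
      rcases Nat.lt_succ_iff_lt_or_eq.1 hk with hk | rfl
      exacts [Or.inl ⟨k, hk, h⟩, Or.inr h]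

/-- One more than the least `s < n` with `c s`, and zero if there is none. -/
def firstHit (c : ℕ → Bool) (n : ℕ) : ℕ :=
  Nat.rec 0 (fun s r => bif Nat.ble 1 r then r else bif c s then s + 1 else 0) n

theorem firstHit_succ (c : ℕ → Bool) (n : ℕ) : firstHit c (n + 1) =
    bif Nat.ble 1 (firstHit c n) then firstHit c n else bif c n then n + 1 else 0 := rfl

theorem firstHit_spec (c : ℕ → Bool) (n : ℕ) :
    (firstHit c n = 0 ∧ ∀ s < n, c s = false) ∨
      ∃ s < n, firstHit c n = s + 1 ∧ c s = true ∧ ∀ t < s, c t = false := by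
  induction n with
  | zero => exact Or.inl ⟨rfl, by simp⟩
  | succ n ih =>
    rcases ih with ⟨h0, h⟩ | ⟨s, hs, h1, h2⟩
    · cases hc : c n
      · refine Or.inl ⟨by rw [firstHit_succ, h0, hc]; rfl, fun s hs => ?_⟩
        rcases Nat.lt_succ_iff_lt_or_eq.1 hs with hs | rfl
        exacts [h s hs, hc]
      · exact Or.inr ⟨n, by omega, by rw [firstHit_succ, h0, hc]; rfl, hc, h⟩
    · exact Or.inr ⟨s, by omega, by
        rw [firstHit_succ, h1, Nat.ble_eq_true_of_le (by omega), cond_true], h2⟩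

theorem firstHit_eq_zero {c : ℕ → Bool} {n : ℕ} (h : ∀ s < n, c s = false) : firstHit c n = 0 := by
  rcases firstHit_spec c n with ⟨h0, -⟩ | ⟨s, hs, -, h1, -⟩
  · exact h0
  · rw [h s hs] at h1
    simp at h1

theorem firstHit_eq_succ {c : ℕ → Bool} {n s : ℕ} (hs : s < n) (hc : c s = true)
    (h : ∀ t < s, c t = false) : firstHit c n = s + 1 := by
  rcases firstHit_spec c n with ⟨-, h1⟩ | ⟨t, ht, h1, h2, h3⟩
  · rw [h1 s hs] at hc
    simp at hc
  · rcases lt_trichotomy s t with hst | rfl | hst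
    · rw [h3 s hst] at hc; simp at hc
    · exact h1
    · rw [h t hst] at h2; simp at h2

theorem firstHit_congr {c c' : ℕ → Bool} {n : ℕ} (h : ∀ s < n, c s = c' s) :
    firstHit c n = firstHit c' n := by
  induction n with
  | zero => rfl
  | succ n ih => rw [firstHit_succ, firstHit_succ, ih fun s hs => h s (by omega), h n (by omega)]

section

variable {α : Type*} [Primcodable α]

@[fun_prop] theorem primrec_qmk {f g h : α → ℕ} (hf : Primrec f) (hg : Primrec g)
    (hh : Primrec h) : Primrec fun a => qmk (f a) (g a) (h a) := by unfold qmk; fun_prop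

@[fun_prop] theorem primrec_qadd {f g : α → ℕ} (hf : Primrec f) (hg : Primrec g) :
    Primrec fun a => qadd (f a) (g a) := by unfold qadd; fun_prop

@[fun_prop] theorem primrec_qneg {f : α → ℕ} (hf : Primrec f) :
    Primrec fun a => qneg (f a) := by unfold qneg; fun_prop

@[fun_prop] theorem primrec_qmul {f g : α → ℕ} (hf : Primrec f) (hg : Primrec g) :
    Primrec fun a => qmul (f a) (g a) := by unfold qmul; fun_prop

@[fun_prop] theorem primrec_qlt {f g : α → ℕ} (hf : Primrec f) (hg : Primrec g) :
    Primrec fun a => qlt (f a) (g a) := by unfold qlt; fun_prop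

@[fun_prop] theorem primrec_qmin {f g : α → ℕ} (hf : Primrec f) (hg : Primrec g) :
    Primrec fun a => qmin (f a) (g a) := by unfold qmin; fun_prop

@[fun_prop] theorem primrec_qpow {f g : α → ℕ} (hf : Primrec f) (hg : Primrec g) :
    Primrec fun a => qpow (f a) (g a) := by unfold qpow; fun_prop

@[fun_prop] theorem primrec_qhalf {f : α → ℕ} (hf : Primrec f) :
    Primrec fun a => qhalf (f a) := by unfold qhalf; fun_prop

@[fun_prop] theorem primrec_qsum {f : α → ℕ → ℕ} {n : α → ℕ}
    (hf : Primrec fun x : α × ℕ => f x.1 x.2) (hn : Primrec n) :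
    Primrec fun a => qsum (f a) (n a) := by unfold qsum; fun_prop

@[fun_prop] theorem primrec_ballLt {f : α → ℕ → Bool} {n : α → ℕ}
    (hf : Primrec fun x : α × ℕ => f x.1 x.2) (hn : Primrec n) :
    Primrec fun a => ballLt (f a) (n a) := by unfold ballLt; fun_prop

@[fun_prop] theorem primrec_bexLt {f : α → ℕ → Bool} {n : α → ℕ}
    (hf : Primrec fun x : α × ℕ => f x.1 x.2) (hn : Primrec n) :
    Primrec fun a => bexLt (f a) (n a) := by unfold bexLt; fun_prop

@[fun_prop] theorem primrec_firstHit {f : α → ℕ → Bool} {n : α → ℕ}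
    (hf : Primrec fun x : α × ℕ => f x.1 x.2) (hn : Primrec n) :
    Primrec fun a => firstHit (f a) (n a) := by unfold firstHit; fun_prop

end

end Weihrauch

namespace Weihrauch

open RepresentedSpace Polynomial

/-! ### All-or-unique choice reduces to bounded root finding -/

/-- Does the rational interval with index `c` meet the unit interval? -/
def meetsUnit (c : ℕ) : Bool :=
  qlt c.unpair.1 c.unpair.2 && (qlt c.unpair.1 (qmk 1 0 0) && qlt 0 c.unpair.2)

theorem meetsUnit_iff {c : ℕ} : meetsUnit c = true ↔
    ∃ x : unitInterval, (x : ℝ) ∈ Set.Ioo (ratOf c.unpair.1 : ℝ) (ratOf c.unpair.2 : ℝ) := by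
  rw [meetsUnit, Bool.and_eq_true, Bool.and_eq_true, qlt_iff, qlt_iff, qlt_iff, ratOf_zero,
    show ratOf (qmk 1 0 0) = 1 by simp [ratOf_qmk]]
  constructor
  · rintro ⟨h1, h2, h3⟩
    obtain ⟨y, hy1, hy2⟩ := exists_between
      (max_lt (lt_min h1 h2) (lt_min h3 (zero_lt_one' ℚ)) :
        max (ratOf c.unpair.1) 0 < min (ratOf c.unpair.2) 1)
    rw [max_lt_iff] at hy1
    rw [lt_min_iff] at hy2
    exact ⟨⟨(y : ℝ), by exact_mod_cast hy1.2.le, by exact_mod_cast hy2.2.le⟩,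
      Rat.cast_lt.2 hy1.1, Rat.cast_lt.2 hy2.1⟩
  · rintro ⟨x, h1, h2⟩
    exact ⟨by exact_mod_cast h1.trans h2, by exact_mod_cast h1.trans_le x.2.2,
      by exact_mod_cast x.2.1.trans_lt h2⟩

/-- With `t` coding a number `N` of cells and a rational `v`: each of the `N` cells of the unit
interval lies within `2⁻ᵏ` of `v` or in one of the intervals listed in the word `w`. -/
def coverCheck (w : List ℕ) (k t : ℕ) : Bool :=
  ballLt (fun i =>
    (qlt (qadd t.unpair.1.unpair.2 (qneg (qhalf k))) (qmk i 0 t.unpair.1.unpair.1) &&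
      qlt (qmk (i + 1) 0 t.unpair.1.unpair.1) (qadd t.unpair.1.unpair.2 (qhalf k))) ||
    bexLt (fun l => qlt (w.getD l 0).unpair.1 (qmk i 0 t.unpair.1.unpair.1) &&
      qlt (qmk (i + 1) 0 t.unpair.1.unpair.1) (w.getD l 0).unpair.2) w.length)
    (t.unpair.1.unpair.1 + 1)

/-- The index of the scaling factor `2⁻ˢ`, where `s` is the first position at which `w` lists an
interval meeting the unit interval, once such an `s ≤ k` is known; and `0` before. -/
def aoucStage (w : List ℕ) (k : ℕ) : ℕ := firstHit (fun s => meetsUnit (w.getD s 0)) (k + 1)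

def aoucPolynomialEntry (w : List ℕ) (n : ℕ) : Option ℕ :=
  bif Nat.ble n 0 then some 1 else
  bif Nat.blt (n - 1).unpair.2 w.length then
    bif Nat.ble (aoucStage w (n - 1).unpair.2) 0 then some 0 else
    bif Nat.ble 2 (n - 1).unpair.1 then some 0 else
    bif Nat.ble 1 (n - 1).unpair.1 then some (qhalf (aoucStage w (n - 1).unpair.2 - 1)) else
    bif coverCheck w (n - 1).unpair.2 w.length then
      some (qneg (qmul (qhalf (aoucStage w (n - 1).unpair.2 - 1)) w.length.unpair.1.unpair.2))
    else none
  else none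

theorem primrec_aoucPolynomialEntry :
    Primrec fun x : List ℕ × ℕ => aoucPolynomialEntry x.1 x.2 := by
  unfold aoucPolynomialEntry aoucStage coverCheck meetsUnit
  fun_prop

theorem aoucStage_initialWord {p : Baire} {k m : ℕ} (h : k < m) :
    aoucStage (initialWord p m) k = firstHit (fun s => meetsUnit (p s)) (k + 1) :=
  firstHit_congr fun s hs => by rw [getD_initialWord (by omega)]

theorem ratOf_cell (i N : ℕ) : (ratOf (qmk i 0 N) : ℝ) = i / (N + 1) := by
  rw [ratOf_qmk]; push_cast; ring

theorem abs_sub_lt_of_coverCheck {w : List ℕ} {k t : ℕ} {a : ℝ} (ha : a ∈ Set.Icc (0 : ℝ) 1)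
    (hw : ∀ l < w.length, ¬ (a ∈ Set.Ioo (ratOf (w.getD l 0).unpair.1 : ℝ)
      (ratOf (w.getD l 0).unpair.2 : ℝ))) (h : coverCheck w k t = true) :
    |(ratOf t.unpair.1.unpair.2 : ℝ) - a| < 2⁻¹ ^ k := by
  rw [coverCheck, ballLt_iff] at h
  set N := t.unpair.1.unpair.1
  have hN : (0 : ℝ) < (N : ℝ) + 1 := by positivity
  obtain ⟨i, hi, h1, h2⟩ : ∃ i < N + 1, (i : ℝ) / (N + 1) ≤ a ∧ a ≤ ((i + 1 : ℕ) : ℝ) / (N + 1) := by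
    by_cases hlt : a < 1
    · have h0 : 0 ≤ a * (N + 1) := mul_nonneg ha.1 hN.le
      refine ⟨⌊a * (N + 1)⌋₊, ?_, ?_, ?_⟩
      · rw [Nat.floor_lt h0]
        push_cast
        nlinarith
      · rw [div_le_iff₀ hN]
        exact Nat.floor_le h0
      · rw [le_div_iff₀ hN]
        push_cast
        exact (Nat.lt_floor_add_one _).le
    · have : a = 1 := le_antisymm ha.2 (not_lt.1 hlt)
      refine ⟨N, by omega, ?_, ?_⟩
      · rw [this, div_le_one hN]; linarith
      · rw [this]; push_cast; rw [div_self hN.ne']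
  have h3 := h i hi
  rw [Bool.or_eq_true, Bool.and_eq_true, qlt_iff, qlt_iff, bexLt_iff] at h3
  rcases h3 with ⟨h3, h4⟩ | ⟨l, hl, h3⟩
  · have h3' := (Rat.cast_lt (K := ℝ)).2 h3
    have h4' := (Rat.cast_lt (K := ℝ)).2 h4
    rw [ratOf_qadd, ratOf_qneg, ratOf_qhalf, ratOf_cell] at h3'
    rw [ratOf_qadd, ratOf_qhalf, ratOf_cell] at h4'
    push_cast at h3' h4' h2
    rw [abs_lt]
    constructor <;> linarith
  · rw [Bool.and_eq_true, qlt_iff, qlt_iff] at h3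
    have h3' := (Rat.cast_lt (K := ℝ)).2 h3.1
    have h4' := (Rat.cast_lt (K := ℝ)).2 h3.2
    rw [ratOf_cell] at h3' h4'
    exact absurd ⟨h3'.trans_le h1, h2.trans_lt h4'⟩ (hw l hl)

theorem exists_coverCheck {p : Baire} {a : ℝ} (k m₀ : ℕ)
    (hp : ∀ x ∈ Set.Icc (0 : ℝ) 1, x ≠ a →
      ∃ l, x ∈ Set.Ioo (ratOf (p l).unpair.1 : ℝ) (ratOf (p l).unpair.2 : ℝ)) :
    ∃ t, m₀ ≤ t ∧ coverCheck (initialWord p t) k t = true := by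
  have hk : (0 : ℝ) < 2⁻¹ ^ k := by positivity
  obtain ⟨v, hv⟩ : ∃ v, |(ratOf v : ℝ) - a| < 2⁻¹ ^ k := by
    obtain ⟨q, hq⟩ := surj a
    exact ⟨q k, hq k⟩
  let U : Option ℕ → Set ℝ := fun o => o.elim
    (Set.Ioo ((ratOf v : ℝ) - 2⁻¹ ^ k) ((ratOf v : ℝ) + 2⁻¹ ^ k))
    (fun l => Set.Ioo (ratOf (p l).unpair.1 : ℝ) (ratOf (p l).unpair.2 : ℝ))
  obtain ⟨δ, hδ, hU⟩ := lebesgue_number_lemma_of_metric (isCompact_Icc (a := (0 : ℝ)) (b := 1))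
    (c := U) (by rintro (_ | l) <;> exact isOpen_Ioo) (by
      intro x hx
      rw [Set.mem_iUnion]
      by_cases hxa : x = a
      · refine ⟨none, ?_⟩
        rw [abs_lt] at hv
        exact ⟨by linarith, by linarith⟩
      · obtain ⟨l, hl⟩ := hp x hx hxa
        exact ⟨some l, hl⟩)
  obtain ⟨N, hN⟩ := exists_nat_one_div_lt hδ
  have hN0 : (0 : ℝ) < (N : ℝ) + 1 := by positivity
  have hcell : ∀ i < N + 1, ∃ o, (i : ℝ) / (N + 1) ∈ U o ∧ ((i + 1 : ℕ) : ℝ) / (N + 1) ∈ U o := by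
    intro i hi
    have hi' : (i : ℝ) ≤ N := by exact_mod_cast Nat.lt_succ_iff.1 hi
    obtain ⟨o, ho⟩ := hU ((i : ℝ) / (N + 1))
      ⟨by positivity, by rw [div_le_one hN0]; linarith⟩
    refine ⟨o, ho (Metric.mem_ball_self hδ), ho ?_⟩
    rw [Metric.mem_ball, Real.dist_eq, ← sub_div]
    push_cast
    rwa [add_sub_cancel_left, abs_of_pos (by positivity)]
  choose! o ho1 ho2 using hcell
  obtain ⟨m, hm⟩ : ∃ m, ∀ i < N + 1, (o i).getD 0 < m :=
    ⟨(Finset.range (N + 1)).sup (fun i => (o i).getD 0) + 1, fun i hi =>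
      Nat.lt_succ_of_le (Finset.le_sup (f := fun i => (o i).getD 0) (Finset.mem_range.2 hi))⟩
  refine ⟨Nat.pair (Nat.pair N v) (max m₀ m), ?_, ?_⟩
  · exact (le_max_left _ _).trans (Nat.right_le_pair _ _)
  have hlen : m ≤ Nat.pair (Nat.pair N v) (max m₀ m) :=
    (le_max_right _ _).trans (Nat.right_le_pair _ _)
  set T := Nat.pair (Nat.pair N v) (max m₀ m) with hT
  have hT1 : T.unpair.1.unpair.1 = N := by simp [hT]
  have hT2 : T.unpair.1.unpair.2 = v := by simp [hT]
  rw [coverCheck, ballLt_iff, hT1, hT2]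
  intro i hi
  rw [Bool.or_eq_true, Bool.and_eq_true, qlt_iff, qlt_iff, bexLt_iff]
  have h1 := ho1 i hi
  have h2 := ho2 i hi
  have h3 := hm i hi
  cases hoi : o i with
  | none =>
    rw [hoi] at h1 h2
    left
    rw [← Rat.cast_lt (K := ℝ), ← Rat.cast_lt (K := ℝ), ratOf_qadd, ratOf_qneg, ratOf_qhalf,
      ratOf_cell, ratOf_qadd, ratOf_qhalf, ratOf_cell]
    have h1' := h1.1
    have h2' := h2.2
    push_cast at h1' h2' ⊢
    exact ⟨by linarith, h2'⟩
  | some l =>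
    rw [hoi] at h1 h2 h3
    right
    have hl : l < T := lt_of_lt_of_le h3 hlen
    refine ⟨l, by simpa using hl, ?_⟩
    rw [Bool.and_eq_true, qlt_iff, qlt_iff, getD_initialWord hl, ← Rat.cast_lt (K := ℝ),
      ← Rat.cast_lt (K := ℝ), ratOf_cell, ratOf_cell]
    exact ⟨h1.1, h2.2⟩

theorem aoUC_reducible_bRoot : Reducible AoUC BRoot := by
  obtain ⟨H, hH, hHs⟩ := exists_isComputable_of_search
    (a := aoucPolynomialEntry) primrec_aoucPolynomialEntry.to_comp
  refine reducible_iff.2 ⟨H, _, hH, isComputable_odd, fun p A hp hA => ?_⟩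
  obtain ⟨-, hA, -⟩ := hA
  suffices hmain : ∃ h ∈ H p, ∃ P : ℝ[X], IsName h P ∧
      ∀ y : unitInterval, y ∈ BRoot P → y ∈ A by
    obtain ⟨h, hh, P, hP, hy⟩ := hmain
    refine ⟨h, hh, P, hP, ?_, fun q w hw hq =>
      ⟨q, Part.mem_some_iff.2 (interleave_odd p q).symm, w, ⟨hA, hy w hw⟩, hq⟩⟩
    by_cases hr : ∃ y : unitInterval, P.eval (y : ℝ) = 0
    · obtain ⟨y, hy⟩ := hr
      exact ⟨y, fun _ => hy⟩
    · exact ⟨0, fun h => absurd h hr⟩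
  have hstage : ∀ n m, (n - 1).unpair.2 < m → aoucStage (initialWord p m) (n - 1).unpair.2 =
      firstHit (fun s => meetsUnit (p s)) ((n - 1).unpair.2 + 1) :=
    fun n m h => aoucStage_initialWord h
  rcases hA with hA | ⟨a, hA⟩
  · have hmeets : ∀ s, meetsUnit (p s) = false := by
      intro s
      rw [Bool.eq_false_iff, ne_eq, meetsUnit_iff]
      rintro ⟨x, hx⟩
      have := (hp x).2 ⟨s, hx⟩
      exact this (by rw [← SetLike.mem_coe, hA]; trivial)
    have hval : ∀ n m, aoucPolynomialEntry (initialWord p m) n =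
        bif Nat.ble n 0 then some 1 else
        bif Nat.blt (n - 1).unpair.2 m then some 0 else none := by
      intro n m
      unfold aoucPolynomialEntry
      rw [length_initialWord]
      cases hn : Nat.blt (n - 1).unpair.2 m
      · rfl
      · rw [hstage n m (blt_iff.1 hn), firstHit_eq_zero fun s _ => hmeets s]
        rfl
    obtain ⟨q, hq, hqs⟩ := hHs p fun n => by
      refine ⟨(n - 1).unpair.2 + 1, ?_⟩
      rw [hval, blt_iff.2 (Nat.lt_succ_self _)]
      cases Nat.ble n 0 <;> rfl
    refine ⟨q, hq, 0, ⟨by simp, fun i _ k => ?_⟩, fun y _ => ?_⟩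
    · obtain ⟨m, hm⟩ := hqs (Nat.pair i k + 1)
      rw [hval] at hm
      have h0 : component q i k = 0 := by
        change q (Nat.pair i k + 1) = 0
        revert hm
        rw [show Nat.ble (Nat.pair i k + 1) 0 = false from rfl, cond_false]
        cases Nat.blt (Nat.pair i k + 1 - 1).unpair.2 m
        · rw [cond_false]; simp
        · rw [cond_true]; intro h; simpa using h.symm
      rw [h0]
      simp
    · rw [← SetLike.mem_coe, hA]; trivial
  · have hmem : ∀ x : unitInterval, x ∈ A ↔ x = a := fun x => by
      rw [← SetLike.mem_coe, hA]; rfl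
    have hcov : ∀ x ∈ Set.Icc (0 : ℝ) 1, x ≠ a →
        ∃ l, x ∈ Set.Ioo (ratOf (p l).unpair.1 : ℝ) (ratOf (p l).unpair.2 : ℝ) := by
      intro x hx hxa
      exact (hp ⟨x, hx⟩).1 (by rw [hmem]; exact fun h => hxa (congrArg Subtype.val h))
    have hnot : ∀ l, ¬ ((a : ℝ) ∈ Set.Ioo (ratOf (p l).unpair.1 : ℝ)
        (ratOf (p l).unpair.2 : ℝ)) := fun l hl => (hp a).2 ⟨l, hl⟩ ((hmem a).2 rfl)
    have hex : ∃ s, meetsUnit (p s) = true := by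
      obtain ⟨x, hx⟩ := exists_ne a
      obtain ⟨l, hl⟩ := (hp x).1 (by rw [hmem]; exact hx)
      exact ⟨l, meetsUnit_iff.2 ⟨x, hl⟩⟩
    classical
    let s := Nat.find hex
    have hs : meetsUnit (p s) = true := Nat.find_spec hex
    have hs' : ∀ t < s, meetsUnit (p t) = false := fun t ht =>
      Bool.eq_false_iff.2 (Nat.find_min hex ht)
    have hlate : ∀ k, s ≤ k → firstHit (fun s => meetsUnit (p s)) (k + 1) = s + 1 := fun k hk =>
      firstHit_eq_succ (by omega) hs hs'
    have hearly : ∀ k, k < s → firstHit (fun s => meetsUnit (p s)) (k + 1) = 0 := fun k hk =>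
      firstHit_eq_zero fun t ht => hs' t (by omega)
    have hentry : ∀ i k m x, aoucPolynomialEntry (initialWord p m) (Nat.pair i k + 1) = some x →
        (k < s ∧ x = 0) ∨ (s ≤ k ∧ (2 ≤ i ∨ (i = 1 ∧ x = qhalf s) ∨ (i = 0 ∧
          ∃ v, |(ratOf v : ℝ) - a| < 2⁻¹ ^ k ∧ x = qneg (qmul (qhalf s) v)))) := by
      intro i k m x
      unfold aoucPolynomialEntry
      rw [length_initialWord, show Nat.ble (Nat.pair i k + 1) 0 = false from rfl, cond_false]
      cases hm : Nat.blt (Nat.pair i k + 1 - 1).unpair.2 m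
      · rw [cond_false]; simp
      rw [cond_true, hstage _ _ (blt_iff.1 hm)]
      simp only [Nat.add_sub_cancel, Nat.unpair_pair]
      rcases lt_or_ge k s with hk | hk
      · rw [hearly k hk, show Nat.ble 0 0 = true from rfl, cond_true]
        exact fun h => Or.inl ⟨hk, by simpa using h.symm⟩
      · rw [hlate k hk, show Nat.ble (s + 1) 0 = false from rfl, cond_false]
        intro h
        refine Or.inr ⟨hk, ?_⟩
        rcases i with _ | _ | i
        · right; right
          refine ⟨rfl, ?_⟩
          rw [show Nat.ble 2 0 = false from rfl, show Nat.ble 1 0 = false from rfl, cond_false,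
            cond_false] at h
          cases hc : coverCheck (initialWord p m) k m
          · rw [hc] at h; simp at h
          · rw [hc, cond_true, Nat.add_sub_cancel] at h
            refine ⟨_, abs_sub_lt_of_coverCheck a.2 (fun l hl => ?_) hc, by simpa using h.symm⟩
            rw [getD_initialWord (by simpa using hl)]
            exact hnot l
        · right; left
          exact ⟨rfl, (Option.some.inj h).symm⟩
        · left; omega
    obtain ⟨q, hq, hqs⟩ := hHs p fun n => by
      obtain ⟨t, ht, hc⟩ := exists_coverCheck (a := a) (n - 1).unpair.2 ((n - 1).unpair.2 + 1) hcov
      refine ⟨t, ?_⟩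
      unfold aoucPolynomialEntry
      rw [length_initialWord, blt_iff.2 ht, hc, cond_true, cond_true]
      cases Nat.ble n 0 <;> cases Nat.ble (aoucStage (initialWord p t) (n - 1).unpair.2) 0 <;>
        cases Nat.ble 2 (n - 1).unpair.1 <;> cases Nat.ble 1 (n - 1).unpair.1 <;> rfl
    have hsmall : ∀ k, k < s → (2⁻¹ : ℝ) ^ s < 2⁻¹ ^ k := fun k hk =>
      pow_lt_pow_right_of_lt_one₀ (by norm_num) (by norm_num) hk
    have hs1 : (2⁻¹ : ℝ) ^ s ≤ 1 := pow_le_one₀ (by norm_num) (by norm_num)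
    have hs0 : (0 : ℝ) < 2⁻¹ ^ s := by positivity
    have hq0 : q 0 = 1 := by
      obtain ⟨m, hm⟩ := hqs 0
      exact (Option.some.inj hm).symm
    refine ⟨q, hq, C ((2⁻¹ : ℝ) ^ s) * X + C (-((2⁻¹ : ℝ) ^ s * (a : ℝ))),
      ⟨?_, fun i hi k => ?_⟩, fun y hy => ?_⟩
    · rw [hq0]; exact natDegree_linear_le
    · obtain ⟨m, hm⟩ := hqs (Nat.pair i k + 1)
      change |(ratOf (q (Nat.pair i k + 1)) : ℝ) - _| < _
      have hi2 : i = 0 ∨ i = 1 := by omega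
      rcases hentry i k m _ hm with ⟨hk, hx⟩ | ⟨hk, h2 | ⟨rfl, hx⟩ | ⟨rfl, v, hv, hx⟩⟩
      · rw [hx, ratOf_zero]
        rcases hi2 with rfl | rfl
        · simp only [Rat.cast_zero, coeff_add, mul_coeff_zero, coeff_X_zero, mul_zero,
            coeff_C_zero, zero_add, zero_sub, neg_neg]
          rw [abs_of_nonneg (mul_nonneg hs0.le a.2.1)]
          exact (mul_le_of_le_one_right hs0.le a.2.2).trans_lt (hsmall k hk)
        · simp only [Rat.cast_zero, coeff_add, coeff_C_mul, coeff_X_one, mul_one, coeff_C_succ,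
            add_zero, zero_sub, abs_neg, abs_of_pos hs0]
          exact hsmall k hk
      · omega
      · rw [hx, ratOf_qhalf]
        simp
      · rw [hx, ratOf_qneg, ratOf_qmul, ratOf_qhalf]
        simp only [coeff_add, mul_coeff_zero, coeff_X_zero, mul_zero, coeff_C_zero, zero_add]
        push_cast
        rw [show -((2⁻¹ : ℝ) ^ s * (ratOf v : ℝ)) - -(2⁻¹ ^ s * (a : ℝ)) =
          -(2⁻¹ ^ s * ((ratOf v : ℝ) - a)) by ring, abs_neg, abs_mul, abs_of_pos hs0]
        exact (mul_le_of_le_one_left (abs_nonneg _) hs1).trans_lt hv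
    · have hev : ∀ z : ℝ, (C (2⁻¹ ^ s) * X + C (-(2⁻¹ ^ s * (a : ℝ)))).eval z =
          2⁻¹ ^ s * (z - a) := by intro z; simp; ring
      have h1 := hy ⟨a, by rw [hev]; simp⟩
      rw [hev, mul_eq_zero, or_iff_right hs0.ne', sub_eq_zero] at h1
      exact (hmem y).2 (Subtype.ext h1)

end Weihrauch

namespace Weihrauch

open Set

/-! ### Virtual roots -/

/-- A continuous strictly increasing function on `[a, b]` changes its sign at a unique point,
which may be an end point. -/
theorem exists_sign_change {φ : ℝ → ℝ} {a b : ℝ} (hab : a ≤ b) (hc : ContinuousOn φ (Icc a b))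
    (hφ : StrictMonoOn φ (Icc a b)) : ∃ x ∈ Icc a b,
      (∀ t ∈ Icc a b, t < x → φ t < 0) ∧ (∀ t ∈ Icc a b, x < t → 0 < φ t) ∧
      (∀ t ∈ Ico a b, φ t < 0 → t < x) ∧ (∀ t ∈ Ioc a b, 0 < φ t → x < t) := by
  have ha : a ∈ Icc a b := left_mem_Icc.2 hab
  have hb : b ∈ Icc a b := right_mem_Icc.2 hab
  rcases le_or_gt 0 (φ a) with h0 | h0
  · refine ⟨a, ha, fun t ht hta => absurd ht.1 hta.not_ge, fun t ht hat => h0.trans_lt (hφ ha ht hat),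
      fun t ht hneg => ?_, fun t ht _ => ht.1⟩
    exact absurd (h0.trans (hφ.monotoneOn ha (Ico_subset_Icc_self ht) ht.1)) hneg.not_ge
  rcases le_or_gt (φ b) 0 with h1 | h1
  · refine ⟨b, hb, fun t ht htb => (hφ ht hb htb).trans_le h1, fun t ht hbt => absurd ht.2 hbt.not_ge,
      fun t ht _ => ht.2, fun t ht hpos => ?_⟩
    exact absurd ((hφ.monotoneOn (Ioc_subset_Icc_self ht) hb ht.2).trans h1) hpos.not_ge
  · obtain ⟨x, hx, hx0⟩ := intermediate_value_Icc hab hc ⟨h0.le, h1.le⟩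
    refine ⟨x, hx, fun t ht h => hx0 ▸ hφ ht hx h, fun t ht h => hx0 ▸ hφ hx ht h,
      fun t ht h => (hφ.lt_iff_lt (Ico_subset_Icc_self ht) hx).1 (hx0.symm ▸ h),
      fun t ht h => (hφ.lt_iff_lt hx (Ioc_subset_Icc_self ht)).1 (hx0.symm ▸ h)⟩

/-- The sequence `z` decreases from `1` to `0` within `n + 1` steps, and `f` is positive between
`z 0` and `z 1`, negative between `z 1` and `z 2`, and so on. -/
structure IsSignPartition (f : ℝ → ℝ) (n : ℕ) (z : ℕ → ℝ) : Prop where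
  zero : z 0 = 1
  eq_zero : ∀ i, n < i → z i = 0
  antitone : Antitone z
  sign : ∀ i x, z (i + 1) < x → x < z i → 0 < (-1) ^ i * f x

/-- The position of the points `z'` relative to the points `z` is determined by the signs of
`g`. -/
structure IsSignRefinement (g : ℝ → ℝ) (z z' : ℕ → ℝ) : Prop where
  lt_iff : ∀ i t, t < z' (i + 1) ↔ t < z (i + 1) ∨ (t < z i ∧ (-1) ^ i * g t < 0)
  gt_iff : ∀ i t, z' (i + 1) < t ↔ z i < t ∨ (z (i + 1) < t ∧ 0 < (-1) ^ i * g t)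

theorem IsSignPartition.mem_Icc {f : ℝ → ℝ} {n : ℕ} {z : ℕ → ℝ} (h : IsSignPartition f n z)
    (i : ℕ) : z i ∈ Icc (0 : ℝ) 1 := by
  refine ⟨?_, h.zero ▸ h.antitone (Nat.zero_le i)⟩
  rw [← h.eq_zero (max (n + 1) i) (by omega)]
  exact h.antitone (le_max_right _ _)

theorem IsSignPartition.exists_eq {f : ℝ → ℝ} {n : ℕ} {z : ℕ → ℝ} (h : IsSignPartition f n z)
    {x : ℝ} (hx : x ∈ Icc (0 : ℝ) 1) (hfx : f x = 0) : ∃ i ≤ n + 1, z i = x := by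
  classical
  have hex : ∃ i, z i ≤ x := ⟨n + 1, by rw [h.eq_zero _ (Nat.lt_succ_self n)]; exact hx.1⟩
  have hle : Nat.find hex ≤ n + 1 :=
    Nat.find_min' hex (by rw [h.eq_zero _ (Nat.lt_succ_self n)]; exact hx.1)
  refine ⟨Nat.find hex, hle, le_antisymm (Nat.find_spec hex) (not_lt.1 fun hlt => ?_)⟩
  cases hi : Nat.find hex with
  | zero =>
    rw [hi, h.zero] at hlt
    exact hlt.not_ge hx.2
  | succ i =>
    rw [hi] at hlt
    have := h.sign i x hlt (not_le.1 (Nat.find_min hex (by omega)))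
    rw [hfx, mul_zero] at this
    exact lt_irrefl _ this

theorem IsSignPartition.exists_refinement {f g : ℝ → ℝ} {n : ℕ} {z : ℕ → ℝ}
    (h : IsSignPartition f n z) (hg : ∀ x, HasDerivAt g (f x) x) :
    ∃ z', IsSignPartition g (n + 1) z' ∧ IsSignRefinement g z z' := by
  have hgc : Continuous g := continuous_iff_continuousAt.2 fun x => (hg x).continuousAt
  have hex : ∀ i, _ := fun i => exists_sign_change (φ := fun t => (-1) ^ i * g t)
    (h.antitone (Nat.le_succ i)) (continuous_const.mul hgc).continuousOn
    (strictMonoOn_of_deriv_pos (convex_Icc _ _) (continuous_const.mul hgc).continuousOn (by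
      intro x hx
      rw [interior_Icc] at hx
      rw [((hg x).const_mul ((-1) ^ i)).deriv]
      exact h.sign i x hx.1 hx.2))
  choose y hy h1 h2 h3 h4 using hex
  let z' : ℕ → ℝ := fun i => Nat.casesOn i 1 y
  refine ⟨z', ⟨rfl, ?_, antitone_nat_of_succ_le ?_, ?_⟩, ⟨fun i t => ?_, fun i t => ?_⟩⟩
  · rintro (_ | i) hi
    · omega
    · have h5 := hy i
      rw [h.eq_zero i (by omega), h.eq_zero (i + 1) (by omega)] at h5
      exact le_antisymm h5.2 h5.1
  · rintro (_ | i)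
    · exact (hy 0).2.trans h.zero.le
    · exact (hy (i + 1)).2.trans (hy i).1
  · rintro (_ | i) x hx1 hx2
    · exact h2 0 x ⟨(hy 0).1.trans hx1.le, hx2.le.trans h.zero.ge⟩ hx1
    · rcases le_or_gt x (z (i + 1)) with hx | hx
      · exact h2 (i + 1) x ⟨(hy (i + 1)).1.trans hx1.le, hx⟩ hx1
      · have := h1 i x ⟨hx.le, hx2.le.trans (hy i).2⟩ hx2
        rw [pow_succ]
        linarith
  · constructor
    · intro ht
      by_cases hz : t < z (i + 1)
      · exact Or.inl hz
      · exact Or.inr ⟨lt_of_lt_of_le ht (hy i).2,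
          h1 i t ⟨not_lt.1 hz, ht.le.trans (hy i).2⟩ ht⟩
    · rintro (ht | ⟨ht, hneg⟩)
      · exact ht.trans_le (hy i).1
      · by_cases hz : t < z (i + 1)
        · exact hz.trans_le (hy i).1
        · exact h3 i t ⟨not_lt.1 hz, ht⟩ hneg
  · constructor
    · intro ht
      by_cases hz : z i < t
      · exact Or.inl hz
      · exact Or.inr ⟨lt_of_le_of_lt (hy i).1 ht,
          h2 i t ⟨(hy i).1.trans ht.le, not_lt.1 hz⟩ ht⟩
    · rintro (ht | ⟨ht, hpos⟩)
      · exact (hy i).2.trans_lt ht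
      · by_cases hz : z i < t
        · exact (hy i).2.trans_lt hz
        · exact h4 i t ⟨ht, not_lt.1 hz⟩ hpos

/-- The virtual roots of the members of a chain of functions, each the derivative of the next,
that starts with a positive function. -/
theorem exists_virtualRoots {f : ℕ → ℝ → ℝ} {m : ℕ} (h0 : ∀ x ∈ Icc (0 : ℝ) 1, 0 < f 0 x)
    (hf : ∀ n < m, ∀ x, HasDerivAt (f (n + 1)) (f n x) x) : ∃ z : ℕ → ℕ → ℝ,
      (∀ n ≤ m, IsSignPartition (f n) n (z n)) ∧
        ∀ n < m, IsSignRefinement (f (n + 1)) (z n) (z (n + 1)) := by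
  have hstep : ∀ n (z : ℕ → ℝ), ∃ z', n < m → IsSignPartition (f n) n z →
      IsSignPartition (f (n + 1)) (n + 1) z' ∧ IsSignRefinement (f (n + 1)) z z' := by
    intro n z
    by_cases h : n < m ∧ IsSignPartition (f n) n z
    · obtain ⟨z', hz'⟩ := h.2.exists_refinement (hf n h.1)
      exact ⟨z', fun _ _ => hz'⟩
    · exact ⟨z, fun h1 h2 => absurd ⟨h1, h2⟩ h⟩
  choose next hnext using hstep
  let z : ℕ → ℕ → ℝ := fun n => Nat.rec (fun i => if i = 0 then 1 else 0) next n
  have hz : ∀ n ≤ m, IsSignPartition (f n) n (z n) := by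
    intro n hn
    induction n with
    | zero =>
      refine ⟨rfl, fun i hi => if_neg hi.ne', antitone_nat_of_succ_le fun i => ?_, ?_⟩
      · change (if i + 1 = 0 then (1 : ℝ) else 0) ≤ if i = 0 then 1 else 0
        rw [if_neg (Nat.succ_ne_zero i)]
        split <;> norm_num
      · rintro (_ | i) x hx1 hx2
        · rw [pow_zero, one_mul]
          exact h0 x ⟨hx1.le, hx2.le⟩
        · exact absurd (lt_trans hx1 hx2) (lt_irrefl (0 : ℝ))
    | succ n ih => exact (hnext n _ hn (ih (by omega))).1
  exact ⟨z, hz, fun n hn => (hnext n _ hn (hz n hn.le)).2⟩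

end Weihrauch

namespace Weihrauch

open RepresentedSpace Polynomial Filter Topology Set

/-! ### Verified signs of the derivatives of a polynomial -/

/-- The falling factorial, by primitive recursion. -/
def fallFactorial (n k : ℕ) : ℕ := Nat.rec 1 (fun i r => (n - i) * r) k

theorem fallFactorial_eq (n k : ℕ) : fallFactorial n k = n.descFactorial k := by
  induction k with
  | zero => rfl
  | succ k ih =>
    rw [Nat.descFactorial_succ, ← ih]
    rfl

def qsign (e c : ℕ) : ℕ := bif Nat.ble (e % 2) 0 then c else qneg c

theorem ratOf_qsign (e c : ℕ) : ratOf (qsign e c) = (-1) ^ e * ratOf c := by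
  rcases Nat.even_or_odd e with he | he
  · rw [qsign, Nat.even_iff.1 he, he.neg_one_pow, one_mul]
    rfl
  · rw [qsign, Nat.odd_iff.1 he, he.neg_one_pow, neg_one_mul, ← ratOf_qneg]
    rfl

/-- With the coefficients of a polynomial `P` of degree at most `d` given by `o` up to an error of
`2⁻ᴺ`: is the `j`-th derivative of `(-1)ᵉ P` certainly positive on the rational interval
`[l, u]`? -/
def signCheck (o : ℕ → ℕ) (d N j e l u : ℕ) : Bool :=
  qlt 0 (qsum (fun k => qadd
    (qmin
      (qmul (qsign e (qmul (qmk (fallFactorial (k + j) j) 0 0) (o (Nat.pair (k + j) N + 1))))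
        (qpow l k))
      (qmul (qsign e (qmul (qmk (fallFactorial (k + j) j) 0 0) (o (Nat.pair (k + j) N + 1))))
        (qpow u k)))
    (qneg (qmul (qmk (fallFactorial (k + j) j) 0 0) (qhalf N)))) (d + 1 - j))

theorem pair_le_pair {i d N s : ℕ} (hi : i ≤ d) (hN : N ≤ s) : Nat.pair i N ≤ Nat.pair d s := by
  have h1 : Nat.pair i N ≤ Nat.pair d N := by
    rcases hi.lt_or_eq with h | rfl
    exacts [(Nat.pair_lt_pair_left N h).le, le_rfl]
  have h2 : Nat.pair d N ≤ Nat.pair d s := by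
    rcases hN.lt_or_eq with h | rfl
    exacts [(Nat.pair_lt_pair_right d h).le, le_rfl]
  exact h1.trans h2

theorem signCheck_congr {o o' : ℕ → ℕ} {d s : ℕ} (h : ∀ k < Nat.pair d s + 2, o k = o' k) {N : ℕ}
    (hN : N ≤ s) (j e l u : ℕ) : signCheck o d N j e l u = signCheck o' d N j e l u := by
  unfold signCheck
  rw [qsum_congr fun k hk => by
    rw [h (Nat.pair (k + j) N + 1)
      (by have := pair_le_pair (show k + j ≤ d by omega) hN; omega)]]

/-- The lower bound for `(-1)ᵉ P⁽ʲ⁾` on `[l, u]` that is approximated in `signCheck`. -/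
noncomputable def signBound (P : ℝ[X]) (d j e : ℕ) (l u : ℝ) : ℝ :=
  ∑ k ∈ Finset.range (d + 1 - j), min ((-1) ^ e * ((derivative^[j] P).coeff k) * l ^ k)
    ((-1) ^ e * ((derivative^[j] P).coeff k) * u ^ k)

theorem coeff_iterate_derivative_eq (P : ℝ[X]) (j k : ℕ) :
    (derivative^[j] P).coeff k = (fallFactorial (k + j) j : ℝ) * P.coeff (k + j) := by
  rw [coeff_iterate_derivative, fallFactorial_eq, nsmul_eq_mul]

theorem eval_iterate_derivative_eq_sum {P : ℝ[X]} {d : ℕ} (hP : P.natDegree ≤ d) {j : ℕ}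
    (hj : j ≤ d) (e : ℕ) (x : ℝ) : (-1) ^ e * (derivative^[j] P).eval x =
      ∑ k ∈ Finset.range (d + 1 - j), (-1) ^ e * ((derivative^[j] P).coeff k) * x ^ k := by
  have := natDegree_iterate_derivative P j
  rw [eval_eq_sum_range' (show (derivative^[j] P).natDegree < d + 1 - j by omega), Finset.mul_sum]
  exact Finset.sum_congr rfl fun k _ => by ring

theorem signBound_self {P : ℝ[X]} {d : ℕ} (hP : P.natDegree ≤ d) {j : ℕ} (hj : j ≤ d) (e : ℕ)
    (x : ℝ) : signBound P d j e x x = (-1) ^ e * (derivative^[j] P).eval x := by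
  rw [eval_iterate_derivative_eq_sum hP hj, signBound]
  exact Finset.sum_congr rfl fun k _ => min_self _

theorem continuous_signBound (P : ℝ[X]) (d j e : ℕ) :
    Continuous fun x : ℝ × ℝ => signBound P d j e x.1 x.2 := by
  unfold signBound
  fun_prop

/-- The approximate lower bound computed in `signCheck`. -/
noncomputable def signApprox (o : ℕ → ℕ) (d N j e : ℕ) (l u : ℝ) : ℝ :=
  ∑ k ∈ Finset.range (d + 1 - j),
    (min ((-1) ^ e * ((fallFactorial (k + j) j : ℝ) * ratOf (o (Nat.pair (k + j) N + 1))) * l ^ k)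
      ((-1) ^ e * ((fallFactorial (k + j) j : ℝ) * ratOf (o (Nat.pair (k + j) N + 1))) * u ^ k) -
        (fallFactorial (k + j) j : ℝ) * 2⁻¹ ^ N)

theorem signCheck_iff {o : ℕ → ℕ} {d N j e l u : ℕ} :
    signCheck o d N j e l u = true ↔ 0 < signApprox o d N j e (ratOf l) (ratOf u) := by
  unfold signCheck signApprox
  rw [qlt_iff, ← Rat.cast_lt (K := ℝ), ratOf_qsum, ratOf_zero, Rat.cast_zero, Rat.cast_sum]
  refine iff_of_eq (congrArg _ (Finset.sum_congr rfl fun k _ => ?_))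
  rw [ratOf_qadd, ratOf_qmin, ratOf_qneg, ratOf_qmul, ratOf_qmul, ratOf_qmul, ratOf_qsign,
    ratOf_qpow, ratOf_qpow, ratOf_qhalf, ratOf_qmul, ratOf_qmk]
  push_cast
  simp only [sub_zero, zero_add, div_one]
  rw [sub_eq_add_neg]

theorem pos_of_signCheck {p : Baire} {P : ℝ[X]} (hp : IsName p P) {N j e l u : ℕ} (hj : j ≤ p 0)
    (hl : (0 : ℝ) ≤ ratOf l) (hu : (ratOf u : ℝ) ≤ 1) (h : signCheck p (p 0) N j e l u = true)
    {x : ℝ} (hlx : (ratOf l : ℝ) ≤ x) (hxu : x ≤ ratOf u) :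
    0 < (-1) ^ e * (derivative^[j] P).eval x := by
  rw [signCheck_iff] at h
  refine h.trans_le ?_
  rw [eval_iterate_derivative_eq_sum hp.1 hj]
  refine Finset.sum_le_sum fun k hk => ?_
  have hk : k + j ≤ p 0 := by have := Finset.mem_range.1 hk; omega
  have hname : |(ratOf (p (Nat.pair (k + j) N + 1)) : ℝ) - P.coeff (k + j)| < 2⁻¹ ^ N :=
    hp.2 (k + j) hk N
  rw [coeff_iterate_derivative_eq]
  set F : ℝ := (fallFactorial (k + j) j : ℝ) with hF
  have hF0 : 0 ≤ F := Nat.cast_nonneg _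
  set v : ℝ := (ratOf (p (Nat.pair (k + j) N + 1)) : ℝ)
  set w : ℝ := P.coeff (k + j)
  have hx0 : 0 ≤ x := hl.trans hlx
  have hxk0 : 0 ≤ x ^ k := pow_nonneg hx0 k
  have hxk1 : x ^ k ≤ 1 := pow_le_one₀ hx0 (hxu.trans hu)
  have h1 : (ratOf l : ℝ) ^ k ≤ x ^ k := pow_le_pow_left₀ hl hlx k
  have h2 : x ^ k ≤ (ratOf u : ℝ) ^ k := pow_le_pow_left₀ hx0 hxu k
  have h3 : min ((-1) ^ e * (F * v) * (ratOf l : ℝ) ^ k) ((-1) ^ e * (F * v) * (ratOf u : ℝ) ^ k) ≤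
      (-1) ^ e * (F * v) * x ^ k := by
    rcases le_total 0 ((-1) ^ e * (F * v)) with hs | hs
    · exact (min_le_left _ _).trans (mul_le_mul_of_nonneg_left h1 hs)
    · exact (min_le_right _ _).trans (mul_le_mul_of_nonpos_left h2 hs)
  have h4 : (-1) ^ e * (F * v) * x ^ k - (-1) ^ e * (F * w) * x ^ k ≤ F * 2⁻¹ ^ N := by
    calc (-1) ^ e * (F * v) * x ^ k - (-1) ^ e * (F * w) * x ^ k
        = (-1) ^ e * (F * (v - w)) * x ^ k := by ring
      _ ≤ |(-1) ^ e * (F * (v - w)) * x ^ k| := le_abs_self _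
      _ = F * |v - w| * x ^ k := by
        rw [abs_mul, abs_mul, abs_mul, abs_neg_one_pow, one_mul, abs_of_nonneg hF0,
          abs_of_nonneg hxk0]
      _ ≤ F * |v - w| := mul_le_of_le_one_right (mul_nonneg hF0 (abs_nonneg _)) hxk1
      _ ≤ F * 2⁻¹ ^ N := mul_le_mul_of_nonneg_left hname.le hF0
  linarith

theorem eventually_signCheck {p : Baire} {P : ℝ[X]} (hp : IsName p P) {j e l u : ℕ}
    (h : 0 < signBound P (p 0) j e (ratOf l) (ratOf u)) :
    ∀ᶠ N in atTop, signCheck p (p 0) N j e l u = true := by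
  have hpow : Tendsto (fun N : ℕ => (2⁻¹ : ℝ) ^ N) atTop (𝓝 0) :=
    tendsto_pow_atTop_nhds_zero_of_lt_one (by norm_num) (by norm_num)
  have hlim : Tendsto (fun N => signApprox p (p 0) N j e (ratOf l) (ratOf u)) atTop
      (𝓝 (signBound P (p 0) j e (ratOf l) (ratOf u))) := by
    refine tendsto_finsetSum _ fun k hk => ?_
    have hk : k + j ≤ p 0 := by have := Finset.mem_range.1 hk; omega
    have hv : Tendsto (fun N => (ratOf (p (Nat.pair (k + j) N + 1)) : ℝ)) atTop
        (𝓝 (P.coeff (k + j))) := by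
      rw [tendsto_iff_dist_tendsto_zero]
      refine squeeze_zero (fun _ => dist_nonneg) (fun N => ?_) hpow
      rw [Real.dist_eq]
      exact (hp.2 (k + j) hk N).le
    rw [coeff_iterate_derivative_eq]
    have h1 := ((hv.const_mul (fallFactorial (k + j) j : ℝ)).const_mul ((-1) ^ e))
    have h2 := ((h1.mul_const ((ratOf l : ℝ) ^ k)).min (h1.mul_const ((ratOf u : ℝ) ^ k))).sub
      (hpow.const_mul (fallFactorial (k + j) j : ℝ))
    rwa [mul_zero, sub_zero] at h2
  filter_upwards [hlim.eventually (lt_mem_nhds h)] with N hN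
  exact signCheck_iff.2 hN

/-! ### Verified bounds for virtual roots -/

/-- Count the verified sign changes (or, with `up`, the places without verified sign agreement) in
the sequence of the derivatives of orders `m, …, 0` at a rational point `x`, where `(-1)ᵇ` is the
sign of the first of them. -/
def signCount (o : ℕ → ℕ) (d N m b : ℕ) (up : Bool) (x n : ℕ) : ℕ :=
  Nat.rec (bif up then 1 else 0) (fun n r =>
    bif signCheck o d N (m - (n + 1)) (r + 1 + b) x x then (bif up then r else r + 1)
    else (bif up then r + 1 else r)) n

theorem signCount_false_succ (o : ℕ → ℕ) (d N m b x n : ℕ) :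
    signCount o d N m b false x (n + 1) =
      bif signCheck o d N (m - (n + 1)) (signCount o d N m b false x n + 1 + b) x x then
        signCount o d N m b false x n + 1 else signCount o d N m b false x n := rfl

theorem signCount_true_succ (o : ℕ → ℕ) (d N m b x n : ℕ) :
    signCount o d N m b true x (n + 1) =
      bif signCheck o d N (m - (n + 1)) (signCount o d N m b true x n + 1 + b) x x then
        signCount o d N m b true x n else signCount o d N m b true x n + 1 := rfl

theorem signCount_congr {o o' : ℕ → ℕ} {d s : ℕ} (h : ∀ k < Nat.pair d s + 2, o k = o' k) {N : ℕ}
    (hN : N ≤ s) (m b : ℕ) (up : Bool) (x n : ℕ) :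
    signCount o d N m b up x n = signCount o' d N m b up x n := by
  induction n with
  | zero => rfl
  | succ n ih =>
    cases up
    · rw [signCount_false_succ, signCount_false_succ, ih, signCheck_congr h hN]
    · rw [signCount_true_succ, signCount_true_succ, ih, signCheck_congr h hN]

/-- The data of virtual roots `z` of a polynomial `P` whose `m`-th derivative has the sign `(-1)ᵇ`
on the unit interval. -/
structure IsVirtualRoots (P : ℝ[X]) (m b : ℕ) (z : ℕ → ℕ → ℝ) : Prop where
  partition : ∀ n ≤ m, IsSignPartition (fun x => (-1) ^ b * (derivative^[m - n] P).eval x) n (z n)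
  refinement : ∀ n < m, IsSignRefinement
    (fun x => (-1) ^ b * (derivative^[m - (n + 1)] P).eval x) (z n) (z (n + 1))

theorem exists_isVirtualRoots {P : ℝ[X]} {m b : ℕ}
    (h : ∀ x ∈ Icc (0 : ℝ) 1, 0 < (-1) ^ b * (derivative^[m] P).eval x) :
    ∃ z, IsVirtualRoots P m b z := by
  obtain ⟨z, h1, h2⟩ := exists_virtualRoots (m := m)
    (f := fun n x => (-1) ^ b * (derivative^[m - n] P).eval x) h (by
      intro n hn x
      have h3 : derivative^[m - n] P = derivative (derivative^[m - (n + 1)] P) := by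
        rw [← Function.iterate_succ_apply' derivative, show (m - (n + 1)).succ = m - n by omega]
      rw [h3]
      exact (Polynomial.hasDerivAt _ x).const_mul _)
  exact ⟨z, h1, h2⟩

section

variable {p : Baire} {P : ℝ[X]} {m b : ℕ} {z : ℕ → ℕ → ℝ}

theorem IsVirtualRoots.lt_of_signCount (hz : IsVirtualRoots P m b z) (hp : IsName p P)
    (hm : m ≤ p 0) {x : ℕ} (hx0 : (0 : ℝ) ≤ ratOf x) (hx1 : (ratOf x : ℝ) < 1) (N : ℕ) {n : ℕ}
    (hn : n ≤ m) : (ratOf x : ℝ) < z n (signCount p (p 0) N m b false x n) := by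
  induction n with
  | zero => exact hx1.trans_eq (hz.partition 0 hn).zero.symm
  | succ n ih =>
    specialize ih (by omega)
    rw [signCount_false_succ]
    set r := signCount p (p 0) N m b false x n
    have href := hz.refinement n hn
    cases hc : signCheck p (p 0) N (m - (n + 1)) (r + 1 + b) x x
    · rw [cond_false]
      cases hr : r with
      | zero => exact hx1.trans_eq (hz.partition (n + 1) hn).zero.symm
      | succ i => exact (href.lt_iff i _).2 (Or.inl (hr ▸ ih))
    · rw [cond_true]
      have := pos_of_signCheck hp (by omega) hx0 hx1.le hc le_rfl le_rfl
      refine (href.lt_iff r _).2 (Or.inr ⟨ih, ?_⟩)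
      rw [pow_add, pow_succ] at this
      linarith

theorem IsVirtualRoots.signCount_lt (hz : IsVirtualRoots P m b z) (hp : IsName p P)
    (hm : m ≤ p 0) {x : ℕ} (hx0 : (0 : ℝ) < ratOf x) (hx1 : (ratOf x : ℝ) ≤ 1) (N : ℕ) {n : ℕ}
    (hn : n ≤ m) : z n (signCount p (p 0) N m b true x n) < ratOf x := by
  induction n with
  | zero => exact ((hz.partition 0 hn).eq_zero 1 Nat.one_pos).trans_lt hx0
  | succ n ih =>
    specialize ih (by omega)
    rw [signCount_true_succ]
    set r := signCount p (p 0) N m b true x n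
    have href := hz.refinement n hn
    cases hc : signCheck p (p 0) N (m - (n + 1)) (r + 1 + b) x x
    · exact (href.gt_iff r _).2 (Or.inl ih)
    · rw [cond_true]
      have := pos_of_signCheck hp (by omega) hx0.le hx1 hc le_rfl le_rfl
      cases hr : r with
      | zero =>
        rw [hr, (hz.partition n (by omega)).zero] at ih
        exact absurd ih hx1.not_gt
      | succ i =>
        rw [hr] at this ih
        refine (href.gt_iff i _).2 (Or.inr ⟨ih, ?_⟩)
        rw [pow_add, pow_succ, pow_succ] at this
        linarith

theorem eventually_forall_signCheck (hp : IsName p P) {j : ℕ} (hj : j ≤ p 0) (x E : ℕ) :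
    ∀ᶠ N in atTop, ∀ e ∈ Finset.range E, 0 < (-1) ^ e * (derivative^[j] P).eval (ratOf x : ℝ) →
      signCheck p (p 0) N j e x x = true := by
  rw [eventually_all_finset]
  intro e _
  by_cases h : 0 < (-1) ^ e * (derivative^[j] P).eval (ratOf x : ℝ)
  · filter_upwards [eventually_signCheck hp (j := j) (e := e) (l := x) (u := x)
      (by rwa [signBound_self hp.1 hj])] with N hN _ using hN
  · exact Eventually.of_forall fun N h' => absurd h' h

theorem IsVirtualRoots.eventually_le_signCount (hz : IsVirtualRoots P m b z) (hp : IsName p P)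
    (hm : m ≤ p 0) {x : ℕ} (hx0 : (0 : ℝ) ≤ ratOf x) {n : ℕ} (hn : n ≤ m) :
    ∀ᶠ N in atTop, ∀ i, (ratOf x : ℝ) < z n i → i ≤ signCount p (p 0) N m b false x n := by
  induction n with
  | zero =>
    refine Eventually.of_forall fun N i hi => ?_
    by_contra hlt
    rw [(hz.partition 0 hn).eq_zero i (by omega)] at hi
    exact hi.not_ge hx0
  | succ n ih =>
    filter_upwards [ih (by omega), eventually_forall_signCheck hp (j := m - (n + 1)) (by omega) x
      (n + b + 2)] with N hN hc i hi
    rw [signCount_false_succ]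
    set r := signCount p (p 0) N m b false x n
    have hmono : r ≤ bif signCheck p (p 0) N (m - (n + 1)) (r + 1 + b) x x then r + 1 else r := by
      cases signCheck p (p 0) N (m - (n + 1)) (r + 1 + b) x x
      exacts [le_rfl, Nat.le_succ _]
    rcases i with _ | i
    · exact Nat.zero_le _
    rcases ((hz.refinement n hn).lt_iff i _).1 hi with h | ⟨h, hneg⟩
    · exact (hN _ h).trans hmono
    · rcases (hN i h).lt_or_eq with hlt | heq
      · exact Nat.succ_le_of_lt (hlt.trans_le hmono)
      · have hin : i ≤ n := by
          by_contra hlt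
          rw [(hz.partition n (by omega)).eq_zero i (by omega)] at h
          exact h.not_ge hx0
        rw [← heq, hc (i + 1 + b) (Finset.mem_range.2 (by omega)), cond_true]
        rw [pow_add, pow_succ]
        linarith

theorem IsVirtualRoots.eventually_signCount_le (hz : IsVirtualRoots P m b z) (hp : IsName p P)
    (hm : m ≤ p 0) {x : ℕ} (hx0 : (0 : ℝ) < ratOf x) (hx1 : (ratOf x : ℝ) ≤ 1) {n : ℕ}
    (hn : n ≤ m) :
    ∀ᶠ N in atTop, ∀ i, z n i < ratOf x → signCount p (p 0) N m b true x n ≤ i := by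
  induction n with
  | zero =>
    refine Eventually.of_forall fun N i hi => ?_
    rcases i with _ | i
    · rw [(hz.partition 0 hn).zero] at hi
      exact absurd hi hx1.not_gt
    · exact Nat.succ_le_succ (Nat.zero_le i)
  | succ n ih =>
    filter_upwards [ih (by omega), eventually_forall_signCheck hp (j := m - (n + 1)) (by omega) x
      (n + b + 3)] with N hN hc i hi
    rw [signCount_true_succ]
    set r := signCount p (p 0) N m b true x n
    have hmono : (bif signCheck p (p 0) N (m - (n + 1)) (r + 1 + b) x x then r else r + 1) ≤
        r + 1 := by
      cases signCheck p (p 0) N (m - (n + 1)) (r + 1 + b) x x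
      exacts [le_rfl, Nat.le_succ _]
    rcases i with _ | i
    · rw [(hz.partition (n + 1) hn).zero] at hi
      exact absurd hi hx1.not_gt
    rcases ((hz.refinement n hn).gt_iff i _).1 hi with h | ⟨h, hpos⟩
    · exact hmono.trans (Nat.succ_le_succ (hN i h))
    · rcases (hN _ h).lt_or_eq with hlt | heq
      · exact hmono.trans hlt
      · have hin : i ≤ n := by
          by_contra hlt
          have := hN i (by rwa [(hz.partition n (by omega)).eq_zero i (by omega)])
          omega
        rw [heq, hc (i + 1 + 1 + b) (Finset.mem_range.2 (by omega)), cond_true]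
        rw [pow_add, pow_succ, pow_succ]
        linarith

end

end Weihrauch

namespace Weihrauch

open RepresentedSpace

/-! ### Nested finite parallelization -/

/-- `∑ k < n, f k`, by primitive recursion. -/
def sumLt (f : ℕ → ℕ) (n : ℕ) : ℕ := Nat.rec 0 (fun k r => r + f k) n

theorem lt_sumLt {f : ℕ → ℕ} {n k x : ℕ} (hk : k < n) (h : x < f k) : x < sumLt f n := by
  induction n with
  | zero => omega
  | succ n ih =>
    change x < sumLt f n + f n
    rcases Nat.lt_succ_iff_lt_or_eq.1 hk with hk | rfl
    · have := ih hk; omega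
    · omega

theorem sumLt_congr {f g : ℕ → ℕ} {n : ℕ} (h : ∀ k < n, f k = g k) : sumLt f n = sumLt g n := by
  induction n with
  | zero => rfl
  | succ n ih =>
    change sumLt f n + f n = sumLt g n + g n
    rw [ih fun k hk => h k (by omega), h n (by omega)]

@[fun_prop] theorem primrec_sumLt {α : Type*} [Primcodable α] {f : α → ℕ → ℕ} {n : α → ℕ}
    (hf : Primrec fun x : α × ℕ => f x.1 x.2) (hn : Primrec n) :
    Primrec fun a => sumLt (f a) (n a) := by unfold sumLt; fun_prop

def flattenEntry (w : List ℕ) (n : ℕ) : Option ℕ :=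
  bif Nat.blt 0 w.length && ballLt (fun i => Nat.blt (Nat.pair i 0 + 1) w.length) (w.getD 0 0) then
    bif Nat.ble n 0 then
      some (sumLt (fun i => Nat.pair i (w.getD (Nat.pair i 0 + 1) 0) + 1) (w.getD 0 0))
    else
      bif Nat.blt (n - 1).unpair.1.unpair.1 (w.getD 0 0) && Nat.blt (n - 1).unpair.1.unpair.2
          (w.getD (Nat.pair (n - 1).unpair.1.unpair.1 0 + 1) 0) then
        w[Nat.pair (n - 1).unpair.1.unpair.1
          (Nat.pair (n - 1).unpair.1.unpair.2 (n - 1).unpair.2 + 1) + 1]?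
      else some 0
  else none

theorem primrec_flattenEntry : Primrec fun x : List ℕ × ℕ => flattenEntry x.1 x.2 := by
  unfold flattenEntry
  fun_prop

/-- The value eventually found by `flattenEntry`. -/
def flattenValue (p : Baire) (n : ℕ) : ℕ :=
  bif Nat.ble n 0 then sumLt (fun i => Nat.pair i (component p i 0) + 1) (p 0) else
    bif Nat.blt (n - 1).unpair.1.unpair.1 (p 0) && Nat.blt (n - 1).unpair.1.unpair.2
        (component p (n - 1).unpair.1.unpair.1 0) then
      component (component p (n - 1).unpair.1.unpair.1) (n - 1).unpair.1.unpair.2 (n - 1).unpair.2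
    else 0

theorem flattenEntry_initialWord (p : Baire) (n m : ℕ) :
    flattenEntry (initialWord p m) n = some (flattenValue p n) ∨
      flattenEntry (initialWord p m) n = none := by
  unfold flattenEntry flattenValue
  rw [length_initialWord]
  rcases hm : Nat.blt 0 m
  · right; simp
  rw [getD_initialWord (blt_iff.1 hm), Bool.true_and]
  rcases hb : ballLt (fun i => Nat.blt (Nat.pair i 0 + 1) m) (p 0)
  · right; rfl
  have hb' : ∀ i < p 0, (initialWord p m).getD (Nat.pair i 0 + 1) 0 = component p i 0 :=
    fun i hi => getD_initialWord (blt_iff.1 (ballLt_iff.1 hb i hi))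
  rw [cond_true]
  rcases Nat.ble n 0
  · rw [cond_false, cond_false]
    rcases hi : Nat.blt (n - 1).unpair.1.unpair.1 (p 0)
    · left; rfl
    · rw [hb' _ (blt_iff.1 hi), Bool.true_and]
      rcases Nat.blt (n - 1).unpair.1.unpair.2 (component p (n - 1).unpair.1.unpair.1 0)
      · left; rfl
      · rw [cond_true, cond_true]
        rcases h : (initialWord p m)[Nat.pair (n - 1).unpair.1.unpair.1
          (Nat.pair (n - 1).unpair.1.unpair.2 (n - 1).unpair.2 + 1) + 1]? with _ | v
        · right; rfl
        · left; rw [← (getElem?_initialWord_eq_some h).2]; rfl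
  · left
    rw [cond_true, cond_true, sumLt_congr fun i hi => by rw [hb' i hi]]

theorem exists_flattenEntry_isSome (p : Baire) (n : ℕ) :
    ∃ m, (flattenEntry (initialWord p m) n).isSome := by
  obtain ⟨m, h0, h1, h2⟩ : ∃ m, 0 < m ∧ (∀ i < p 0, Nat.pair i 0 + 1 < m) ∧
      Nat.pair (n - 1).unpair.1.unpair.1
        (Nat.pair (n - 1).unpair.1.unpair.2 (n - 1).unpair.2 + 1) + 1 < m := by
    refine ⟨Nat.pair (p 0) 0 + Nat.pair (n - 1).unpair.1.unpair.1
        (Nat.pair (n - 1).unpair.1.unpair.2 (n - 1).unpair.2 + 1) + 2, by omega, ?_, by omega⟩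
    intro i hi
    have := Nat.pair_lt_pair_left 0 hi
    omega
  refine ⟨m, ?_⟩
  unfold flattenEntry
  rw [length_initialWord, getElem?_initialWord h2, getD_initialWord h0, blt_iff.2 h0,
    ballLt_iff.2 fun i hi => blt_iff.2 (h1 i hi)]
  simp only [Bool.and_self, cond_true]
  rcases Nat.ble n 0 <;> [skip; rfl]
  rw [cond_false]
  cases (Nat.blt (n - 1).unpair.1.unpair.1 (p 0) && Nat.blt (n - 1).unpair.1.unpair.2
    ((initialWord p m).getD (Nat.pair (n - 1).unpair.1.unpair.1 0 + 1) 0)) <;> rfl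

theorem component_flattenValue {p : Baire} {i j : ℕ} (hi : i < p 0) (hj : j < component p i 0) :
    component (flattenValue p) (Nat.pair i j) = component (component p i) j := by
  funext k
  change flattenValue p (Nat.pair (Nat.pair i j) k + 1) = _
  unfold flattenValue
  simp only [Nat.add_sub_cancel, Nat.unpair_pair, blt_iff.2 hi, blt_iff.2 hj]
  rfl

theorem component_flattenValue_of_not {p : Baire} {e : ℕ}
    (h : ¬ (e.unpair.1 < p 0 ∧ e.unpair.2 < component p e.unpair.1 0)) :
    component (flattenValue p) e = fun _ => 0 := by
  funext k
  change flattenValue p (Nat.pair e k + 1) = _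
  unfold flattenValue
  simp only [Nat.add_sub_cancel, Nat.unpair_pair]
  have : (Nat.blt e.unpair.1 (p 0) && Nat.blt e.unpair.2 (component p e.unpair.1 0)) = false := by
    rw [Bool.eq_false_iff, ne_eq, Bool.and_eq_true, blt_iff, blt_iff]
    exact h
  rw [this]
  rfl

/-- Finite parallelization is idempotent for problems with a trivial instance to pad with. -/
theorem parallel_parallel_reducible {X Y : Type*} [RepresentedSpace X] [RepresentedSpace Y]
    {f : X → Set Y} {x₀ : X} (hx₀ : IsName (fun _ => 0) x₀) (hne : (f x₀).Nonempty) :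
    Reducible (Parallel (Parallel f)) (Parallel f) := by
  obtain ⟨H, hH, hHs⟩ := exists_isComputable_of_search primrec_flattenEntry.to_comp
  let φ : ℕ → ℕ := fun n => bif Nat.ble n 0 then 0 else
    bif Nat.ble (n - 1).unpair.2 0 then 2 * n else
      2 * (Nat.pair (Nat.pair (n - 1).unpair.1 ((n - 1).unpair.2 - 1).unpair.1)
        ((n - 1).unpair.2 - 1).unpair.2 + 1) + 1
  have hφ : Primrec φ := by fun_prop
  refine reducible_iff.2 ⟨H, _, hH, isComputable_reindex hφ, ?_⟩
  rintro p ⟨n, t⟩ ⟨hp0, hp⟩ ht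
  rw [parallel_nonempty] at ht
  have ht' := fun i => parallel_nonempty.1 (ht i)
  obtain ⟨h, hh, hhs⟩ := hHs p (exists_flattenEntry_isSome p)
  have hval : h = flattenValue p := by
    funext k
    obtain ⟨m, hm⟩ := hhs k
    rcases flattenEntry_initialWord p k m with h1 | h1
    · exact Option.some.inj (hm.symm.trans h1)
    · rw [h1] at hm; simp at hm
  subst hval
  have hp0 : p 0 = n := hp0
  have hpi : ∀ i : Fin n, component p i 0 = (t i).1 := fun i => (hp i).1
  set N := flattenValue p 0 with hN
  have hlt : ∀ (i : Fin n) (j : Fin (t i).1), Nat.pair i j < N := by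
    intro i j
    refine lt_sumLt (k := i) (by rw [hp0]; exact i.2) ?_
    rw [hpi]
    have := Nat.pair_lt_pair_right i j.2
    omega
  have hz : ∀ e : Fin N, ∃ z, IsName (component (flattenValue p) e) z ∧ (f z).Nonempty ∧
      ∀ (i : Fin n) (j : Fin (t i).1), Nat.pair i j = e → z = (t i).2 j := by
    intro e
    by_cases he : e.1.unpair.1 < p 0 ∧ e.1.unpair.2 < component p e.1.unpair.1 0
    · let i : Fin n := ⟨e.1.unpair.1, hp0 ▸ he.1⟩
      have hj : e.1.unpair.2 < (t i).1 := by rw [← hpi i]; exact he.2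
      refine ⟨(t i).2 ⟨_, hj⟩, ?_, ht' i ⟨_, hj⟩, ?_⟩
      · have := component_flattenValue he.1 he.2
        rw [Nat.pair_unpair] at this
        rw [this]
        exact (hp i).2 ⟨_, hj⟩
      · intro i' j' he'
        have h1 : i'.1 = e.1.unpair.1 := by rw [← he', Nat.unpair_pair]
        have h2 : j'.1 = e.1.unpair.2 := by rw [← he', Nat.unpair_pair]
        obtain rfl : i' = i := Fin.ext h1
        exact congrArg _ (Fin.ext h2.symm)
    · refine ⟨x₀, by rw [component_flattenValue_of_not he]; exact hx₀, hne, fun i j hij => ?_⟩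
      refine absurd ?_ he
      rw [← hij, Nat.unpair_pair, hpi, hp0]
      exact ⟨i.2, j.2⟩
  choose z hzn hzne hzeq using hz
  refine ⟨_, hh, ⟨N, z⟩, ⟨rfl, hzn⟩, parallel_nonempty.2 hzne, ?_⟩
  rintro q _ ⟨y, rfl, hy⟩ ⟨-, hq⟩
  refine ⟨_, Part.mem_some _, ⟨n, fun i => ⟨(t i).1, fun j => y ⟨Nat.pair i j, hlt i j⟩⟩⟩,
    ⟨_, rfl, fun i => ⟨_, rfl, fun j => ?_⟩⟩, ?_, fun i => ⟨?_, fun j => ?_⟩⟩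
  · rw [← hzeq ⟨Nat.pair i j, hlt i j⟩ i j rfl]
    exact hy _
  · exact (interleave_even_apply p q 0).trans hp0
  · change interleave p q (φ (Nat.pair i 0 + 1)) = _
    have : φ (Nat.pair i 0 + 1) = 2 * (Nat.pair i 0 + 1) := by
      simp [φ, show Nat.ble 0 0 = true from rfl,
        show ∀ n, Nat.ble (n + 1) 0 = false from fun _ => rfl]
    rw [this, interleave_even_apply]
    exact hpi i
  · have : component (component (fun n => interleave p q (φ n)) i) j =
        component q (Nat.pair i j) := by
      funext k
      change interleave p q (φ (Nat.pair i (Nat.pair j k + 1) + 1)) = _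
      have : φ (Nat.pair i (Nat.pair j k + 1) + 1) =
          2 * (Nat.pair (Nat.pair i j) k + 1) + 1 := by
        simp [φ, show ∀ n, Nat.ble (n + 1) 0 = false from fun _ => rfl]
      rw [this, interleave_odd_apply]
      rfl
    rw [this]
    exact hq ⟨Nat.pair i j, hlt i j⟩

theorem isName_zero_univ :
    IsName (fun _ => 0) (⊤ : TopologicalSpace.Closeds unitInterval) := by
  intro x
  refine iff_of_false (fun h => h (Set.mem_univ x)) ?_
  simp

theorem aoUC_top_nonempty : (AoUC ⊤).Nonempty :=
  ⟨0, Or.inl rfl, trivial⟩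

theorem parallel_parallel_aoUC_reducible : Reducible (Parallel (Parallel AoUC)) (Parallel AoUC) :=
  parallel_parallel_reducible isName_zero_univ aoUC_top_nonempty

end Weihrauch

namespace Weihrauch

open RepresentedSpace Polynomial Filter Topology

/-! ### Continuity of computable functions and of names -/

theorem IsComputable.continuous {F : Baire →. Baire} (hF : IsComputable F) {p q : Baire}
    (hq : q ∈ F p) (n : ℕ) : ∃ t, ∀ p' q', (∀ k < t, p' k = p k) → q' ∈ F p' →
      ∀ k < n, q' k = q k := by
  obtain ⟨g, -, hmono, hg⟩ := hF
  obtain ⟨t, ht⟩ := hg p q hq n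
  refine ⟨t, fun p' q' hp hq' k hk => ?_⟩
  obtain ⟨s, hs⟩ := hg p' q' hq' n
  rw [← initialWord_congr hp] at ht
  have h1 := ht.trans (hmono _ _ (initialWord_prefix p' (le_max_left t s)))
  have h2 := hs.trans (hmono _ _ (initialWord_prefix p' (le_max_right t s)))
  have h3 := getElem?_of_prefix h1 (getElem?_initialWord hk)
  rw [getElem?_of_prefix h2 (getElem?_initialWord hk)] at h3
  exact Option.some.inj h3

theorem interleave_congr {p p' q q' : Baire} {t : ℕ} (hp : ∀ k < t, p' k = p k)
    (hq : ∀ k < t, q' k = q k) : ∀ k < t, interleave p' q' k = interleave p q k := by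
  intro k hk
  unfold interleave
  rw [hp _ (by omega), hq _ (by omega)]

theorem eq_of_components {p p' : Baire} {t : ℕ} (h0 : p' 0 = p 0)
    (h : ∀ i, ∀ k < t, component p' i k = component p i k) : ∀ k < t, p' k = p k := by
  rintro (_ | k) hk
  · exact h0
  · have := h k.unpair.1 k.unpair.2 (by have := Nat.unpair_right_le k; omega)
    simpa [component] using this

theorem abs_sub_lt_of_isName {q q' : Baire} {x y : ℝ} {n : ℕ} (hq : IsName q x)
    (hq' : IsName q' y) (h : q' n = q n) : |y - x| < 2 * 2⁻¹ ^ n := by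
  have h1 := hq n
  have h2 := hq' n
  rw [h, abs_lt] at h2
  rw [abs_lt] at h1 ⊢
  constructor <;> linarith

theorem exists_isName_real {q : Baire} {x : ℝ} (hq : IsName q x) (t : ℕ) :
    ∀ᶠ ε in 𝓝[>] (0 : ℝ), ∀ y, |y - x| < ε → ∃ q', IsName q' y ∧ ∀ k < t, q' k = q k := by
  have h1 : ∀ᶠ ε in 𝓝[>] (0 : ℝ), ∀ k ∈ Finset.range t,
      ε < 2⁻¹ ^ k - |(ratOf (q k) : ℝ) - x| := by
    rw [eventually_all_finset]
    exact fun k _ => nhdsWithin_le_nhds (eventually_lt_nhds (sub_pos.2 (hq k)))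
  filter_upwards [h1] with ε hε y hy
  obtain ⟨r, hr⟩ := surj y
  refine ⟨fun k => if k < t then q k else r k, fun k => ?_, fun k hk => if_pos hk⟩
  by_cases hk : k < t
  · simp only [if_pos hk]
    have h2 := hε k (Finset.mem_range.2 hk)
    have h3 := abs_sub_le (ratOf (q k) : ℝ) x y
    rw [abs_sub_comm x y] at h3
    linarith
  · simp only [if_neg hk]
    exact hr k

theorem exists_isName_polynomial {p : Baire} {P R : ℝ[X]} (hp : IsName p P)
    (hR : R.natDegree ≤ P.natDegree) (t : ℕ) :
    ∃ ε > 0, ∃ p', IsName p' (P + C ε * R) ∧ ∀ k < t, p' k = p k := by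
  obtain ⟨B, hB0, hB⟩ : ∃ B > 0, ∀ i ∈ Finset.range (p 0 + 1), |R.coeff i| < B := by
    have : ∀ᶠ B in atTop, ∀ i ∈ Finset.range (p 0 + 1), |R.coeff i| < B := by
      rw [eventually_all_finset]
      exact fun i _ => eventually_gt_atTop _
    obtain ⟨B, h1, h2⟩ := (this.and (eventually_gt_atTop 0)).exists
    exact ⟨B, h2, h1⟩
  have h1 : ∀ᶠ ε in 𝓝[>] (0 : ℝ), ∀ i ∈ Finset.range (p 0 + 1), ∀ y, |y - P.coeff i| < ε →
      ∃ q', IsName q' y ∧ ∀ k < t, q' k = component p i k := by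
    rw [eventually_all_finset]
    intro i hi
    exact exists_isName_real (hp.2 i (Nat.lt_succ_iff.1 (Finset.mem_range.1 hi))) t
  obtain ⟨ε, hε, hε0⟩ := (h1.and self_mem_nhdsWithin).exists
  have hε0 : 0 < ε := hε0
  have hc : ∀ i, ∃ q', (i ≤ p 0 → IsName q' ((P + C (ε / B) * R).coeff i)) ∧
      ∀ k < t, q' k = component p i k := by
    intro i
    by_cases hi : i ≤ p 0
    · have hi' : i ∈ Finset.range (p 0 + 1) := Finset.mem_range.2 (Nat.lt_succ_of_le hi)
      obtain ⟨q', h1, h2⟩ := hε i hi' ((P + C (ε / B) * R).coeff i) (by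
        rw [coeff_add, coeff_C_mul, add_sub_cancel_left, abs_mul, abs_of_pos (by positivity),
          div_mul_eq_mul_div, div_lt_iff₀ hB0]
        exact mul_lt_mul_of_pos_left (hB i hi') hε0)
      exact ⟨q', fun _ => h1, h2⟩
    · exact ⟨component p i, fun h => absurd h hi, fun _ _ => rfl⟩
  choose c hc hct using hc
  obtain ⟨p', h0, hp'⟩ := exists_components (p 0) c
  refine ⟨ε / B, by positivity, p', ⟨?_, fun i hi => ?_⟩, eq_of_components h0 fun i k hk => ?_⟩
  · rw [h0]
    exact (natDegree_add_le _ _).trans (max_le hp.1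
      ((natDegree_C_mul_le _ _).trans (hR.trans hp.1)))
  · rw [hp']
    exact hc i (h0 ▸ hi)
  · rw [hp']
    exact hct i k hk

theorem exists_forall_mem_of_isName {h : Baire} {A : TopologicalSpace.Closeds unitInterval}
    (hA : IsName h A) {U : Set unitInterval} (hU : IsOpen U) (hAU : (A : Set unitInterval) ⊆ U) :
    ∃ t, ∀ (h' : Baire) (A' : TopologicalSpace.Closeds unitInterval), IsName h' A' →
      (∀ k < t, h' k = h k) → (A' : Set unitInterval) ⊆ U := by
  let V : ℕ → Set unitInterval := fun n =>
    {x | (x : ℝ) ∈ Set.Ioo (ratOf (h n).unpair.1 : ℝ) (ratOf (h n).unpair.2 : ℝ)}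
  obtain ⟨s, hs⟩ := (hU.isClosed_compl.isCompact).elim_finite_subcover V
    (fun n => isOpen_Ioo.preimage continuous_subtype_val) (fun x hx => by
      obtain ⟨n, hn⟩ := (hA x).1 fun hxA => hx (hAU hxA)
      exact Set.mem_iUnion.2 ⟨n, hn⟩)
  refine ⟨s.sup id + 1, fun h' A' hA' hh x hx => ?_⟩
  by_contra hxU
  obtain ⟨n, hn, hxn⟩ := Set.mem_iUnion₂.1 (hs hxU)
  refine (hA' x).2 ⟨n, ?_⟩ hx
  rw [hh n (Nat.lt_succ_of_le (Finset.le_sup (f := id) hn))]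
  exact hxn

theorem exists_isName_closeds {q : Baire} (hq : IsName q (⊤ : TopologicalSpace.Closeds unitInterval))
    (A : TopologicalSpace.Closeds unitInterval) (t : ℕ) :
    ∃ q', IsName q' A ∧ ∀ k < t, q' k = q k := by
  obtain ⟨r, hr⟩ := surj A
  refine ⟨fun k => if k < t then q k else r (k - t), fun x => ?_, fun k hk => if_pos hk⟩
  rw [hr x]
  constructor
  · rintro ⟨n, hn⟩
    exact ⟨n + t, by simpa using hn⟩
  · rintro ⟨n, hn⟩
    by_cases hnt : n < t
    · simp only [if_pos hnt] at hn
      exact absurd (Set.mem_univ x) ((hq x).2 ⟨n, hn⟩)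
    · simp only [if_neg hnt] at hn
      exact ⟨n - t, hn⟩

theorem exists_isName_tuple {n : ℕ} {x : Fin n → TopologicalSpace.Closeds unitInterval}
    {p : Baire} (hp : IsName p (⟨n, x⟩ : Σ n : ℕ, Fin n → TopologicalSpace.Closeds unitInterval))
    {i : Fin n} (hi : x i = ⊤) (A : TopologicalSpace.Closeds unitInterval) (t : ℕ) :
    ∃ p', IsName p' (⟨n, Function.update x i A⟩ :
      Σ n : ℕ, Fin n → TopologicalSpace.Closeds unitInterval) ∧ ∀ k < t, p' k = p k := by
  have hi' : IsName (component p i) (⊤ : TopologicalSpace.Closeds unitInterval) := hi ▸ hp.2 i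
  obtain ⟨q, hq, hqt⟩ := exists_isName_closeds hi' A t
  obtain ⟨p', h0, hp'⟩ := exists_components (p 0) (fun j => if j = i then q else component p j)
  refine ⟨p', ⟨h0.trans hp.1, fun j => ?_⟩, eq_of_components h0 fun j k hk => ?_⟩
  · rw [hp']
    by_cases hj : j = i
    · rw [if_pos (congrArg Fin.val hj)]
      change IsName q (Function.update x i A j)
      rw [hj, Function.update_self]
      exact hq
    · rw [if_neg fun h => hj (Fin.ext h)]
      simp only [Function.update_of_ne hj]
      exact hp.2 j
  · rw [hp']
    by_cases hj : j = i
    · rw [if_pos hj, hj]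
      exact hqt k hk
    · rw [if_neg hj]

/-! ### Bounded root finding does not reduce to all-or-unique choice -/

/-- A polynomial whose real roots are those `i / 2` with `e i = 0`, provided `0 ≤ e`. -/
noncomputable def threeRoots (e : Fin 3 → ℝ) : ℝ[X] :=
  ∏ i : Fin 3, ((X - C ((i : ℝ) / 2)) ^ 2 + C (e i))

theorem monic_factor (a b : ℝ) : ((X - C a) ^ 2 + C b).Monic ∧
    ((X - C a) ^ 2 + C b).natDegree = 2 := by
  have h2 : ((X - C a) ^ 2).Monic := (monic_X_sub_C a).pow 2
  have h3 : ((X - C a) ^ 2).natDegree = 2 := by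
    rw [(monic_X_sub_C a).natDegree_pow, natDegree_X_sub_C]
  have h4 : (C b).degree < ((X - C a) ^ 2).degree := by
    rw [degree_eq_natDegree h2.ne_zero, h3]
    exact degree_C_le.trans_lt (by norm_num)
  exact ⟨h2.add_of_left h4, by rw [natDegree_add_eq_left_of_degree_lt h4, h3]⟩

theorem threeRoots_update {e : Fin 3 → ℝ} {i : Fin 3} (hi : e i = 0) : ∃ R : ℝ[X],
    R.natDegree ≤ (threeRoots e).natDegree ∧
      ∀ ε, threeRoots (Function.update e i ε) = threeRoots e + C ε * R := by
  refine ⟨∏ j ∈ Finset.univ.erase i, ((X - C ((j : ℝ) / 2)) ^ 2 + C (e j)), ?_, fun ε => ?_⟩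
  · rw [threeRoots, natDegree_prod_of_monic _ _ fun j _ => (monic_factor _ _).1,
      natDegree_prod_of_monic _ _ fun j _ => (monic_factor _ _).1]
    exact Finset.sum_le_sum_of_subset (Finset.erase_subset _ _)
  · rw [threeRoots, threeRoots, ← Finset.mul_prod_erase _ _ (Finset.mem_univ i),
      ← Finset.mul_prod_erase _ _ (Finset.mem_univ i), Function.update_self, hi, C_0, add_zero,
      add_mul]
    rw [Finset.prod_congr rfl fun j hj => by
      rw [Function.update_of_ne (Finset.ne_of_mem_erase hj)]]

theorem eval_threeRoots_eq_zero {e : Fin 3 → ℝ} (he : ∀ i, 0 ≤ e i) {x : ℝ} :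
    (threeRoots e).eval x = 0 ↔ ∃ i : Fin 3, x = (i : ℝ) / 2 ∧ e i = 0 := by
  rw [threeRoots, eval_prod, Finset.prod_eq_zero_iff]
  refine exists_congr fun i => ?_
  simp only [Finset.mem_univ, true_and, eval_add, eval_pow, eval_sub, eval_X, eval_C]
  rw [add_eq_zero_iff_of_nonneg (sq_nonneg _) (he i), sq_eq_zero_iff, sub_eq_zero]

theorem exists_of_mem_bRoot_threeRoots {e : Fin 3 → ℝ} (he : ∀ i, 0 ≤ e i) {j : Fin 3}
    (hj : e j = 0) {y : unitInterval} (hy : y ∈ BRoot (threeRoots e)) :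
    ∃ i : Fin 3, (y : ℝ) = (i : ℝ) / 2 ∧ e i = 0 := by
  refine (eval_threeRoots_eq_zero he).1 (hy ⟨⟨(j : ℝ) / 2, by positivity, ?_⟩,
    (eval_threeRoots_eq_zero he).2 ⟨j, rfl, hj⟩⟩)
  rw [div_le_one (by norm_num)]
  exact_mod_cast Nat.lt_succ_iff.1 j.2

theorem eq_of_abs_sub_lt {i j : Fin 3} (h : |(i : ℝ) / 2 - (j : ℝ) / 2| < 1 / 2) : i = j := by
  rw [abs_lt] at h
  have h1 : (i : ℝ) < (j : ℝ) + 1 := by linarith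
  have h2 : (j : ℝ) < (i : ℝ) + 1 := by linarith
  have h1' : (i : ℕ) < j + 1 := by exact_mod_cast h1
  have h2' : (j : ℕ) < i + 1 := by exact_mod_cast h2
  exact Fin.ext (by omega)

theorem not_bRoot_reducible_aoUC : ¬ Reducible BRoot AoUC := by
  intro hred
  obtain ⟨H, K, hH, hK, hred⟩ := reducible_iff.1 hred
  have hne : ∀ P : ℝ[X], (BRoot P).Nonempty := by
    intro P
    by_cases hr : ∃ y : unitInterval, P.eval (y : ℝ) = 0
    · obtain ⟨y, hy⟩ := hr
      exact ⟨y, fun _ => hy⟩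
    · exact ⟨0, fun h => absurd h hr⟩
  have hstable : ∀ (p : Baire) (P : ℝ[X]) (h : Baire) (A : TopologicalSpace.Closeds unitInterval)
      (q : Baire) (a : unitInterval) (k : Baire) (y : unitInterval), h ∈ H p → IsName h A →
      a ∈ A → IsName q a → k ∈ K (interleave p q) → IsName k y →
      ∃ t, ∀ (p' : Baire) (P' : ℝ[X]) (h' : Baire) (A' : TopologicalSpace.Closeds unitInterval),
        IsName p' P' → (∀ k < t, p' k = p k) → h' ∈ H p' → IsName h' A' → (AoUC A').Nonempty →
        (∀ q, ∀ w ∈ AoUC A', IsName q w → ∃ k ∈ K (interleave p' q), ∃ y ∈ BRoot P', IsName k y) →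
        ((A' : Set unitInterval) = Set.univ ∨ (A : Set unitInterval) = {a}) →
        ∃ y' ∈ BRoot P', |(y' : ℝ) - y| < 1 / 2 := by
    intro p P h A q a k y hh hA ha hq hk hy
    obtain ⟨t₁, ht₁⟩ := hK.continuous hk 4
    obtain ⟨ε, hε, hε0⟩ := ((exists_isName_real hq t₁).and self_mem_nhdsWithin).exists
    have hε0 : 0 < ε := hε0
    obtain ⟨t₂, ht₂⟩ : ∃ t, (A : Set unitInterval) = {a} →
        ∀ (h' : Baire) (A' : TopologicalSpace.Closeds unitInterval), IsName h' A' →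
        (∀ k < t, h' k = h k) → (A' : Set unitInterval) ⊆ Metric.ball a ε := by
      by_cases hAa : (A : Set unitInterval) = {a}
      · obtain ⟨t, ht⟩ := exists_forall_mem_of_isName hA (Metric.isOpen_ball (x := a) (ε := ε))
          (by rw [hAa, Set.singleton_subset_iff]; exact Metric.mem_ball_self hε0)
        exact ⟨t, fun _ => ht⟩
      · exact ⟨0, fun h => absurd h hAa⟩
    obtain ⟨t₃, ht₃⟩ := hH.continuous hh t₂
    refine ⟨max t₁ t₃, fun p' P' h' A' hp' hpp hh' hA' hne' hans hor => ?_⟩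
    obtain ⟨w, hw, hwa⟩ : ∃ w ∈ AoUC A', |(w : ℝ) - a| < ε := by
      rcases hor with hu | hs
      · refine ⟨a, ⟨Or.inl hu, ?_⟩, by simpa using hε0⟩
        rw [← SetLike.mem_coe, hu]
        trivial
      · obtain ⟨w, hw⟩ := hne'
        refine ⟨w, hw, ?_⟩
        have := ht₂ hs h' A' hA' (ht₃ p' h' (fun k hk => hpp k (lt_max_of_lt_right hk)) hh') hw.2
        rwa [Metric.mem_ball, Subtype.dist_eq, Real.dist_eq] at this
    obtain ⟨q', hq', hqq⟩ := hε w hwa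
    obtain ⟨k', hk', y', hy', hky'⟩ := hans q' w hw hq'
    refine ⟨y', hy', ?_⟩
    have h3 := ht₁ _ k' (interleave_congr (fun k hk => hpp k (lt_max_of_lt_left hk)) hqq) hk' 3
      (by norm_num)
    have := abs_sub_lt_of_isName (x := y) (y := y') hy hky' h3
    norm_num at this ⊢
    linarith
  obtain ⟨p₀, hp₀⟩ := surj (threeRoots 0)
  obtain ⟨h₀, hh₀, A₀, hA₀, ⟨a₀, ha₀⟩, hans₀⟩ := hred p₀ _ hp₀ (hne _)
  obtain ⟨q₀, hq₀⟩ := surj a₀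
  obtain ⟨k₀, hk₀, y₀, hy₀, hky₀⟩ := hans₀ q₀ a₀ ha₀ hq₀
  obtain ⟨i, hi, -⟩ := exists_of_mem_bRoot_threeRoots (j := 0) (fun _ => le_rfl) rfl hy₀
  obtain ⟨t₀, ht₀⟩ := hstable p₀ (threeRoots 0) h₀ A₀ q₀ a₀ k₀ y₀ hh₀ hA₀ ha₀.2 hq₀ hk₀ hky₀
  obtain ⟨R₀, hR₀, hupd₀⟩ := threeRoots_update (e := 0) (i := i) rfl
  obtain ⟨ε, hε, p₁, hp₁, hpp₁⟩ := exists_isName_polynomial hp₀ hR₀ t₀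
  rw [← hupd₀] at hp₁
  set e₁ : Fin 3 → ℝ := Function.update 0 i ε with he₁
  have he₁0 : ∀ j, 0 ≤ e₁ j := fun j => by
    by_cases hj : j = i
    · rw [hj, he₁, Function.update_self]; exact hε.le
    · rw [he₁, Function.update_of_ne hj]; exact le_rfl
  have he₁i : e₁ i ≠ 0 := by rw [he₁, Function.update_self]; exact hε.ne'
  have he₁j : ∀ j, j ≠ i → e₁ j = 0 := fun j hj => by rw [he₁, Function.update_of_ne hj]; rfl
  obtain ⟨h₁, hh₁, A₁, hA₁, hne₁, hans₁⟩ := hred p₁ _ hp₁ (hne _)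
  obtain ⟨j₀, hj₀, l, hl⟩ : ∃ j₀, j₀ ≠ i ∧ ∃ l, l ≠ i ∧ l ≠ j₀ :=
    (show ∀ i : Fin 3, ∃ j₀, j₀ ≠ i ∧ ∃ l, l ≠ i ∧ l ≠ j₀ by decide) i
  have hA₁u : (A₁ : Set unitInterval) ≠ Set.univ := by
    intro hu
    obtain ⟨y₁, hy₁, hd⟩ := ht₀ p₁ _ h₁ A₁ hp₁ hpp₁ hh₁ hA₁ hne₁ hans₁ (Or.inl hu)
    obtain ⟨j, hj, hej⟩ := exists_of_mem_bRoot_threeRoots he₁0 (he₁j j₀ hj₀) hy₁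
    rw [hj, hi] at hd
    exact he₁i (eq_of_abs_sub_lt hd ▸ hej)
  obtain ⟨a₁, ha₁⟩ := hne₁
  obtain ⟨q₁, hq₁⟩ := surj a₁
  obtain ⟨k₁, hk₁, y₁, hy₁, hky₁⟩ := hans₁ q₁ a₁ ha₁ hq₁
  have hA₁s : (A₁ : Set unitInterval) = {a₁} := by
    rcases ha₁.1 with hu | ⟨b, hb⟩
    · exact absurd hu hA₁u
    · have := ha₁.2
      rw [← SetLike.mem_coe, hb] at this
      rw [hb, Set.mem_singleton_iff.1 this]
  obtain ⟨j, hj, hej⟩ := exists_of_mem_bRoot_threeRoots he₁0 (he₁j j₀ hj₀) hy₁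
  obtain ⟨t₁, ht₁⟩ := hstable p₁ (threeRoots e₁) h₁ A₁ q₁ a₁ k₁ y₁ hh₁ hA₁ ha₁.2 hq₁ hk₁ hky₁
  obtain ⟨R₁, hR₁, hupd₁⟩ := threeRoots_update hej
  obtain ⟨δ, hδ, p₂, hp₂, hpp₂⟩ := exists_isName_polynomial hp₁ hR₁ t₁
  rw [← hupd₁] at hp₂
  set e₂ : Fin 3 → ℝ := Function.update e₁ j δ with he₂
  have he₂0 : ∀ m, 0 ≤ e₂ m := fun m => by
    by_cases hm : m = j
    · rw [hm, he₂, Function.update_self]; exact hδ.le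
    · rw [he₂, Function.update_of_ne hm]; exact he₁0 m
  have he₂j : e₂ j ≠ 0 := by rw [he₂, Function.update_self]; exact hδ.ne'
  obtain ⟨l', hl'⟩ : ∃ l', e₂ l' = 0 := by
    by_cases hlj : l = j
    · refine ⟨j₀, ?_⟩
      rw [he₂, Function.update_of_ne (fun h => hl.2 (hlj.trans h.symm)), he₁j j₀ hj₀]
    · exact ⟨l, by rw [he₂, Function.update_of_ne hlj, he₁j l hl.1]⟩
  obtain ⟨h₂, hh₂, A₂, hA₂, hne₂, hans₂⟩ := hred p₂ _ hp₂ (hne _)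
  obtain ⟨y₂, hy₂, hd⟩ := ht₁ p₂ _ h₂ A₂ hp₂ hpp₂ hh₂ hA₂ hne₂ hans₂ (Or.inr hA₁s)
  obtain ⟨m, hm, hem⟩ := exists_of_mem_bRoot_threeRoots he₂0 hl' hy₂
  rw [hm, hj] at hd
  exact he₂j (eq_of_abs_sub_lt hd ▸ hem)

/-! ### Parallel all-or-unique choice does not reduce to bounded root finding -/

theorem abs_eval_sub_lt_of_isName {h : Baire} {P : ℝ[X]} (hP : IsName h P) {c : ℝ} (hc : 0 < c) :
    ∃ t, ∀ h' P', IsName h' P' → (∀ k < t, h' k = h k) →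
      ∀ x ∈ Set.Icc (0 : ℝ) 1, |eval x P' - eval x P| < c := by
  have hd : (0 : ℝ) < (h 0 : ℝ) + 1 := by positivity
  obtain ⟨n, hn⟩ := exists_pow_lt_of_lt_one (show 0 < c / (2 * ((h 0 : ℝ) + 1)) by positivity)
    (show (2⁻¹ : ℝ) < 1 by norm_num)
  refine ⟨Nat.pair (h 0) n + 2, fun h' P' hP' hh x hx => ?_⟩
  have h0 : h' 0 = h 0 := hh 0 (by omega)
  have hP'd : P'.natDegree < h 0 + 1 := Nat.lt_succ_of_le (h0 ▸ hP'.1)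
  rw [eval_eq_sum_range' hP'd, eval_eq_sum_range' (Nat.lt_succ_of_le hP.1),
    ← Finset.sum_sub_distrib]
  have hterm : ∀ i ∈ Finset.range (h 0 + 1),
      |P'.coeff i * x ^ i - P.coeff i * x ^ i| ≤ 2 * 2⁻¹ ^ n := by
    intro i hi
    have hi' : i ≤ h 0 := Nat.lt_succ_iff.1 (Finset.mem_range.1 hi)
    have hpair : Nat.pair i n ≤ Nat.pair (h 0) n := by
      rcases hi'.lt_or_eq with h | rfl
      exacts [(Nat.pair_lt_pair_left n h).le, le_rfl]
    have h1 := abs_sub_lt_of_isName (hP.2 i hi') (hP'.2 i (h0 ▸ hi')) (n := n)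
      (hh _ (by omega))
    rw [← sub_mul, abs_mul, abs_of_nonneg (pow_nonneg hx.1 i)]
    exact (mul_le_of_le_one_right (abs_nonneg _) (pow_le_one₀ hx.1 hx.2)).trans h1.le
  refine (Finset.abs_sum_le_sum_abs _ _).trans_lt ((Finset.sum_le_sum hterm).trans_lt ?_)
  rw [Finset.sum_const, Finset.card_range, nsmul_eq_mul]
  rw [lt_div_iff₀ (by positivity)] at hn
  push_cast
  linarith

/-- Near a nonzero polynomial, bounded root finding always has an answer close to one of finitely
many valid answers. -/
theorem exists_finite_answers {h : Baire} {P : ℝ[X]} (hP : IsName h P) (hP0 : P ≠ 0) :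
    ∃ Z : Set unitInterval, Z.Finite ∧ Z.Nonempty ∧ (∀ z ∈ Z, z ∈ BRoot P) ∧
      ∀ ε > 0, ∃ t, ∀ h' P', IsName h' P' → (∀ k < t, h' k = h k) →
        ∃ y ∈ BRoot P', ∃ z ∈ Z, |(y : ℝ) - z| < ε := by
  classical
  let Z₀ : Set unitInterval := {x | P.eval (x : ℝ) = 0}
  have hfin : Z₀.Finite := by
    refine Set.Finite.preimage Subtype.val_injective.injOn (s := {x : ℝ | P.IsRoot x}) ?_
    exact finite_setOfPred_isRoot hP0
  let Z : Set unitInterval := if Z₀.Nonempty then Z₀ else {0}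
  have hZ₀ : Z₀ ⊆ Z := by
    by_cases hne : Z₀.Nonempty
    · simp only [Z, if_pos hne]; exact subset_rfl
    · rw [Set.not_nonempty_iff_eq_empty.1 hne]; exact Set.empty_subset _
  have hZne : Z.Nonempty := by
    by_cases hne : Z₀.Nonempty
    · exact hne.mono hZ₀
    · simp only [Z, if_neg hne]; exact Set.singleton_nonempty _
  refine ⟨Z, ?_, hZne, ?_, fun ε hε => ?_⟩
  · by_cases hne : Z₀.Nonempty
    · simp only [Z, if_pos hne]; exact hfin
    · simp only [Z, if_neg hne]; exact Set.finite_singleton _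
  · intro z hz
    by_cases hne : Z₀.Nonempty
    · simp only [Z, if_pos hne] at hz
      exact fun _ => hz
    · exact fun hr => absurd hr hne
  · let S : Set unitInterval := {x | ∀ z ∈ Z, ε ≤ |(x : ℝ) - z|}
    have hS : IsCompact S := by
      have : S = ⋂ z ∈ Z, {x : unitInterval | ε ≤ |(x : ℝ) - z|} := by
        ext x; simp [S]
      rw [this]
      refine (isClosed_biInter fun z _ => ?_).isCompact
      exact isClosed_le continuous_const (by fun_prop)
    obtain ⟨c, hc0, hc⟩ : ∃ c > 0, ∀ x ∈ S, c ≤ |P.eval (x : ℝ)| := by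
      rcases S.eq_empty_or_nonempty with hSe | hSne
      · exact ⟨1, one_pos, by simp [hSe]⟩
      · obtain ⟨x, hx, hmin⟩ := hS.exists_isMinOn hSne
          (f := fun x : unitInterval => |P.eval (x : ℝ)|)
          (by fun_prop)
        refine ⟨|P.eval (x : ℝ)|, abs_pos.2 fun h0 => ?_, fun y hy => hmin hy⟩
        have := hx x (hZ₀ h0)
        simp only [sub_self, abs_zero] at this
        linarith
    obtain ⟨t, ht⟩ := abs_eval_sub_lt_of_isName hP hc0
    refine ⟨t, fun h' P' hP' hh => ?_⟩
    obtain ⟨z, hz⟩ := hZne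
    by_cases hr : ∃ y : unitInterval, P'.eval (y : ℝ) = 0
    · obtain ⟨y, hy⟩ := hr
      refine ⟨y, fun _ => hy, ?_⟩
      by_contra! hcon
      have h1 := hc y hcon
      have h2 := ht h' P' hP' hh y y.2
      rw [hy, zero_sub, abs_neg] at h2
      linarith
    · exact ⟨z, fun h => absurd h hr, z, hz, by simpa using hε⟩

theorem aoUC_singleton_nonempty (b : unitInterval) : (AoUC {b}).Nonempty :=
  ⟨b, Or.inr ⟨b, rfl⟩, rfl⟩

theorem eq_of_mem_aoUC_singleton {b y : unitInterval} (h : y ∈ AoUC {b}) : y = b := h.2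

theorem exists_two_mul_pow_lt {x y : unitInterval} (h : x ≠ y) :
    ∃ n : ℕ, 2 * (2⁻¹ : ℝ) ^ n < |(x : ℝ) - y| := by
  have h0 : 0 < |(x : ℝ) - y| := abs_pos.2 (sub_ne_zero.2 fun h' => h (Subtype.ext h'))
  obtain ⟨n, hn⟩ := exists_pow_lt_of_lt_one (half_pos h0) (show (2⁻¹ : ℝ) < 1 by norm_num)
  exact ⟨n, by linarith⟩

theorem not_parallel_aoUC_reducible_bRoot : ¬ Reducible (Parallel AoUC) BRoot := by
  intro hred
  obtain ⟨H, K, hH, hK, hred⟩ := reducible_iff.1 hred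
  have hzero : ∀ (p : Baire) (x : Fin 2 → TopologicalSpace.Closeds unitInterval) (h : Baire)
      (P : ℝ[X]), IsName p (⟨2, x⟩ : Σ n : ℕ, Fin n → TopologicalSpace.Closeds unitInterval) →
      x 1 = ⊤ → (AoUC (x 0)).Nonempty → h ∈ H p → IsName h P →
      (∀ q, ∀ w ∈ BRoot P, IsName q w → ∃ k ∈ K (interleave p q),
        ∃ y ∈ Parallel AoUC ⟨2, x⟩, IsName k y) → P = 0 := by
    intro p x h P hp hx1 hx0 hh hP hans
    by_contra hP0
    obtain ⟨Z, hZ, hZne, hZP, hclose⟩ := exists_finite_answers hP hP0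
    have h1 : ∀ z ∈ Z, ∃ q, IsName q z ∧ ∃ k ∈ K (interleave p q), ∃ b : unitInterval,
        IsName (component k 1) b := by
      intro z hz
      obtain ⟨q, hq⟩ := surj z
      obtain ⟨k, hk, -, ⟨y, rfl, -⟩, -, hy⟩ := hans q z (hZP z hz) hq
      exact ⟨q, hq, k, hk, y 1, hy 1⟩
    choose! q hq k hk b hb using h1
    obtain ⟨b', hb'⟩ : ∃ b', b' ∉ b '' Z :=
      haveI : Infinite unitInterval := (Set.Icc_infinite zero_lt_one).to_subtype
      (hZ.image b).exists_notMem
    have h2 : ∀ z ∈ Z, ∃ t : ℕ, ∀ᶠ ε in 𝓝[>] (0 : ℝ), ∀ p' : Baire, (∀ i < t, p' i = p i) →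
        ∀ w : ℝ, |w - z| < ε → ∃ q', IsName q' w ∧ ∀ k' ∈ K (interleave p' q'),
          ¬ IsName (component k' 1) b' := by
      intro z hz
      obtain ⟨n, hn⟩ := exists_two_mul_pow_lt (x := b') (y := b z) fun h => hb' ⟨z, hz, h.symm⟩
      obtain ⟨t, ht⟩ := hK.continuous (hk z hz) (Nat.pair 1 n + 2)
      refine ⟨t, ?_⟩
      filter_upwards [exists_isName_real (hq z hz) t] with ε hε p' hpp w hw
      obtain ⟨q', hq', hqq⟩ := hε w hw
      refine ⟨q', hq', fun k' hk' hkb => ?_⟩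
      have h3 := ht _ k' (interleave_congr hpp hqq) hk' (Nat.pair 1 n + 1) (by omega)
      exact (abs_sub_lt_of_isName (x := b z) (y := b') (hb z hz) hkb h3).not_gt hn
    choose! t ht using h2
    obtain ⟨T, hT⟩ := (hZ.image t).bddAbove
    obtain ⟨ε, hε, hε0⟩ := (((eventually_all_finite hZ).2 ht).and self_mem_nhdsWithin).exists
    obtain ⟨s, hs⟩ := hclose ε hε0
    obtain ⟨s', hs'⟩ := hH.continuous hh s
    obtain ⟨p', hp', hpp⟩ := exists_isName_tuple hp hx1 {b'} (max T s')
    have hne : ∀ i : Fin 2, (AoUC (Function.update x 1 {b'} i)).Nonempty :=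
      Fin.forall_fin_two.2 ⟨by simpa using hx0, by simpa using aoUC_singleton_nonempty b'⟩
    obtain ⟨h', hh', P', hP', -, hans'⟩ := hred p' _ hp' (parallel_nonempty.2 hne)
    obtain ⟨w, hw, z, hz, hwz⟩ := hs h' P' hP'
      (hs' p' h' (fun i hi => hpp i (lt_max_of_lt_right hi)) hh')
    obtain ⟨q', hq', hno⟩ := hε z hz p' (fun i hi => hpp i (lt_max_of_lt_left
      (hi.trans_le (hT ⟨z, hz, rfl⟩)))) w hwz
    obtain ⟨k', hk', -, ⟨y, rfl, hy⟩, -, hky⟩ := hans' q' w hw hq'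
    refine hno k' hk' ?_
    have h3 := hy 1
    simp only [Function.update_self] at h3
    have h4 : IsName (component k' 1) (y 1) := hky 1
    rw [eq_of_mem_aoUC_singleton h3] at h4
    exact h4
  let x : Fin 2 → TopologicalSpace.Closeds unitInterval := fun _ => ⊤
  have htop : (AoUC ⊤).Nonempty := ⟨0, Or.inl rfl, trivial⟩
  obtain ⟨p, hp⟩ := surj (⟨2, x⟩ : Σ n : ℕ, Fin n → TopologicalSpace.Closeds unitInterval)
  obtain ⟨h, hh, P, hP, -, hans⟩ := hred p _ hp (parallel_nonempty.2 fun _ => htop)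
  obtain rfl : P = 0 := hzero p x h P hp rfl htop hh hP hans
  have hmem : (0 : unitInterval) ∈ BRoot 0 := fun _ => eval_zero
  obtain ⟨q, hq⟩ := surj (0 : unitInterval)
  obtain ⟨k, hk, -, ⟨y, rfl, -⟩, -, hky⟩ := hans q 0 hmem hq
  obtain ⟨b, hb⟩ := exists_ne (y 0)
  obtain ⟨n, hn⟩ := exists_two_mul_pow_lt hb
  obtain ⟨t, ht⟩ := hK.continuous hk (Nat.pair 0 n + 2)
  obtain ⟨p', hp', hpp⟩ := exists_isName_tuple hp (i := 0) rfl {b} t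
  have hne : ∀ i : Fin 2, (AoUC (Function.update x 0 {b} i)).Nonempty :=
    Fin.forall_fin_two.2 ⟨by simpa using aoUC_singleton_nonempty b, by simpa [x] using htop⟩
  obtain ⟨h', hh', P', hP', -, hans'⟩ := hred p' _ hp' (parallel_nonempty.2 hne)
  obtain rfl : P' = 0 := hzero p' _ h' P' hp' (by simp [x]) (hne 0) hh' hP' hans'
  obtain ⟨k', hk', -, ⟨y', rfl, hy'⟩, -, hky'⟩ := hans' q 0 hmem hq
  have h3 := hy' 0
  simp only [Function.update_self] at h3
  have h4 : IsName (component k' 0) (y' 0) := hky' 0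
  have h5 := ht _ k' (interleave_congr hpp fun _ _ => rfl) hk' (Nat.pair 0 n + 1) (by omega)
  have h6 := abs_sub_lt_of_isName (x := y 0) (y := y' 0) (hky 0) h4 h5
  rw [eq_of_mem_aoUC_singleton h3] at h6
  exact h6.not_gt hn

end Weihrauch

namespace Weihrauch

open RepresentedSpace Polynomial Filter Topology Set

/-! ### The instances of all-or-unique choice for a polynomial -/

/-- The index of the rational `1`. -/
def qone : ℕ := qmk 1 0 0

theorem ratOf_qone : ratOf qone = 1 := by simp [qone, ratOf_qmk]

/-- Does `s`, coding a precision `N`, an order `m` and a sign `(-1)ᵇ`, witness that the `m`-th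
derivative has the sign `(-1)ᵇ` on the unit interval? -/
def topCheck (o : ℕ → ℕ) (d s : ℕ) : Bool :=
  Nat.ble s.unpair.2.unpair.1 d &&
    signCheck o d s.unpair.1 s.unpair.2.unpair.1 s.unpair.2.unpair.2 0 qone

/-- Is the rational `x` in `[0, 1)`, and is it certainly below the `i`-th virtual root? -/
def cutBelow (o : ℕ → ℕ) (d s₀ i N x : ℕ) : Bool :=
  (!qlt x 0 && qlt x qone) && Nat.ble i (signCount o d N s₀.unpair.2.unpair.1 s₀.unpair.2.unpair.2
    false x s₀.unpair.2.unpair.1)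

/-- Is the rational `x` in `(0, 1]`, and is it certainly above the `i`-th virtual root? -/
def cutAbove (o : ℕ → ℕ) (d s₀ i N x : ℕ) : Bool :=
  (qlt 0 x && !qlt qone x) && Nat.ble (signCount o d N s₀.unpair.2.unpair.1 s₀.unpair.2.unpair.2
    true x s₀.unpair.2.unpair.1) i

/-- Does `t` witness that the `i`-th virtual root is not a root? -/
def exclCheck (o : ℕ → ℕ) (d s₀ i t : ℕ) : Bool :=
  ((!qlt t.unpair.2.unpair.1 0 && !qlt 0 t.unpair.2.unpair.1) ||
    cutBelow o d s₀ i t.unpair.1 t.unpair.2.unpair.1) &&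
  (((!qlt t.unpair.2.unpair.2.unpair.1 qone && !qlt qone t.unpair.2.unpair.2.unpair.1) ||
    cutAbove o d s₀ i t.unpair.1 t.unpair.2.unpair.2.unpair.1) &&
  signCheck o d t.unpair.1 0 t.unpair.2.unpair.2.unpair.2 t.unpair.2.unpair.1
    t.unpair.2.unpair.2.unpair.1)

/-- The intervals shrinking a set to the `i`-th virtual root. -/
def candidateInterval (o : ℕ → ℕ) (d s₀ i s : ℕ) : ℕ :=
  bif Nat.ble s.unpair.2.unpair.2 0 then
    bif cutBelow o d s₀ i s.unpair.1 s.unpair.2.unpair.1 then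
      Nat.pair (qmk 0 1 0) s.unpair.2.unpair.1 else 0
  else
    bif cutAbove o d s₀ i s.unpair.1 s.unpair.2.unpair.1 then
      Nat.pair s.unpair.2.unpair.1 (qmk 2 0 0) else 0

/-- The intervals shrinking a set to `0` if the virtual root number `c'` is seen first not to be a
root, and to `1` if the one number `c` is. -/
def comparisonInterval (o : ℕ → ℕ) (d s₀ c c' s : ℕ) : ℕ :=
  bif Nat.ble (firstHit (fun t => exclCheck o d s₀ c t || exclCheck o d s₀ c' t) s) 0 then 0 else
    bif exclCheck o d s₀ c'
        (firstHit (fun t => exclCheck o d s₀ c t || exclCheck o d s₀ c' t) s - 1) then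
      Nat.pair (qhalf s) (qmk 2 0 0)
    else Nat.pair (qmk 0 1 0) (qadd qone (qneg (qhalf s)))

theorem comparisonInterval_of_eq_zero {o : ℕ → ℕ} {d s₀ c c' s : ℕ}
    (h : firstHit (fun t => exclCheck o d s₀ c t || exclCheck o d s₀ c' t) s = 0) :
    comparisonInterval o d s₀ c c' s = 0 := by
  unfold comparisonInterval
  rw [h, show Nat.ble 0 0 = true from rfl, cond_true]

theorem comparisonInterval_of_eq_succ {o : ℕ → ℕ} {d s₀ c c' s t : ℕ}
    (h : firstHit (fun t => exclCheck o d s₀ c t || exclCheck o d s₀ c' t) s = t + 1) :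
    comparisonInterval o d s₀ c c' s =
      bif exclCheck o d s₀ c' t then Nat.pair (qhalf s) (qmk 2 0 0)
      else Nat.pair (qmk 0 1 0) (qadd qone (qneg (qhalf s))) := by
  unfold comparisonInterval
  rw [h, show Nat.ble (t + 1) 0 = false from rfl, cond_false, Nat.add_sub_cancel]

def rootIntervalAt (o : ℕ → ℕ) (d s₀ e s : ℕ) : ℕ :=
  bif Nat.blt e (d + 2) then candidateInterval o d s₀ e s
  else comparisonInterval o d s₀ (e - (d + 2)).unpair.1 (e - (d + 2)).unpair.2 s

/-- The `s`-th interval of the `e`-th instance of all-or-unique choice. -/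
def rootInterval (o : ℕ → ℕ) (d e s : ℕ) : ℕ :=
  bif Nat.ble (firstHit (topCheck o d) s) 0 then 0
  else rootIntervalAt o d (firstHit (topCheck o d) s - 1) e s

theorem rootInterval_of_eq_zero {o : ℕ → ℕ} {d s : ℕ} (h : firstHit (topCheck o d) s = 0) (e : ℕ) :
    rootInterval o d e s = 0 := by
  unfold rootInterval
  rw [h, show Nat.ble 0 0 = true from rfl, cond_true]

theorem rootInterval_of_eq_succ {o : ℕ → ℕ} {d s t : ℕ} (h : firstHit (topCheck o d) s = t + 1)
    (e : ℕ) : rootInterval o d e s = rootIntervalAt o d t e s := by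
  unfold rootInterval
  rw [h, show Nat.ble (t + 1) 0 = false from rfl, cond_false, Nat.add_sub_cancel]

section

variable {α : Type*} [Primcodable α]

@[fun_prop] theorem primrec_signCheck {o : α → ℕ → ℕ} {d N j e l u : α → ℕ}
    (ho : Primrec fun x : α × ℕ => o x.1 x.2) (hd : Primrec d) (hN : Primrec N) (hj : Primrec j)
    (he : Primrec e) (hl : Primrec l) (hu : Primrec u) :
    Primrec fun a => signCheck (o a) (d a) (N a) (j a) (e a) (l a) (u a) := by
  unfold signCheck qsign fallFactorial; fun_prop

@[fun_prop] theorem primrec_signCount {o : α → ℕ → ℕ} {d N m b x n : α → ℕ} (up : Bool)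
    (ho : Primrec fun x : α × ℕ => o x.1 x.2) (hd : Primrec d) (hN : Primrec N) (hm : Primrec m)
    (hb : Primrec b) (hx : Primrec x) (hn : Primrec n) :
    Primrec fun a => signCount (o a) (d a) (N a) (m a) (b a) up (x a) (n a) := by
  unfold signCount; fun_prop

@[fun_prop] theorem primrec_exclCheck {o : α → ℕ → ℕ} {d s₀ i t : α → ℕ}
    (ho : Primrec fun x : α × ℕ => o x.1 x.2) (hd : Primrec d) (hs : Primrec s₀)
    (hi : Primrec i) (ht : Primrec t) :
    Primrec fun a => exclCheck (o a) (d a) (s₀ a) (i a) (t a) := by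
  unfold exclCheck cutBelow cutAbove; fun_prop

@[fun_prop] theorem primrec_rootInterval {o : α → ℕ → ℕ} {d e s : α → ℕ}
    (ho : Primrec fun x : α × ℕ => o x.1 x.2) (hd : Primrec d) (he : Primrec e)
    (hs : Primrec s) : Primrec fun a => rootInterval (o a) (d a) (e a) (s a) := by
  unfold rootInterval rootIntervalAt candidateInterval comparisonInterval cutBelow cutAbove topCheck
  fun_prop

end

section

variable {o o' : ℕ → ℕ} {d s : ℕ}

theorem topCheck_congr (h : ∀ k < Nat.pair d s + 2, o k = o' k) {t : ℕ} (ht : t ≤ s) :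
    topCheck o d t = topCheck o' d t := by
  unfold topCheck
  rw [signCheck_congr h ((Nat.unpair_left_le t).trans ht)]

theorem cutBelow_congr (h : ∀ k < Nat.pair d s + 2, o k = o' k) {N : ℕ} (hN : N ≤ s) (s₀ i x : ℕ) :
    cutBelow o d s₀ i N x = cutBelow o' d s₀ i N x := by
  unfold cutBelow
  rw [signCount_congr h hN]

theorem cutAbove_congr (h : ∀ k < Nat.pair d s + 2, o k = o' k) {N : ℕ} (hN : N ≤ s) (s₀ i x : ℕ) :
    cutAbove o d s₀ i N x = cutAbove o' d s₀ i N x := by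
  unfold cutAbove
  rw [signCount_congr h hN]

theorem exclCheck_congr (h : ∀ k < Nat.pair d s + 2, o k = o' k) {t : ℕ} (ht : t ≤ s) (s₀ i : ℕ) :
    exclCheck o d s₀ i t = exclCheck o' d s₀ i t := by
  have := (Nat.unpair_left_le t).trans ht
  unfold exclCheck
  rw [cutBelow_congr h this, cutAbove_congr h this, signCheck_congr h this]

theorem rootInterval_congr (h : ∀ k < Nat.pair d s + 2, o k = o' k) (e : ℕ) :
    rootInterval o d e s = rootInterval o' d e s := by
  have h1 : firstHit (topCheck o d) s = firstHit (topCheck o' d) s :=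
    firstHit_congr fun t ht => topCheck_congr h ht.le
  have h2 : ∀ s₀ i, candidateInterval o d s₀ i s = candidateInterval o' d s₀ i s := by
    intro s₀ i
    unfold candidateInterval
    rw [cutBelow_congr h (Nat.unpair_left_le s), cutAbove_congr h (Nat.unpair_left_le s)]
  have h3 : ∀ s₀ c c', comparisonInterval o d s₀ c c' s = comparisonInterval o' d s₀ c c' s := by
    intro s₀ c c'
    have h4 : firstHit (fun t => exclCheck o d s₀ c t || exclCheck o d s₀ c' t) s =
        firstHit (fun t => exclCheck o' d s₀ c t || exclCheck o' d s₀ c' t) s :=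
      firstHit_congr fun t ht => by rw [exclCheck_congr h ht.le, exclCheck_congr h ht.le]
    rcases firstHit_spec (fun t => exclCheck o' d s₀ c t || exclCheck o' d s₀ c' t) s with
      ⟨h5, -⟩ | ⟨t, ht, h5, -⟩
    · rw [comparisonInterval_of_eq_zero h5, comparisonInterval_of_eq_zero (h4.trans h5)]
    · rw [comparisonInterval_of_eq_succ h5, comparisonInterval_of_eq_succ (h4.trans h5),
        exclCheck_congr h ht.le]
  unfold rootInterval rootIntervalAt
  rw [h1, h2, h3]

end

section

variable {p : Baire} {P : ℝ[X]}

theorem pos_of_topCheck (hp : IsName p P) {s : ℕ} (hs : topCheck p (p 0) s = true) :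
    s.unpair.2.unpair.1 ≤ p 0 ∧ ∀ x ∈ Icc (0 : ℝ) 1,
      0 < (-1) ^ s.unpair.2.unpair.2 * (derivative^[s.unpair.2.unpair.1] P).eval x := by
  rw [topCheck, Bool.and_eq_true, Nat.ble_eq] at hs
  refine ⟨hs.1, fun x hx => pos_of_signCheck hp hs.1 ?_ ?_ hs.2 ?_ ?_⟩
  · simp
  · simp [ratOf_qone]
  · simpa using hx.1
  · simpa [ratOf_qone] using hx.2

theorem exists_topCheck (hp : IsName p P) (hP : P ≠ 0) : ∃ s, topCheck p (p 0) s = true := by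
  have hlead : P.coeff P.natDegree ≠ 0 := by simpa using hP
  obtain ⟨b, hb⟩ : ∃ b : ℕ, 0 < (-1) ^ b * P.coeff P.natDegree := by
    rcases hlead.lt_or_gt with h | h
    · exact ⟨1, by linarith⟩
    · exact ⟨0, by linarith⟩
  have hbound : 0 < signBound P (p 0) P.natDegree b (ratOf 0 : ℚ) (ratOf qone : ℚ) := by
    rw [signBound, Finset.sum_eq_single_of_mem 0
      (Finset.mem_range.2 (by have := hp.1; omega))]
    · rw [pow_zero, pow_zero, min_self, mul_one, coeff_iterate_derivative_eq, zero_add,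
        fallFactorial_eq, mul_left_comm]
      exact mul_pos (by exact_mod_cast Nat.descFactorial_pos.2 le_rfl) hb
    · intro k _ hk
      rw [coeff_iterate_derivative_eq, coeff_eq_zero_of_natDegree_lt (p := P) (n := k + P.natDegree)
        (by omega)]
      simp
  obtain ⟨N, hN⟩ := (eventually_signCheck hp hbound).exists
  refine ⟨Nat.pair N (Nat.pair P.natDegree b), ?_⟩
  rw [topCheck]
  simp only [Nat.unpair_pair]
  rw [hN, Nat.ble_eq_true_of_le hp.1]
  rfl

end

section

variable {p : Baire} {P : ℝ[X]} {s₀ : ℕ} {z : ℕ → ℕ → ℝ}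

theorem lt_of_cutBelow (hp : IsName p P) (hm : s₀.unpair.2.unpair.1 ≤ p 0)
    (hz : IsVirtualRoots P s₀.unpair.2.unpair.1 s₀.unpair.2.unpair.2 z) {i N x : ℕ}
    (h : cutBelow p (p 0) s₀ i N x = true) :
    (0 : ℝ) ≤ ratOf x ∧ (ratOf x : ℝ) < z s₀.unpair.2.unpair.1 i := by
  simp only [cutBelow, Bool.and_eq_true, Bool.not_eq_true', Bool.eq_false_iff, ne_eq, qlt_iff,
    ratOf_zero, ratOf_qone, not_lt, Nat.ble_eq] at h
  obtain ⟨⟨h0, h1⟩, h2⟩ := h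
  have h0 : (0 : ℝ) ≤ ratOf x := by exact_mod_cast h0
  have h1 : (ratOf x : ℝ) < 1 := by exact_mod_cast h1
  exact ⟨h0, (hz.lt_of_signCount hp hm h0 h1 N le_rfl).trans_le
    ((hz.partition _ le_rfl).antitone h2)⟩

theorem gt_of_cutAbove (hp : IsName p P) (hm : s₀.unpair.2.unpair.1 ≤ p 0)
    (hz : IsVirtualRoots P s₀.unpair.2.unpair.1 s₀.unpair.2.unpair.2 z) {i N x : ℕ}
    (h : cutAbove p (p 0) s₀ i N x = true) :
    z s₀.unpair.2.unpair.1 i < (ratOf x : ℝ) ∧ (ratOf x : ℝ) ≤ 1 := by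
  simp only [cutAbove, Bool.and_eq_true, Bool.not_eq_true', Bool.eq_false_iff, ne_eq, qlt_iff,
    ratOf_zero, ratOf_qone, not_lt, Nat.ble_eq] at h
  obtain ⟨⟨h0, h1⟩, h2⟩ := h
  have h0 : (0 : ℝ) < ratOf x := by exact_mod_cast h0
  have h1 : (ratOf x : ℝ) ≤ 1 := by exact_mod_cast h1
  exact ⟨((hz.partition _ le_rfl).antitone h2).trans_lt (hz.signCount_lt hp hm h0 h1 N le_rfl), h1⟩

theorem eventually_cutBelow (hp : IsName p P) (hm : s₀.unpair.2.unpair.1 ≤ p 0)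
    (hz : IsVirtualRoots P s₀.unpair.2.unpair.1 s₀.unpair.2.unpair.2 z) {i x : ℕ}
    (h0 : (0 : ℝ) ≤ ratOf x) (h : (ratOf x : ℝ) < z s₀.unpair.2.unpair.1 i) :
    ∀ᶠ N in atTop, cutBelow p (p 0) s₀ i N x = true := by
  filter_upwards [hz.eventually_le_signCount hp hm h0 le_rfl] with N hN
  have h1 : (ratOf x : ℝ) < 1 := h.trans_le ((hz.partition _ le_rfl).mem_Icc i).2
  simp only [cutBelow, Bool.and_eq_true, Bool.not_eq_true', Bool.eq_false_iff, ne_eq, qlt_iff,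
    ratOf_zero, ratOf_qone, not_lt, Nat.ble_eq]
  exact ⟨⟨by exact_mod_cast h0, by exact_mod_cast h1⟩, hN i h⟩

theorem eventually_cutAbove (hp : IsName p P) (hm : s₀.unpair.2.unpair.1 ≤ p 0)
    (hz : IsVirtualRoots P s₀.unpair.2.unpair.1 s₀.unpair.2.unpair.2 z) {i x : ℕ}
    (h1 : (ratOf x : ℝ) ≤ 1) (h : z s₀.unpair.2.unpair.1 i < (ratOf x : ℝ)) :
    ∀ᶠ N in atTop, cutAbove p (p 0) s₀ i N x = true := by
  have h0 : (0 : ℝ) < ratOf x := ((hz.partition _ le_rfl).mem_Icc i).1.trans_lt h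
  filter_upwards [hz.eventually_signCount_le hp hm h0 h1 le_rfl] with N hN
  simp only [cutAbove, Bool.and_eq_true, Bool.not_eq_true', Bool.eq_false_iff, ne_eq, qlt_iff,
    ratOf_zero, ratOf_qone, not_lt, Nat.ble_eq]
  exact ⟨⟨by exact_mod_cast h0, by exact_mod_cast h1⟩, hN i h⟩

theorem eval_ne_zero_of_exclCheck (hp : IsName p P) (hm : s₀.unpair.2.unpair.1 ≤ p 0)
    (hz : IsVirtualRoots P s₀.unpair.2.unpair.1 s₀.unpair.2.unpair.2 z) {i t : ℕ}
    (h : exclCheck p (p 0) s₀ i t = true) : P.eval (z s₀.unpair.2.unpair.1 i) ≠ 0 := by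
  rw [exclCheck, Bool.and_eq_true, Bool.and_eq_true, Bool.or_eq_true, Bool.or_eq_true] at h
  obtain ⟨hl, hu, hs⟩ := h
  have hmem := (hz.partition _ le_rfl).mem_Icc i
  have hl' : (0 : ℝ) ≤ ratOf t.unpair.2.unpair.1 ∧
      (ratOf t.unpair.2.unpair.1 : ℝ) ≤ z s₀.unpair.2.unpair.1 i := by
    rcases hl with hl | hl
    · simp only [Bool.and_eq_true, Bool.not_eq_true', Bool.eq_false_iff, ne_eq, qlt_iff, ratOf_zero,
        not_lt] at hl
      rw [le_antisymm hl.2 hl.1, Rat.cast_zero]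
      exact ⟨le_rfl, hmem.1⟩
    · have := lt_of_cutBelow hp hm hz hl
      exact ⟨this.1, this.2.le⟩
  have hu' : z s₀.unpair.2.unpair.1 i ≤ (ratOf t.unpair.2.unpair.2.unpair.1 : ℝ) ∧
      (ratOf t.unpair.2.unpair.2.unpair.1 : ℝ) ≤ 1 := by
    rcases hu with hu | hu
    · simp only [Bool.and_eq_true, Bool.not_eq_true', Bool.eq_false_iff, ne_eq, qlt_iff, ratOf_qone,
        not_lt] at hu
      rw [le_antisymm hu.2 hu.1, Rat.cast_one]
      exact ⟨hmem.2, le_rfl⟩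
    · have := gt_of_cutAbove hp hm hz hu
      exact ⟨this.1.le, this.2⟩
  have hpos := pos_of_signCheck hp (Nat.zero_le _) hl'.1 hu'.2 hs hl'.2 hu'.1
  intro h0
  rw [Function.iterate_zero, id, h0, mul_zero] at hpos
  exact lt_irrefl _ hpos

theorem exists_index_between {a b : ℝ} (h : a < b) : ∃ x, a < (ratOf x : ℝ) ∧ (ratOf x : ℝ) < b := by
  obtain ⟨r, h1, h2⟩ := exists_rat_btwn h
  obtain ⟨x, rfl⟩ := ratOf_surjective r
  exact ⟨x, h1, h2⟩

theorem exists_exclCheck (hp : IsName p P) (hm : s₀.unpair.2.unpair.1 ≤ p 0)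
    (hz : IsVirtualRoots P s₀.unpair.2.unpair.1 s₀.unpair.2.unpair.2 z) {i : ℕ}
    (h : P.eval (z s₀.unpair.2.unpair.1 i) ≠ 0) : ∃ t, exclCheck p (p 0) s₀ i t = true := by
  have hmem := (hz.partition _ le_rfl).mem_Icc i
  obtain ⟨e, he⟩ : ∃ e : ℕ, 0 < (-1) ^ e * P.eval (z s₀.unpair.2.unpair.1 i) := by
    rcases h.lt_or_gt with h | h
    · exact ⟨1, by linarith⟩
    · exact ⟨0, by linarith⟩
  have hb : 0 < signBound P (p 0) 0 e (z s₀.unpair.2.unpair.1 i) (z s₀.unpair.2.unpair.1 i) := by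
    rw [signBound_self hp.1 (Nat.zero_le _)]
    exact he
  obtain ⟨δ, hδ, hball⟩ := Metric.eventually_nhds_iff.1
    ((continuous_signBound P (p 0) 0 e).continuousAt.eventually
      (lt_mem_nhds (a := 0) (b := signBound P (p 0) 0 e
        (z s₀.unpair.2.unpair.1 i, z s₀.unpair.2.unpair.1 i).1
        (z s₀.unpair.2.unpair.1 i, z s₀.unpair.2.unpair.1 i).2) hb))
  obtain ⟨l, hl, hlδ⟩ : ∃ l, (∀ᶠ N in atTop, ((!qlt l 0 && !qlt 0 l) ||
      cutBelow p (p 0) s₀ i N l) = true) ∧ |(ratOf l : ℝ) - z s₀.unpair.2.unpair.1 i| < δ := by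
    rcases hmem.1.eq_or_lt with h0 | h0
    · refine ⟨0, Eventually.of_forall fun N => by simp [Bool.eq_false_iff, qlt_iff], ?_⟩
      rw [← h0]
      simpa using hδ
    · obtain ⟨l, h1, h2⟩ := exists_index_between
        (max_lt (sub_lt_self _ hδ) h0 :
          max (z s₀.unpair.2.unpair.1 i - δ) 0 < z s₀.unpair.2.unpair.1 i)
      rw [max_lt_iff] at h1
      refine ⟨l, ?_, by rw [abs_lt]; constructor <;> linarith⟩
      filter_upwards [eventually_cutBelow hp hm hz h1.2.le h2] with N hN
      rw [hN, Bool.or_true]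
  obtain ⟨u, hu, huδ⟩ : ∃ u, (∀ᶠ N in atTop, ((!qlt u qone && !qlt qone u) ||
      cutAbove p (p 0) s₀ i N u) = true) ∧ |(ratOf u : ℝ) - z s₀.unpair.2.unpair.1 i| < δ := by
    rcases hmem.2.eq_or_lt with h0 | h0
    · refine ⟨qone, Eventually.of_forall fun N => by simp [Bool.eq_false_iff, qlt_iff], ?_⟩
      rw [h0, ratOf_qone]
      simpa using hδ
    · obtain ⟨u, h1, h2⟩ := exists_index_between
        (lt_min (lt_add_of_pos_right _ hδ) h0 :
          z s₀.unpair.2.unpair.1 i < min (z s₀.unpair.2.unpair.1 i + δ) 1)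
      rw [lt_min_iff] at h2
      refine ⟨u, ?_, by rw [abs_lt]; constructor <;> linarith⟩
      filter_upwards [eventually_cutAbove hp hm hz h2.2.le h1] with N hN
      rw [hN, Bool.or_true]
  have hlu : 0 < signBound P (p 0) 0 e (ratOf l) (ratOf u) := by
    refine hball (y := ((ratOf l : ℝ), (ratOf u : ℝ))) ?_
    rw [Prod.dist_eq, Real.dist_eq, Real.dist_eq]
    exact max_lt hlδ huδ
  obtain ⟨N, ⟨h1, h2⟩, h3⟩ := ((hl.and hu).and (eventually_signCheck hp hlu)).exists
  refine ⟨Nat.pair N (Nat.pair l (Nat.pair u e)), ?_⟩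
  rw [exclCheck]
  simp only [Nat.unpair_pair]
  rw [h1, h2, h3]
  rfl

theorem candidateInterval_iff (hp : IsName p P) (hm : s₀.unpair.2.unpair.1 ≤ p 0)
    (hz : IsVirtualRoots P s₀.unpair.2.unpair.1 s₀.unpair.2.unpair.2 z) (i : ℕ) {x : ℝ}
    (hx : x ∈ Icc (0 : ℝ) 1) : x ≠ z s₀.unpair.2.unpair.1 i ↔ ∃ s, s₀ < s ∧
      x ∈ Ioo (ratOf (candidateInterval p (p 0) s₀ i s).unpair.1 : ℝ)
        (ratOf (candidateInterval p (p 0) s₀ i s).unpair.2 : ℝ) := by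
  have hmem := (hz.partition _ le_rfl).mem_Icc i
  have hneg : (ratOf (qmk 0 1 0) : ℝ) = -1 := by rw [ratOf_qmk]; norm_num
  have htwo : (ratOf (qmk 2 0 0) : ℝ) = 2 := by rw [ratOf_qmk]; norm_num
  constructor
  · intro hne
    rcases hne.lt_or_gt with h | h
    · obtain ⟨l, h1, h2⟩ := exists_index_between h
      obtain ⟨N, hN, hs⟩ := ((eventually_cutBelow hp hm hz (hx.1.trans h1.le) h2).and
        (eventually_gt_atTop s₀)).exists
      refine ⟨Nat.pair N (Nat.pair l 0), hs.trans_le (Nat.left_le_pair _ _), ?_⟩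
      unfold candidateInterval
      simp only [Nat.unpair_pair, show Nat.ble 0 0 = true from rfl, cond_true, hN, hneg]
      exact ⟨by linarith [hx.1], h1⟩
    · obtain ⟨u, h1, h2⟩ := exists_index_between h
      obtain ⟨N, hN, hs⟩ := ((eventually_cutAbove hp hm hz (h2.le.trans hx.2) h1).and
        (eventually_gt_atTop s₀)).exists
      refine ⟨Nat.pair N (Nat.pair u 1), hs.trans_le (Nat.left_le_pair _ _), ?_⟩
      unfold candidateInterval
      simp only [Nat.unpair_pair, show Nat.ble 1 0 = false from rfl, cond_true, cond_false, hN,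
        htwo]
      exact ⟨h2, by linarith [hx.2]⟩
  · rintro ⟨s, -, hs⟩ rfl
    unfold candidateInterval at hs
    cases h1 : Nat.ble s.unpair.2.unpair.2 0
    · rw [h1, cond_false] at hs
      cases h2 : cutAbove p (p 0) s₀ i s.unpair.1 s.unpair.2.unpair.1
      · rw [h2] at hs
        simp at hs
      · rw [h2, cond_true, Nat.unpair_pair] at hs
        exact (gt_of_cutAbove hp hm hz h2).1.not_gt hs.1
    · rw [h1, cond_true] at hs
      cases h2 : cutBelow p (p 0) s₀ i s.unpair.1 s.unpair.2.unpair.1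
      · rw [h2] at hs
        simp at hs
      · rw [h2, cond_true, Nat.unpair_pair] at hs
        exact (lt_of_cutBelow hp hm hz h2).2.not_gt hs.2

end

/-- The set described by `comparisonInterval`. -/
theorem exists_comparison (o : ℕ → ℕ) (d s₀ c c' : ℕ) :
    ∃ A : TopologicalSpace.Closeds unitInterval, (AoUC A).Nonempty ∧
      (∀ x : unitInterval, x ∉ A ↔ ∃ s, s₀ < s ∧
        (x : ℝ) ∈ Ioo (ratOf (comparisonInterval o d s₀ c c' s).unpair.1 : ℝ)
          (ratOf (comparisonInterval o d s₀ c c' s).unpair.2 : ℝ)) ∧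
      ((∀ t, exclCheck o d s₀ c t = false) → (∃ t, exclCheck o d s₀ c' t = true) → A = {0}) ∧
      ((∃ t, exclCheck o d s₀ c t = true) → (∀ t, exclCheck o d s₀ c' t = false) → A = {1}) := by
  classical
  have hneg : (ratOf (qmk 0 1 0) : ℝ) = -1 := by rw [ratOf_qmk]; norm_num
  have htwo : (ratOf (qmk 2 0 0) : ℝ) = 2 := by rw [ratOf_qmk]; norm_num
  have hhalf : ∀ s, (ratOf (qhalf s) : ℝ) = 2⁻¹ ^ s := fun s => by rw [ratOf_qhalf]; push_cast; rfl
  by_cases hex : ∃ t, (exclCheck o d s₀ c t || exclCheck o d s₀ c' t) = true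
  · set t₀ := Nat.find hex with ht₀
    have hspec : (exclCheck o d s₀ c t₀ || exclCheck o d s₀ c' t₀) = true := Nat.find_spec hex
    have hmin : ∀ t < t₀, (exclCheck o d s₀ c t || exclCheck o d s₀ c' t) = false :=
      fun t ht => Bool.eq_false_iff.2 (Nat.find_min hex ht)
    have hval : ∀ s, comparisonInterval o d s₀ c c' s = if s ≤ t₀ then 0 else
        bif exclCheck o d s₀ c' t₀ then Nat.pair (qhalf s) (qmk 2 0 0)
        else Nat.pair (qmk 0 1 0) (qadd qone (qneg (qhalf s))) := by
      intro s
      split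
      next h => exact comparisonInterval_of_eq_zero (firstHit_eq_zero fun t ht => hmin t (by omega))
      next h => exact comparisonInterval_of_eq_succ (firstHit_eq_succ (by omega) hspec hmin)
    have hpow : ∀ y : ℝ, 0 < y → ∃ s, s₀ < s ∧ ¬ s ≤ t₀ ∧ (2⁻¹ : ℝ) ^ s < y := by
      intro y hy
      have hlim : Tendsto (fun s : ℕ => (2⁻¹ : ℝ) ^ s) atTop (𝓝 0) :=
        tendsto_pow_atTop_nhds_zero_of_lt_one (by norm_num) (by norm_num)
      obtain ⟨s, ⟨h1, h2⟩, h3⟩ := (((hlim.eventually (gt_mem_nhds hy)).and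
        (eventually_gt_atTop s₀)).and (eventually_gt_atTop t₀)).exists
      exact ⟨s, h2, by omega, h1⟩
    cases hc' : exclCheck o d s₀ c' t₀
    · simp only [hc', cond_false] at hval
      refine ⟨{1}, ⟨1, Or.inr ⟨1, rfl⟩, rfl⟩, fun x => ?_, fun h _ => ?_, fun _ _ => rfl⟩
      · constructor
        · intro hx
          have hx1 : (x : ℝ) < 1 := lt_of_le_of_ne x.2.2 fun h => hx (Subtype.ext h)
          obtain ⟨s, hs, hst, hpows⟩ := hpow (1 - x) (by linarith)
          refine ⟨s, hs, ?_⟩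
          rw [hval, if_neg hst, Nat.unpair_pair, ratOf_qadd, ratOf_qneg, ratOf_qone, hneg]
          push_cast
          rw [hhalf]
          exact ⟨by linarith [x.2.1], by linarith⟩
        · rintro ⟨s, -, hs⟩ hx
          obtain rfl : x = 1 := hx
          rw [hval] at hs
          split at hs
          next => simp at hs
          next =>
            rw [Nat.unpair_pair, ratOf_qadd, ratOf_qneg, ratOf_qone] at hs
            have h2 := hs.2
            push_cast at h2
            rw [hhalf] at h2
            have : (0 : ℝ) < 2⁻¹ ^ s := by positivity
            linarith
      · rw [h t₀, hc'] at hspec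
        simp at hspec
    · simp only [hc', cond_true] at hval
      refine ⟨{0}, ⟨0, Or.inr ⟨0, rfl⟩, rfl⟩, fun x => ?_, fun _ _ => rfl, fun _ h => ?_⟩
      · constructor
        · intro hx
          have hx0 : (0 : ℝ) < x := lt_of_le_of_ne x.2.1 fun h => hx (Subtype.ext h.symm)
          obtain ⟨s, hs, hst, hpows⟩ := hpow x hx0
          refine ⟨s, hs, ?_⟩
          rw [hval, if_neg hst, Nat.unpair_pair, htwo, hhalf]
          exact ⟨hpows, by linarith [x.2.2]⟩
        · rintro ⟨s, -, hs⟩ hx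
          obtain rfl : x = 0 := hx
          rw [hval] at hs
          split at hs
          next => simp at hs
          next =>
            rw [Nat.unpair_pair, hhalf] at hs
            have h2 := hs.1
            have : (0 : ℝ) < 2⁻¹ ^ s := by positivity
            rw [show ((0 : unitInterval) : ℝ) = 0 from rfl] at h2
            linarith
      · rw [h t₀] at hc'
        simp at hc'
  · have hall : ∀ t, (exclCheck o d s₀ c t || exclCheck o d s₀ c' t) = false :=
      fun t => Bool.eq_false_iff.2 fun h => hex ⟨t, h⟩
    refine ⟨⊤, ⟨0, Or.inl rfl, trivial⟩, fun x => ?_, fun _ ⟨t, ht⟩ => ?_, fun ⟨t, ht⟩ _ => ?_⟩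
    · refine iff_of_false (fun h => h (Set.mem_univ x)) ?_
      rintro ⟨s, -, hs⟩
      rw [comparisonInterval_of_eq_zero (firstHit_eq_zero fun t _ => hall t)] at hs
      simp at hs
    · exact absurd ⟨t, by rw [ht, Bool.or_true]⟩ hex
    · exact absurd ⟨t, by rw [ht, Bool.true_or]⟩ hex

theorem exists_instances {p : Baire} {P : ℝ[X]} (hp : IsName p P) :
    ∃ A : ℕ → TopologicalSpace.Closeds unitInterval,
      (∀ e, IsName (fun s => rootInterval p (p 0) e s) (A e)) ∧ (∀ e, (AoUC (A e)).Nonempty) ∧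
      (P ≠ 0 → ∃ z : ℕ → unitInterval,
        (∀ x : unitInterval, P.eval (x : ℝ) = 0 → ∃ i ≤ p 0 + 1, z i = x) ∧
        (∀ i < p 0 + 2, A i = {z i}) ∧
        ∀ c c', P.eval (z c : ℝ) = 0 → P.eval (z c' : ℝ) ≠ 0 →
          A (p 0 + 2 + Nat.pair c c') = {0} ∧ A (p 0 + 2 + Nat.pair c' c) = {1}) := by
  classical
  by_cases hP : P = 0
  · refine ⟨fun _ => ⊤, fun e x => ?_, fun _ => ⟨0, Or.inl rfl, trivial⟩, fun h => absurd hP h⟩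
    refine iff_of_false (fun h => h (Set.mem_univ x)) ?_
    rintro ⟨s, hs⟩
    have h0 : firstHit (topCheck p (p 0)) s = 0 := firstHit_eq_zero fun t _ => by
      rw [Bool.eq_false_iff]
      intro ht
      have := (pos_of_topCheck hp ht).2 0 ⟨le_rfl, zero_le_one⟩
      rw [hP, iterate_derivative_zero, eval_zero, mul_zero] at this
      exact lt_irrefl _ this
    beta_reduce at hs
    rw [rootInterval_of_eq_zero h0] at hs
    simp at hs
  · have hex := exists_topCheck hp hP
    set s₀ := Nat.find hex
    have hs₀ : topCheck p (p 0) s₀ = true := Nat.find_spec hex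
    have hmin : ∀ t < s₀, topCheck p (p 0) t = false := fun t ht =>
      Bool.eq_false_iff.2 (Nat.find_min hex ht)
    obtain ⟨hm, hpos⟩ := pos_of_topCheck hp hs₀
    obtain ⟨z, hz⟩ := exists_isVirtualRoots hpos
    have hpart := hz.partition _ le_rfl
    let y : ℕ → unitInterval := fun i => ⟨z s₀.unpair.2.unpair.1 i, hpart.mem_Icc i⟩
    have hname : ∀ (e : ℕ) (A : TopologicalSpace.Closeds unitInterval),
        (∀ x : unitInterval, x ∉ A ↔ ∃ s, s₀ < s ∧
          (x : ℝ) ∈ Ioo (ratOf (rootIntervalAt p (p 0) s₀ e s).unpair.1 : ℝ)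
            (ratOf (rootIntervalAt p (p 0) s₀ e s).unpair.2 : ℝ)) →
        IsName (fun s => rootInterval p (p 0) e s) A := by
      intro e A hA x
      rw [hA]
      refine exists_congr fun s => ?_
      beta_reduce
      by_cases hs : s₀ < s
      · rw [rootInterval_of_eq_succ (firstHit_eq_succ hs hs₀ hmin)]
        simp only [hs, true_and]
      · rw [rootInterval_of_eq_zero (firstHit_eq_zero fun t ht => hmin t (by omega))]
        refine iff_of_false (fun h => hs h.1) fun h => ?_
        simp at h
    have hA : ∀ e, ∃ A : TopologicalSpace.Closeds unitInterval,
        IsName (fun s => rootInterval p (p 0) e s) A ∧ (AoUC A).Nonempty ∧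
        (e < p 0 + 2 → A = {y e}) ∧ ∀ c c', e = p 0 + 2 + Nat.pair c c' →
          (P.eval (y c : ℝ) = 0 → P.eval (y c' : ℝ) ≠ 0 → A = {0}) ∧
          (P.eval (y c : ℝ) ≠ 0 → P.eval (y c' : ℝ) = 0 → A = {1}) := by
      intro e
      by_cases he : e < p 0 + 2
      · refine ⟨{y e}, hname e _ fun x => ?_, ⟨y e, Or.inr ⟨_, rfl⟩, rfl⟩, fun _ => rfl,
          fun c c' h => by omega⟩
        unfold rootIntervalAt
        rw [blt_iff.2 he]
        rw [show x ∉ ({y e} : TopologicalSpace.Closeds unitInterval) ↔ (x : ℝ) ≠ y e from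
          not_congr (Subtype.ext_iff (a1 := x) (a2 := y e))]
        exact candidateInterval_iff hp hm hz e x.2
      · obtain ⟨A, hne, hA, h0, h1⟩ := exists_comparison p (p 0) s₀ (e - (p 0 + 2)).unpair.1
          (e - (p 0 + 2)).unpair.2
        refine ⟨A, hname e _ fun x => ?_, hne, fun h => absurd h he, fun c c' hcc => ?_⟩
        · rw [hA]
          unfold rootIntervalAt
          rw [show Nat.blt e (p 0 + 2) = false from Bool.eq_false_iff.2 fun h => he (blt_iff.1 h)]
          simp only [cond_false]
        · rw [hcc, Nat.add_sub_cancel_left, Nat.unpair_pair] at h0 h1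
          exact ⟨fun hc hc' => h0 (fun t => Bool.eq_false_iff.2 fun ht =>
              eval_ne_zero_of_exclCheck hp hm hz ht hc) (exists_exclCheck hp hm hz hc'),
            fun hc hc' => h1 (exists_exclCheck hp hm hz hc) fun t => Bool.eq_false_iff.2 fun ht =>
              eval_ne_zero_of_exclCheck hp hm hz ht hc'⟩
    choose A hAn hAne hAy hAc using hA
    refine ⟨A, hAn, hAne, fun _ => ⟨y, fun x hx => ?_, fun i hi => hAy i hi, fun c c' hc hc' =>
      ⟨(hAc _ c c' rfl).1 hc hc', (hAc _ c' c rfl).2 hc' hc⟩⟩⟩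
    obtain ⟨i, hi, hix⟩ := hpart.exists_eq x.2 (by
      rw [Nat.sub_self, Function.iterate_zero, id, hx, mul_zero])
    exact ⟨i, by omega, Subtype.ext hix⟩

end Weihrauch

namespace Weihrauch

open RepresentedSpace Polynomial

/-! ### Reducing bounded root finding to finitely many instances of all-or-unique choice -/

/-- A word function listing the instances of all-or-unique choice that solve a polynomial. -/
def rootInstancesEntry (w : List ℕ) (n : ℕ) : Option ℕ :=
  bif Nat.ble n 0 then
    bif Nat.blt 0 w.length then
      some (w.getD 0 0 + 2 + (w.getD 0 0 + 2) * (w.getD 0 0 + 2))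
    else none
  else
    bif Nat.blt (Nat.pair (w.getD 0 0) (n - 1).unpair.2 + 1) w.length then
      some (rootInterval (fun k => w.getD k 0) (w.getD 0 0) (n - 1).unpair.1 (n - 1).unpair.2)
    else none

theorem primrec_rootInstancesEntry :
    Primrec fun x : List ℕ × ℕ => rootInstancesEntry x.1 x.2 := by
  unfold rootInstancesEntry
  fun_prop

theorem rootInstancesEntry_zero {p : Baire} {m v : ℕ}
    (h : rootInstancesEntry (initialWord p m) 0 = some v) :
    v = p 0 + 2 + (p 0 + 2) * (p 0 + 2) := by
  unfold rootInstancesEntry at h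
  rw [length_initialWord, show Nat.ble 0 0 = true from rfl, cond_true] at h
  cases hm : Nat.blt 0 m
  · rw [hm, cond_false] at h; simp at h
  · rw [hm, cond_true, getD_initialWord (blt_iff.1 hm)] at h
    exact (Option.some.inj h).symm

theorem rootInstancesEntry_succ {p : Baire} {m v e s : ℕ}
    (h : rootInstancesEntry (initialWord p m) (Nat.pair e s + 1) = some v) :
    v = rootInterval p (p 0) e s := by
  unfold rootInstancesEntry at h
  rw [length_initialWord, show Nat.ble (Nat.pair e s + 1) 0 = false from rfl, cond_false,
    Nat.add_sub_cancel, Nat.unpair_pair] at h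
  cases hm : Nat.blt (Nat.pair ((initialWord p m).getD 0 0) s + 1) m
  · simp only [hm, cond_false] at h; simp at h
  · have hm' := blt_iff.1 hm
    simp only [hm, cond_true] at h
    have h0 : (initialWord p m).getD 0 0 = p 0 := getD_initialWord (by omega)
    rw [h0] at h hm'
    rw [← Option.some.inj h]
    exact rootInterval_congr (fun k hk => getD_initialWord (by omega)) e

theorem exists_rootInstancesEntry (p : Baire) (n : ℕ) :
    ∃ m, (rootInstancesEntry (initialWord p m) n).isSome := by
  refine ⟨Nat.pair (p 0) (n - 1).unpair.2 + 2, ?_⟩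
  unfold rootInstancesEntry
  rw [length_initialWord, getD_initialWord (Nat.succ_pos _), blt_iff.2 (Nat.succ_pos _),
    blt_iff.2 (Nat.lt_succ_self _)]
  cases Nat.ble n 0 <;> rfl

/-- The winner among the candidates `0, …, n`, where the current winner `w` is replaced by `c` unless
the answer to the comparison of `w` with `c` is below `1/2`. -/
def knockout (q : ℕ → ℕ) (M n : ℕ) : ℕ :=
  Nat.rec 0 (fun c w => bif qlt (q (Nat.pair (M + Nat.pair w (c + 1)) 2 + 1)) (qmk 1 0 1) then w
    else c + 1) n

theorem knockout_succ (q : ℕ → ℕ) (M n : ℕ) : knockout q M (n + 1) =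
    bif qlt (q (Nat.pair (M + Nat.pair (knockout q M n) (n + 1)) 2 + 1)) (qmk 1 0 1) then
      knockout q M n else n + 1 := rfl

@[fun_prop] theorem primrec_knockout {α : Type*} [Primcodable α] {q : α → ℕ → ℕ} {M n : α → ℕ}
    (hq : Primrec fun x : α × ℕ => q x.1 x.2) (hM : Primrec M) (hn : Primrec n) :
    Primrec fun a => knockout (q a) (M a) (n a) := by
  unfold knockout; fun_prop

theorem knockout_le (q : ℕ → ℕ) (M n : ℕ) : knockout q M n ≤ n := by
  induction n with
  | zero => exact le_rfl
  | succ n ih =>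
    rw [knockout_succ]
    cases qlt (q (Nat.pair (M + Nat.pair (knockout q M n) (n + 1)) 2 + 1)) (qmk 1 0 1)
    · exact le_rfl
    · exact ih.trans (Nat.le_succ n)

theorem pair_lt_mul_self {a b M : ℕ} (ha : a < M) (hb : b < M) : Nat.pair a b < M * M := by
  refine (Nat.pair_lt_max_add_one_sq a b).trans_le ?_
  rw [sq]
  exact Nat.mul_le_mul (max_lt ha hb) (max_lt ha hb)

theorem knockout_congr {q q' : ℕ → ℕ} {M k n : ℕ}
    (h : ∀ j ≤ Nat.pair (M + M * M) (k + 2) + 1, q j = q' j) (hn : n < M) :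
    knockout q M n = knockout q' M n := by
  induction n with
  | zero => rfl
  | succ n ih =>
    have := pair_lt_mul_self ((knockout_le q' M n).trans_lt (Nat.lt_of_succ_lt hn)) hn
    rw [knockout_succ, knockout_succ, ih (Nat.lt_of_succ_lt hn),
      h _ (Nat.succ_le_succ (pair_le_pair (by omega) (by omega)))]

/-- If each comparison of a good with a bad candidate is decided correctly, the winner is good as
soon as there is a good candidate. -/
theorem knockout_spec {q : ℕ → ℕ} {M : ℕ} {good : ℕ → Prop} {n : ℕ}
    (h₀ : ∀ w c, w ≤ n → c ≤ n → good w → ¬ good c →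
      qlt (q (Nat.pair (M + Nat.pair w c) 2 + 1)) (qmk 1 0 1) = true)
    (h₁ : ∀ w c, w ≤ n → c ≤ n → ¬ good w → good c →
      qlt (q (Nat.pair (M + Nat.pair w c) 2 + 1)) (qmk 1 0 1) = false)
    (hex : ∃ c ≤ n, good c) : good (knockout q M n) := by
  induction n with
  | zero =>
    obtain ⟨c, hc, hg⟩ := hex
    obtain rfl : c = 0 := by omega
    exact hg
  | succ n ih =>
    have ih := ih (fun w c hw hc => h₀ w c (by omega) (by omega))
      fun w c hw hc => h₁ w c (by omega) (by omega)
    have hle := (knockout_le q M n).trans (Nat.le_succ n)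
    rw [knockout_succ]
    by_cases hw : good (knockout q M n)
    · by_cases hc : good (n + 1)
      · cases qlt (q (Nat.pair (M + Nat.pair (knockout q M n) (n + 1)) 2 + 1)) (qmk 1 0 1)
        · exact hc
        · exact hw
      · rw [h₀ _ _ hle le_rfl hw hc]
        exact hw
    · have hc : good (n + 1) := by
        obtain ⟨c, hc, hg⟩ := hex
        rcases hc.lt_or_eq with hc | rfl
        · exact absurd (ih ⟨c, by omega, hg⟩) hw
        · exact hg
      rw [h₁ _ _ hle le_rfl hw hc]
      exact hc

/-- A word function reading off the root from the solutions of the instances. -/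
def rootEntry (w : List ℕ) (n : ℕ) : Option ℕ :=
  bif Nat.blt (2 * (Nat.pair (w.getD 0 0 + 2 + (w.getD 0 0 + 2) * (w.getD 0 0 + 2)) (n + 2) + 1) + 1)
      w.length then
    some (w.getD (2 * (Nat.pair (knockout (fun k => w.getD (2 * k + 1) 0) (w.getD 0 0 + 2)
      (w.getD 0 0 + 1)) n + 1) + 1) 0)
  else none

theorem primrec_rootEntry : Primrec fun x : List ℕ × ℕ => rootEntry x.1 x.2 := by
  unfold rootEntry
  fun_prop

theorem rootEntry_interleave {p q : Baire} {m n v : ℕ}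
    (h : rootEntry (initialWord (interleave p q) m) n = some v) :
    v = component q (knockout q (p 0 + 2) (p 0 + 1)) n := by
  unfold rootEntry at h
  rw [length_initialWord] at h
  set d := (initialWord (interleave p q) m).getD 0 0 with hd
  cases hm : Nat.blt (2 * (Nat.pair (d + 2 + (d + 2) * (d + 2)) (n + 2) + 1) + 1) m
  · rw [hm, cond_false] at h; simp at h
  have hm' := blt_iff.1 hm
  have hdp : d = p 0 := by
    rw [hd, getD_initialWord (by omega)]
    exact interleave_even_apply p q 0
  have hq : ∀ j ≤ Nat.pair (d + 2 + (d + 2) * (d + 2)) (n + 2) + 1,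
      (initialWord (interleave p q) m).getD (2 * j + 1) 0 = q j := fun j hj => by
    rw [getD_initialWord (by omega), interleave_odd_apply]
  rw [hm, cond_true, knockout_congr hq (by omega)] at h
  have hle := knockout_le q (d + 2) (d + 1)
  rw [hq _ (Nat.succ_le_succ (pair_le_pair (by omega) (by omega)))] at h
  rw [← hdp, ← Option.some.inj h]
  rfl

theorem exists_rootEntry (r : Baire) (n : ℕ) : ∃ m, (rootEntry (initialWord r m) n).isSome := by
  refine ⟨2 * (Nat.pair (r 0 + 2 + (r 0 + 2) * (r 0 + 2)) (n + 2) + 1) + 2, ?_⟩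
  unfold rootEntry
  rw [length_initialWord, getD_initialWord (Nat.succ_pos _), blt_iff.2 (Nat.lt_succ_self _)]
  rfl

theorem bRoot_reducible_parallel_aoUC : Reducible BRoot (Parallel AoUC) := by
  obtain ⟨H, hH, hHs⟩ := exists_isComputable_of_search primrec_rootInstancesEntry.to_comp
  obtain ⟨K, hK, hKs⟩ := exists_isComputable_of_search primrec_rootEntry.to_comp
  refine reducible_iff.2 ⟨H, K, hH, hK, fun p P hp _ => ?_⟩
  obtain ⟨h, hh, hhs⟩ := hHs p (exists_rootInstancesEntry p)
  obtain ⟨A, hA, hne, hroots⟩ := exists_instances hp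
  set M := p 0 + 2 with hM
  refine ⟨h, hh, ⟨M + M * M, fun e => A e⟩, ⟨?_, fun e => ?_⟩,
    parallel_nonempty.2 fun e => hne e, ?_⟩
  · obtain ⟨m, hm⟩ := hhs 0
    exact rootInstancesEntry_zero hm
  · have : component h e = fun s => rootInterval p (p 0) e s := by
      funext s
      obtain ⟨m, hm⟩ := hhs (Nat.pair e s + 1)
      exact rootInstancesEntry_succ hm
    rw [this]
    exact hA e
  rintro q _ ⟨y, rfl, hy⟩ ⟨-, hq⟩
  obtain ⟨k, hk, hks⟩ := hKs (interleave p q) (exists_rootEntry _)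
  have hwin : knockout q M (p 0 + 1) < M + M * M :=
    (knockout_le q M (p 0 + 1)).trans_lt (by omega)
  refine ⟨k, hk, y ⟨_, hwin⟩, fun hroot => ?_, ?_⟩
  · by_cases hP : P = 0
    · rw [hP, eval_zero]
    obtain ⟨z, hz, hAz, hcmp⟩ := hroots hP
    have hhalf : ratOf (qmk 1 0 1) = 1 / 2 := by rw [ratOf_qmk]; norm_num
    have hbit : ∀ w c, w ≤ p 0 + 1 → c ≤ p 0 + 1 → ∃ x : unitInterval, x ∈ A (M + Nat.pair w c) ∧
        |(ratOf (q (Nat.pair (M + Nat.pair w c) 2 + 1)) : ℝ) - x| < 2⁻¹ ^ 2 := by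
      intro w c hw hc
      have hlt : M + Nat.pair w c < M + M * M :=
        Nat.add_lt_add_left (pair_lt_mul_self (by omega) (by omega)) M
      exact ⟨y ⟨_, hlt⟩, (hy ⟨_, hlt⟩).2, hq ⟨_, hlt⟩ 2⟩
    have hgood : P.eval (z (knockout q M (p 0 + 1)) : ℝ) = 0 := by
      refine knockout_spec (good := fun c => P.eval (z c : ℝ) = 0) ?_ ?_ ?_
      · intro w c hw hc hgw hgc
        obtain ⟨x, hx, hqx⟩ := hbit w c hw hc
        rw [(hcmp w c hgw hgc).1] at hx
        obtain rfl : x = 0 := hx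
        rw [show ((0 : unitInterval) : ℝ) = 0 from rfl, abs_lt] at hqx
        rw [qlt_iff, hhalf]
        have : (ratOf (q (Nat.pair (M + Nat.pair w c) 2 + 1)) : ℝ) < ((1 / 2 : ℚ) : ℝ) := by
          push_cast
          linarith [hqx.2]
        exact_mod_cast this
      · intro w c hw hc hgw hgc
        obtain ⟨x, hx, hqx⟩ := hbit w c hw hc
        rw [(hcmp c w hgc hgw).2] at hx
        obtain rfl : x = 1 := hx
        rw [show ((1 : unitInterval) : ℝ) = 1 from rfl, abs_lt] at hqx
        rw [Bool.eq_false_iff, ne_eq, qlt_iff, hhalf, not_lt]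
        have : ((1 / 2 : ℚ) : ℝ) ≤ (ratOf (q (Nat.pair (M + Nat.pair w c) 2 + 1)) : ℝ) := by
          push_cast
          linarith [hqx.1]
        exact_mod_cast this
      · obtain ⟨x, hx⟩ := hroot
        obtain ⟨i, hi, rfl⟩ := hz x hx
        exact ⟨i, hi, hx⟩
    have hyz : y ⟨_, hwin⟩ ∈ A (knockout q M (p 0 + 1)) := (hy ⟨_, hwin⟩).2
    rw [hAz _ ((knockout_le q M (p 0 + 1)).trans_lt (by omega))] at hyz
    rw [show y ⟨_, hwin⟩ = z (knockout q M (p 0 + 1)) from hyz]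
    exact hgood
  · have : k = component q (knockout q M (p 0 + 1)) := by
      funext n
      obtain ⟨m, hm⟩ := hks n
      exact rootEntry_interleave hm
    rw [this]
    exact hq ⟨_, hwin⟩

end Weihrauch

theorem theorem2 :
    Weihrauch.StrictlyReducible Weihrauch.AoUC Weihrauch.BRoot ∧
    Weihrauch.StrictlyReducible Weihrauch.BRoot (Weihrauch.Parallel Weihrauch.AoUC) ∧
    Weihrauch.Equivalent (Weihrauch.Parallel Weihrauch.AoUC)
      (Weihrauch.Parallel Weihrauch.BRoot) :=
  ⟨⟨Weihrauch.aoUC_reducible_bRoot, Weihrauch.not_bRoot_reducible_aoUC⟩,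
    ⟨Weihrauch.bRoot_reducible_parallel_aoUC, Weihrauch.not_parallel_aoUC_reducible_bRoot⟩,
    ⟨Weihrauch.aoUC_reducible_bRoot.parallel, Weihrauch.bRoot_reducible_parallel_aoUC.parallel.trans
      Weihrauch.parallel_parallel_aoUC_reducible⟩⟩
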